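/- All spaces are compactly generated Hausdorff. Let $D$ be a small category enriched over such spaces. A $D$-space is an enriched functor from $D$ to spaces, and a $D$-orbit is a $D$-space $T$ with $\operatorname{colim}_D T=\{*\}$. Let $\mathcal O'$ be the full category on a finite set of $D$-orbits, and let $h\mathcal O'$ be its homotopy category: it has the same objects, and its morphisms are the equivariant homotopy classes of equivariant maps. Let $U(D)=\bigoplus_{[T]}\mathbb Z$ be the free abelian group on the isomorphism classes $[T]$ of objects of $h\mathcal O'$ (homotopy types of orbits). Let $X$ be a finite $D$-CW-complex of type $\mathcal O'$: it has a filtration $\varnothing=X_{-1}\subset X_0\subset X_1\subset\cdots$ with colimit $X$, each $X_n$ is obtained from $X_{n-1}$ by attaching cells $T\times e^n$ with $T\in\mathcal O'$ along maps $T\times\partial e^n\to X_{n-1}$, and there are finitely many cells in total. Its equivariant Euler characteristic is $\chi^D(X)=\sum_{\text{cells } T\times e^n}(-1)^n[T]\in U(D)$. Let $I$ be the isotropy ring: the free abelian group on the morphisms of $h\mathcal O'$, with $fg=f\circ g$ when the range of $g$ is the domain of $f$ and $fg=0$ otherwise; its unit is $\sum_T 1_T$. Let $Ab(I)$ be the quotient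 of the additive group $I$ by the subgroup generated by the commutators $ab-ba$. Let $\zeta I$ be the covariant functor $T\mapsto 1_TI$ on $h\mathcal O'$ with values in right $I$-modules. Let $\mathcal C_n(X)$ be the contravariant functor on $\mathcal O'$ $$\mathcal C_n(X)(T)=H_n\big(\hom_D(T,X_n),\hom_D(T,X_{n-1});\mathbb Z\big),$$ with the cellular boundary maps, and let $H^D_n(X;\zeta I)=H_n(\mathcal C_*(X)\otimes_{\mathcal O'}\zeta I)$, which is a right $I$-module. For a right $I$-module $M$ with a finite resolution $0\to P_k\to\cdots\to P_0\to M\to0$ by finitely generated projective modules, let $rk_{HS}(M)=\sum_j(-1)^j rk_{HS}(P_j)\in Ab(I)$ be its Hattori–Stallings rank. Let $\varphi:I\to U(D)$ be the additive augmentation with $\varphi(f)=[T]$ for an endomorphism $f:T\to T$ and $\varphi(h)=0$ for $h:T_1\to T_2$ with $T_1\neq T_2$. **Theorem.** There is a homomorphism $\psi:Ab(I)\to U(D)$ such that $\psi([1_T])=[T]$ for every $T$. If every module $H^D_n(X;\zeta I)$ has a Hattori–Stallings rank, then only finitely many of these ranks are non-zero, and the following hold. 1. If $\varphi$ vanishes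 on commutators, so that it induces a homomorphism $Ab(\varphi):Ab(I)\to U(D)$, then $$\chi^D(X)=Ab(\varphi)\Big(\sum_{n=0}^\infty(-1)^n\,rk_{HS}\,H^D_n(X;\zeta I)\Big).$$ 2. In all cases, for every homomorphism $\psi:Ab(I)\to U(D)$ such that $\psi([1_T])=[T]$ for every $T$, $$\chi^D(X)=\psi\Big(\sum_{n=0}^\infty(-1)^n\,rk_{HS}\,H^D_n(X;\zeta I)\Big).$$ -/

import Mathlib

open CategoryTheory Opposite Topology

universe u

noncomputable section

namespace EquivariantEuler

/-! ### Topologically enriched categories and diagrams of spaces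

Spaces are compactly generated Hausdorff spaces.  A map out of the product of two such spaces,
taken in that category, is continuous exactly when its composite with every pair of continuous
maps from one compact Hausdorff space is continuous. -/

/-- A small category enriched over compactly generated Hausdorff spaces. -/
class TopEnriched (D : Type u) [SmallCategory D] where
  top (a b : D) : TopologicalSpace (a ⟶ b)
  t2 : ∀ a b : D, T2Space (a ⟶ b)
  cg : ∀ a b : D, CompactlyGeneratedSpace (a ⟶ b)
  continuous_comp : ∀ (a b c : D) (K : Type u) [TopologicalSpace K] [CompactSpace K] [T2Space K]
    (f : C(K, a ⟶ b)) (g : C(K, b ⟶ c)), Continuous fun k => f k ≫ g k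

attribute [reducible] TopEnriched.top
attribute [instance] TopEnriched.top TopEnriched.t2 TopEnriched.cg

variable {D : Type u} [SmallCategory D]

/-- A `D`-space: an enriched functor from `D` to compactly generated Hausdorff spaces.  Equivariant
maps are the natural transformations of the underlying functors. -/
structure DSpace (D : Type u) [SmallCategory D] [TopEnriched D] where
  toFunctor : D ⥤ TopCat.{u}
  t2 : ∀ d, T2Space (toFunctor.obj d)
  cg : ∀ d, CompactlyGeneratedSpace (toFunctor.obj d)
  continuous_map : ∀ (d d' : D) (K : Type u) [TopologicalSpace K] [CompactSpace K] [T2Space K]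
    (f : C(K, d ⟶ d')) (x : C(K, toFunctor.obj d)), Continuous fun k => toFunctor.map (f k) (x k)

/-- Equivariant homotopy of equivariant maps `X ⟶ Y`: an equivariant map `X × [0,1] → Y` with the
prescribed ends. -/
def DHomotopic {X Y : D ⥤ TopCat.{u}} (f g : X ⟶ Y) : Prop :=
  ∃ H : ∀ d, C(X.obj d × unitInterval, Y.obj d),
    (∀ d x, H d (x, 0) = f.app d x) ∧ (∀ d x, H d (x, 1) = g.app d x) ∧
      ∀ (d d' : D) (a : d ⟶ d') (x : X.obj d) (t : unitInterval),
        H d' (X.map a x, t) = Y.map a (H d (x, t))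

/-- A `D`-orbit: a `D`-space whose colimit, in compactly generated Hausdorff spaces, is a point.
By the universal property: the cocones from `T` to a space `Y` are the constant ones, one for each
point of `Y`. -/
def IsOrbit [TopEnriched D] (T : DSpace D) : Prop :=
  ∀ (Y : Type u) [TopologicalSpace Y] [T2Space Y] [CompactlyGeneratedSpace Y]
    (g : ∀ d, C(T.toFunctor.obj d, Y)),
    (∀ (d d' : D) (a : d ⟶ d') (x : T.toFunctor.obj d), g d' (T.toFunctor.map a x) = g d x) →
      ∃! y : Y, ∀ d x, g d x = y

/-! ### Orbit categories -/

section OrbitCategory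

variable [TopEnriched D] {ι : Type u} (O : ι → DSpace D)

/-- The full subcategory of `D`-spaces on a family of orbits. -/
abbrev OrbitCat : Type u := InducedCategory (D ⥤ TopCat.{u}) fun i => (O i).toFunctor

/-- Homotopy of maps between orbits, as a relation on the morphisms of the orbit category. -/
def orbitHomotopic : HomRel (OrbitCat O) := fun _ _ f g => DHomotopic f.hom g.hom

/-- The homotopy orbit category: morphisms are homotopy classes of equivariant maps. -/
abbrev HoOrbitCat : Type u := CategoryTheory.Quotient (orbitHomotopic O)

/-- The projection from the orbit category to the homotopy orbit category. -/
abbrev toHo : OrbitCat O ⥤ HoOrbitCat O := CategoryTheory.Quotient.functor (orbitHomotopic O)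

/-- The object of the homotopy orbit category given by the `i`-th orbit. -/
abbrev hoObj (i : ι) : HoOrbitCat O := (toHo O).obj i

instance [Fintype ι] : Fintype (HoOrbitCat O) :=
  Fintype.ofEquiv ι (CategoryTheory.Quotient.equiv (orbitHomotopic O)).symm

end OrbitCategory

/-! ### Mapping spaces -/

section Kification

variable {A B : Type u}

lemma continuous_toCG [t : TopologicalSpace A] {K : Type u} [TopologicalSpace K] [CompactSpace K]
    [T2Space K] (g : C(K, A)) :
    Continuous[_, TopologicalSpace.compactlyGenerated.{u} A] g := by
  have h : Continuous[_, TopologicalSpace.compactlyGenerated.{u} A]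
      (fun p : (Σ (i : (S : CompHaus.{u}) × C(S, A)), i.fst) => p.1.2 p.2) :=
    continuous_coinduced_rng
  have h' := @Continuous.comp K _ A _ _ (TopologicalSpace.compactlyGenerated.{u} A) _ _ h
    (continuous_sigmaMk
      (σ := fun i : (S : CompHaus.{u}) × C(S, A) => (i.fst : Type u)) (i := ⟨CompHaus.of K, g⟩))
  exact h'

lemma continuous_cg_map [TopologicalSpace A] [TopologicalSpace B] {f : A → B}
    (hf : Continuous f) :
    Continuous[TopologicalSpace.compactlyGenerated.{u} A,
      TopologicalSpace.compactlyGenerated.{u} B] f :=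
  @continuous_from_compactlyGenerated.{u} A B _ (TopologicalSpace.compactlyGenerated.{u} B) f
    fun _ g => continuous_toCG ((⟨f, hf⟩ : C(A, B)).comp g)

end Kification

/-- The set of equivariant maps with the topology induced from the product of the compact-open
topologies. -/
abbrev mapTop (X Y : D ⥤ TopCat.{u}) : TopologicalSpace (X ⟶ Y) :=
  TopologicalSpace.induced (fun f d => ((f.app d).hom : C(X.obj d, Y.obj d))) inferInstance

/-- The space of equivariant maps `hom_D(X, Y)` in compactly generated spaces. -/
def mapSpace (X Y : D ⥤ TopCat.{u}) : TopCat.{u} :=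
  @TopCat.of (X ⟶ Y) (@TopologicalSpace.compactlyGenerated.{u} _ (mapTop X Y))

lemma continuous_mapTop_comp {X X' Y Y' : D ⥤ TopCat.{u}} (a : X' ⟶ X) (b : Y ⟶ Y') :
    Continuous[mapTop X Y, mapTop X' Y'] fun f : X ⟶ Y => a ≫ f ≫ b := by
  let _ := mapTop X Y
  refine continuous_induced_rng.2 (continuous_pi fun d => ?_)
  have h0 : Continuous fun (f : X ⟶ Y) (d : D) => ((f.app d).hom : C(X.obj d, Y.obj d)) :=
    continuous_induced_dom
  have h : Continuous fun f : X ⟶ Y => ((f.app d).hom : C(X.obj d, Y.obj d)) :=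
    (continuous_apply d).comp h0
  exact ((ContinuousMap.continuous_precomp (a.app d).hom).comp
    ((ContinuousMap.continuous_postcomp (b.app d).hom).comp h))

/-- The map of mapping spaces induced by `a : X' ⟶ X` and `b : Y ⟶ Y'`. -/
def mapSpaceMap {X X' Y Y' : D ⥤ TopCat.{u}} (a : X' ⟶ X) (b : Y ⟶ Y') :
    mapSpace X Y ⟶ mapSpace X' Y' :=
  letI := mapTop X Y
  letI := mapTop X' Y'
  @TopCat.ofHom _ _ (TopologicalSpace.compactlyGenerated.{u} (X ⟶ Y))
    (TopologicalSpace.compactlyGenerated.{u} (X' ⟶ Y'))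
    (@ContinuousMap.mk _ _ (TopologicalSpace.compactlyGenerated.{u} (X ⟶ Y))
      (TopologicalSpace.compactlyGenerated.{u} (X' ⟶ Y'))
      (fun f => a ≫ f ≫ b) (continuous_cg_map (continuous_mapTop_comp a b)))

/-- The orbit point space `T ↦ hom_D(T, X)` of `X`. -/
def orbitPoints [TopEnriched D] {ι : Type u} (O : ι → DSpace D) :
    (D ⥤ TopCat.{u}) ⥤ (OrbitCat O)ᵒᵖ ⥤ TopCat.{u} where
  obj X :=
    { obj := fun T => mapSpace (O T.unop).toFunctor X
      map := fun a => mapSpaceMap a.unop.hom (𝟙 X)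
      map_id := fun T => by
        ext (f : (O T.unop).toFunctor ⟶ X)
        exact (Category.id_comp _).trans (Category.comp_id f)
      map_comp := fun {T₁ T₂ T₃} a b => by
        ext (f : (O T₁.unop).toFunctor ⟶ X)
        change (b.unop.hom ≫ a.unop.hom) ≫ f ≫ 𝟙 X = b.unop.hom ≫ (a.unop.hom ≫ f ≫ 𝟙 X) ≫ 𝟙 X
        simp }
  map {X Y} b :=
    { app := fun T => mapSpaceMap (𝟙 _) b
      naturality := fun T₁ T₂ a => by
        ext (f : (O T₁.unop).toFunctor ⟶ X)
        change 𝟙 _ ≫ (a.unop.hom ≫ f ≫ 𝟙 X) ≫ b = a.unop.hom ≫ (𝟙 _ ≫ f ≫ b) ≫ 𝟙 Y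
        simp }
  map_id X := by
    ext T (f : (O T.unop).toFunctor ⟶ X)
    exact (Category.id_comp _).trans (Category.comp_id f)
  map_comp {X Y Z} a b := by
    ext T (f : (O T.unop).toFunctor ⟶ X)
    change 𝟙 _ ≫ f ≫ a ≫ b = 𝟙 _ ≫ (𝟙 _ ≫ f ≫ a) ≫ b
    simp

/-! ### `D`-CW-complexes -/

/-- The `D`-subspace of `X` on a family of subsets stable under the action of `D`. -/
def subDiagram (X : D ⥤ TopCat.{u}) (S : ∀ d, Set (X.obj d))
    (hS : ∀ (d d' : D) (a : d ⟶ d') (x : X.obj d), x ∈ S d → X.map a x ∈ S d') :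
    D ⥤ TopCat.{u} where
  obj d := TopCat.of (S d)
  map {d d'} a := TopCat.ofHom
    ⟨fun x => ⟨X.map a x.1, hS d d' a x.1 x.2⟩,
      ((X.map a).hom.continuous.comp continuous_subtype_val).subtype_mk _⟩
  map_id d := by ext x; simp
  map_comp a b := by ext x; simp

/-- The inclusion of a smaller `D`-subspace in a larger one. -/
def subDiagramIncl (X : D ⥤ TopCat.{u}) {S S' : ∀ d, Set (X.obj d)} (hS hS')
    (h : ∀ d, S d ⊆ S' d) : subDiagram X S hS ⟶ subDiagram X S' hS' where
  app d := TopCat.ofHom ⟨Set.inclusion (h d), continuous_inclusion (h d)⟩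
  naturality d d' a := by ext x; rfl

/-- The standard `n`-cell: the closed unit ball in Euclidean `n`-space. -/
abbrev Cell (n : ℕ) : Type := Metric.closedBall (0 : EuclideanSpace ℝ (Fin n)) 1

/-- An (absolute) `D`-CW-structure on `X` whose cells `T × eⁿ` have their orbits `T` in the family
`O`.  The `D`-subspace `skel n` is the skeleton `X_{n-1}`, so that `skel 0` is empty.  The field
`isQuotientMap` together with `existsUnique_cell` and the two preceding fields says that
`skel (n + 1)` is the push-out of `skel n` and the `n`-cells `T × eⁿ` along attaching maps
`T × ∂eⁿ → skel n`; the last two fields say that `X` is the colimit of its skeleta. -/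
structure DCWStructure [TopEnriched D] (X : DSpace D) {ι : Type u} (O : ι → DSpace D) where
  cell : ℕ → Type u
  orbit : ∀ {n}, cell n → ι
  skel : ℕ → ∀ d, Set (X.toFunctor.obj d)
  map_mem_skel : ∀ n (d d' : D) (a : d ⟶ d') (x : X.toFunctor.obj d),
    x ∈ skel n d → X.toFunctor.map a x ∈ skel n d'
  skel_zero : ∀ d, skel 0 d = ∅
  skel_subset : ∀ n d, skel n d ⊆ skel (n + 1) d
  charMap : ∀ {n} (c : cell n) (d : D),
    C((O (orbit c)).toFunctor.obj d × Cell n, X.toFunctor.obj d)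
  charMap_naturality : ∀ {n} (c : cell n) (d d' : D) (a : d ⟶ d')
    (t : (O (orbit c)).toFunctor.obj d) (x : Cell n),
    charMap c d' ((O (orbit c)).toFunctor.map a t, x) = X.toFunctor.map a (charMap c d (t, x))
  charMap_mem : ∀ {n} (c : cell n) d p, charMap c d p ∈ skel (n + 1) d
  charMap_mem_iff : ∀ {n} (c : cell n) d p,
    charMap c d p ∈ skel n d ↔ ‖(p.2 : EuclideanSpace ℝ (Fin n))‖ = 1
  existsUnique_cell : ∀ n d, ∀ y ∈ skel (n + 1) d, y ∉ skel n d →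
    ∃! q : Σ c : cell n, (O (orbit c)).toFunctor.obj d × Cell n, charMap q.1 d q.2 = y
  isQuotientMap : ∀ n d, IsQuotientMap
    (Sum.elim (Set.inclusion (skel_subset n d)) (fun q => ⟨charMap q.1 d q.2, charMap_mem q.1 d q.2⟩) :
      (skel n d ⊕ Σ c : cell n, (O (orbit c)).toFunctor.obj d × Cell n) → skel (n + 1) d)
  exists_mem_skel : ∀ d (x : X.toFunctor.obj d), ∃ n, x ∈ skel n d
  isClosed_of_skel : ∀ d (A : Set (X.toFunctor.obj d)),
    (∀ n, IsClosed ((↑) ⁻¹' A : Set (skel n d))) → IsClosed A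

namespace DCWStructure

variable [TopEnriched D] {X : DSpace D} {ι : Type u} {O : ι → DSpace D} (S : DCWStructure X O)

/-- The set of all cells. -/
abbrev Cells : Type u := Σ n, S.cell n

/-- The `n`-th stage of the filtration as a `D`-space. -/
def skelDiagram (n : ℕ) : D ⥤ TopCat.{u} :=
  subDiagram X.toFunctor (S.skel n) (S.map_mem_skel n)

/-- The inclusion of consecutive stages of the filtration. -/
def skelIncl (n : ℕ) : S.skelDiagram n ⟶ S.skelDiagram (n + 1) :=
  subDiagramIncl X.toFunctor _ _ (S.skel_subset n)

instance mono_orbitPoints_skelIncl (n : ℕ) (T : (OrbitCat O)ᵒᵖ) :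
    Mono (((orbitPoints O).map (S.skelIncl n)).app T) := by
  rw [TopCat.mono_iff_injective]
  intro (f : (O T.unop).toFunctor ⟶ S.skelDiagram n) (g : (O T.unop).toFunctor ⟶ S.skelDiagram n) h
  have h' : 𝟙 _ ≫ f ≫ S.skelIncl n = 𝟙 _ ≫ g ≫ S.skelIncl n := h
  simp only [Category.id_comp] at h'
  refine NatTrans.ext (funext fun d => ?_)
  ext x
  have h2 : (f ≫ S.skelIncl n).app d x = (g ≫ S.skelIncl n).app d x := by rw [h']
  exact Set.inclusion_injective (S.skel_subset n d) h2

end DCWStructure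

/-! ### Cellular chains of a filtered diagram of spaces -/

section Cellular

open Limits HomologicalComplex

/-- The integral singular chain complex of a space. -/
def singularChains : TopCat.{u} ⥤ ChainComplex (ModuleCat.{u} ℤ) ℕ :=
  (AlgebraicTopology.singularChainComplexFunctor (ModuleCat.{u} ℤ)).obj
    (ModuleCat.of ℤ (ULift.{u} ℤ))

instance : (singularChains.{u}).PreservesMonomorphisms := by
  unfold singularChains; infer_instance

/-- The short exact sequence of singular chain complexes of a pair of spaces. -/
def pairSequence {A B : TopCat.{u}} (f : A ⟶ B) :
    ShortComplex (ChainComplex (ModuleCat.{u} ℤ) ℕ) :=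
  ShortComplex.mk (singularChains.map f) (cokernel.π (singularChains.map f))
    (cokernel.condition _)

lemma pairSequence_shortExact {A B : TopCat.{u}} (f : A ⟶ B) [Mono f] :
    (pairSequence f).ShortExact where
  exact := ShortComplex.exact_cokernel _
  mono_f := inferInstanceAs (Mono (singularChains.map f))
  epi_g := inferInstanceAs (Epi (cokernel.π (singularChains.map f)))

/-- Functoriality of the short exact sequence of a pair. -/
def pairSequenceMap {A B A' B' : TopCat.{u}} (f : A ⟶ B) (f' : A' ⟶ B') (a : A ⟶ A') (b : B ⟶ B')
    (w : f ≫ b = a ≫ f') : pairSequence f ⟶ pairSequence f' where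
  τ₁ := singularChains.map a
  τ₂ := singularChains.map b
  τ₃ := cokernel.map _ _ (singularChains.map a) (singularChains.map b)
    (by rw [← Functor.map_comp, ← Functor.map_comp, w])
  comm₁₂ := by simp [pairSequence, ← Functor.map_comp, w]
  comm₂₃ := by simp [pairSequence]

variable {J : Type u} [SmallCategory J] (Y : ℕ → J ⥤ TopCat.{u}) (i : ∀ n, Y n ⟶ Y (n + 1))

/-- The map of pairs induced by a morphism of the indexing category. -/
def filtrationMap (n : ℕ) {j k : J} (a : j ⟶ k) :
    pairSequence ((i n).app j) ⟶ pairSequence ((i n).app k) :=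
  pairSequenceMap _ _ ((Y n).map a) ((Y (n + 1)).map a) ((i n).naturality a).symm

/-- The relative singular chain complexes of the `n`-th stage of the filtration modulo the previous
one. -/
def relChains (n : ℕ) : J ⥤ ChainComplex (ModuleCat.{u} ℤ) ℕ where
  obj j := cokernel (singularChains.map ((i n).app j))
  map {j k} a := cokernel.map _ _ (singularChains.map ((Y n).map a))
    (singularChains.map ((Y (n + 1)).map a))
    (by rw [← Functor.map_comp, ← Functor.map_comp, (i n).naturality])
  map_id j := by
    apply (cancel_epi (cokernel.π _)).1
    simp
  map_comp a b := by
    apply (cancel_epi (cokernel.π _)).1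
    simp

/-- The `n`-th cellular chain functor `j ↦ H_n(Y_n(j), Y_{n-1}(j))`, where `Y (n + 1)` is the
`n`-th stage `Y_n` of the filtration. -/
def cellularChain (n : ℕ) : J ⥤ ModuleCat.{u} ℤ :=
  relChains Y i n ⋙ homologyFunctor _ _ n

/-- The map `H_n(Y_n) ⟶ H_n(Y_n, Y_{n-1})`. -/
def toRelative (n : ℕ) (j : J) : (singularChains.obj ((Y (n + 1)).obj j)).homology n ⟶
    (cellularChain Y i n).obj j :=
  homologyMap (pairSequence ((i n).app j)).g n

lemma toRelative_naturality (n : ℕ) {j k : J} (a : j ⟶ k) :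
    homologyMap (singularChains.map ((Y (n + 1)).map a)) n ≫ toRelative Y i n k =
      toRelative Y i n j ≫ (cellularChain Y i n).map a := by
  have h := congrArg (fun f => homologyMap f n) (filtrationMap Y i n a).comm₂₃
  simp only [homologyMap_comp] at h
  exact h

variable [∀ n j, Mono ((i n).app j)]

/-- The connecting homomorphism `H_{n+1}(Y_{n+1}, Y_n) ⟶ H_n(Y_n)`. -/
def connecting (n : ℕ) (j : J) : (cellularChain Y i (n + 1)).obj j ⟶
    (singularChains.obj ((Y (n + 1)).obj j)).homology n :=
  (pairSequence_shortExact ((i (n + 1)).app j)).δ (n + 1) n (by simp)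

lemma toRelative_connecting (n : ℕ) (j : J) :
    toRelative Y i (n + 1) j ≫ connecting Y i n j = 0 :=
  (pairSequence_shortExact ((i (n + 1)).app j)).comp_δ (n + 1) n (by simp)

lemma connecting_naturality (n : ℕ) {j k : J} (a : j ⟶ k) :
    (cellularChain Y i (n + 1)).map a ≫ connecting Y i n k =
      connecting Y i n j ≫ homologyMap (singularChains.map ((Y (n + 1)).map a)) n :=
  (HomologySequence.δ_naturality (filtrationMap Y i (n + 1) a)
    (pairSequence_shortExact ((i (n + 1)).app j)) (pairSequence_shortExact ((i (n + 1)).app k))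
    (n + 1) n (by simp)).symm

/-- The cellular boundary map
`H_{n+1}(Y_{n+1}, Y_n) ⟶ H_n(Y_n) ⟶ H_n(Y_n, Y_{n-1})`. -/
def cellularBoundary (n : ℕ) : cellularChain Y i (n + 1) ⟶ cellularChain Y i n where
  app j := connecting Y i n j ≫ toRelative Y i n j
  naturality j k a := by
    rw [← Category.assoc, connecting_naturality, Category.assoc, toRelative_naturality,
      Category.assoc]

lemma cellularBoundary_comp (n : ℕ) :
    cellularBoundary Y i (n + 1) ≫ cellularBoundary Y i n = 0 := by
  refine NatTrans.ext (funext fun j => ?_)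
  change (connecting Y i (n + 1) j ≫ toRelative Y i (n + 1) j) ≫
    (connecting Y i n j ≫ toRelative Y i n j) = 0
  rw [Category.assoc, ← Category.assoc (toRelative Y i (n + 1) j), toRelative_connecting,
    zero_comp, comp_zero]

/-- The cellular chain complex of a filtered diagram of spaces. -/
def cellularComplex : ChainComplex (J ⥤ ModuleCat.{u} ℤ) ℕ :=
  ChainComplex.of (cellularChain Y i) (cellularBoundary Y i) (cellularBoundary_comp Y i)

end Cellular

/-- The cellular chain complex of `X`: the cellular chain complex of the filtration of the orbit
point space of `X` by the orbit point spaces of the skeleta, a complex of contravariant functors on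
the orbit category. -/
def DCWStructure.chains [TopEnriched D] {X : DSpace D} {ι : Type u} {O : ι → DSpace D}
    (S : DCWStructure X O) : ChainComplex ((OrbitCat O)ᵒᵖ ⥤ ModuleCat.{u} ℤ) ℕ :=
  cellularComplex (fun n => (orbitPoints O).obj (S.skelDiagram n))
    (fun n => (orbitPoints O).map (S.skelIncl n))

/-! ### The isotropy ring -/

section IsotropyRing

variable (𝒞 : Type u) [SmallCategory 𝒞]

/-- The set of all morphisms of a small category. -/
abbrev Mor : Type u := Σ (a : 𝒞) (b : 𝒞), a ⟶ b

/-- The free abelian group on the morphisms of a small category. -/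
def IsotropyRing : Type u := Mor 𝒞 →₀ ℤ

instance : AddCommGroup (IsotropyRing 𝒞) := inferInstanceAs (AddCommGroup (Mor 𝒞 →₀ ℤ))

namespace IsotropyRing

variable {𝒞}

/-- A morphism as a generator of the isotropy ring. -/
def of {a b : 𝒞} (f : a ⟶ b) : IsotropyRing 𝒞 := Finsupp.single ⟨a, b, f⟩ (1 : ℤ)

/-- The additive map with prescribed values on the generators. -/
def lift {A : Type*} [AddCommGroup A] (F : Mor 𝒞 → A) : IsotropyRing 𝒞 →+ A :=
  Finsupp.liftAddHom fun p => (zmultiplesHom A (F p))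

@[simp] lemma lift_of {A : Type*} [AddCommGroup A] (F : Mor 𝒞 → A) {a b : 𝒞} (f : a ⟶ b) :
    lift F (of f) = F ⟨a, b, f⟩ := by
  exact (Finsupp.liftAddHom_apply_single (fun p => zmultiplesHom A (F p)) _ _).trans (by simp)

@[elab_as_elim]
lemma induction {P : IsotropyRing 𝒞 → Prop} (x : IsotropyRing 𝒞) (zero : P 0)
    (add : ∀ x y, P x → P y → P (x + y)) (neg : ∀ x, P x → P (-x))
    (of : ∀ {a b : 𝒞} (f : a ⟶ b), P (of f)) : P x := by
  refine Finsupp.induction_linear x zero add ?_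
  rintro ⟨a, b, f⟩ n
  have hn : ∀ m : ℕ, P (Finsupp.single ⟨a, b, f⟩ (m : ℤ)) := by
    intro m
    induction m with
    | zero => rw [Nat.cast_zero, Finsupp.single_zero]; exact zero
    | succ k ih =>
      rw [Nat.cast_succ, Finsupp.single_add]
      exact add _ _ ih (of f)
  obtain ⟨m, rfl | rfl⟩ := n.eq_nat_or_neg
  · exact hn m
  · rw [Finsupp.single_neg]
    exact neg _ (hn m)

open Classical in
/-- The product of two morphisms: `f * g` is `f ∘ g` if the range of `g` is the domain of `f`, and
zero otherwise. -/
def morMul (f g : Mor 𝒞) : IsotropyRing 𝒞 :=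
  if h : g.2.1 = f.1 then of (g.2.2 ≫ eqToHom h ≫ f.2.2) else 0

lemma morMul_comp {a b c : 𝒞} (f : b ⟶ c) (g : a ⟶ b) :
    morMul ⟨b, c, f⟩ ⟨a, b, g⟩ = of (g ≫ f) := by
  simp [morMul]

lemma morMul_of_ne {a b b' c : 𝒞} (f : b ⟶ c) (g : a ⟶ b') (h : b' ≠ b) :
    morMul ⟨b, c, f⟩ ⟨a, b', g⟩ = 0 := by
  simp [morMul, h]

/-- The biadditive extension of the product of morphisms. -/
def mulHom : IsotropyRing 𝒞 →+ IsotropyRing 𝒞 →+ IsotropyRing 𝒞 :=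
  lift fun f => lift fun g => morMul f g

instance : Mul (IsotropyRing 𝒞) := ⟨fun x y => mulHom x y⟩

lemma of_mul_of {a b c : 𝒞} (f : b ⟶ c) (g : a ⟶ b) : of f * of g = of (g ≫ f) := by
  change mulHom (of f) (of g) = _
  simp [mulHom, morMul_comp]

lemma of_mul_of_ne {a b b' c : 𝒞} (f : b ⟶ c) (g : a ⟶ b') (h : b' ≠ b) : of f * of g = 0 := by
  change mulHom (of f) (of g) = _
  simp [mulHom, morMul_of_ne f g h]

instance : NonUnitalNonAssocRing (IsotropyRing 𝒞) where
  left_distrib x y z := map_add (mulHom x) y z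
  right_distrib x y z := congrArg (fun F : IsotropyRing 𝒞 →+ IsotropyRing 𝒞 => F z)
    (map_add mulHom x y)
  zero_mul x := congrArg (fun F : IsotropyRing 𝒞 →+ IsotropyRing 𝒞 => F x) (map_zero mulHom)
  mul_zero x := map_zero (mulHom x)

lemma of_mul_of_mul_of {a b c d a' b' : 𝒞} (f : a ⟶ b) (g : c ⟶ d) (h : a' ⟶ b') :
    of f * of g * of h = of f * (of g * of h) := by
  by_cases h₁ : d = a
  · subst h₁
    by_cases h₂ : b' = c
    · subst h₂
      simp [of_mul_of]
    · rw [of_mul_of, of_mul_of_ne _ _ h₂, of_mul_of_ne _ _ h₂, mul_zero]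
  · rw [of_mul_of_ne _ _ h₁, zero_mul]
    by_cases h₂ : b' = c
    · subst h₂
      rw [of_mul_of, of_mul_of_ne _ _ h₁]
    · rw [of_mul_of_ne _ _ h₂, mul_zero]

protected lemma mul_assoc (x y z : IsotropyRing 𝒞) : x * y * z = x * (y * z) := by
  induction x using IsotropyRing.induction with
  | zero => simp
  | add x x' hx hx' => simp only [add_mul, hx, hx']
  | neg x hx => simp only [neg_mul, hx]
  | of f =>
    induction y using IsotropyRing.induction with
    | zero => simp
    | add y y' hy hy' => simp only [add_mul, mul_add, hy, hy']
    | neg y hy => simp only [neg_mul, mul_neg, hy]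
    | of g =>
      induction z using IsotropyRing.induction with
      | zero => simp
      | add z z' hz hz' => simp only [mul_add, hz, hz']
      | neg z hz => simp only [mul_neg, hz]
      | of h => exact of_mul_of_mul_of f g h

variable [Fintype 𝒞]

instance : One (IsotropyRing 𝒞) := ⟨∑ a : 𝒞, of (𝟙 a)⟩

lemma one_def : (1 : IsotropyRing 𝒞) = ∑ a : 𝒞, of (𝟙 a) := rfl

protected lemma one_mul (x : IsotropyRing 𝒞) : 1 * x = x := by
  induction x using IsotropyRing.induction with
  | zero => simp
  | add x x' hx hx' => simp only [mul_add, hx, hx']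
  | neg x hx => simp only [mul_neg, hx]
  | @of a b f =>
    rw [one_def, Finset.sum_mul, Finset.sum_eq_single b, of_mul_of, Category.comp_id]
    · exact fun c _ hc => of_mul_of_ne _ _ hc.symm
    · simp

protected lemma mul_one (x : IsotropyRing 𝒞) : x * 1 = x := by
  induction x using IsotropyRing.induction with
  | zero => simp
  | add x x' hx hx' => simp only [add_mul, hx, hx']
  | neg x hx => simp only [neg_mul, hx]
  | @of a b f =>
    rw [one_def, Finset.mul_sum, Finset.sum_eq_single a, of_mul_of, Category.id_comp]
    · exact fun c _ hc => of_mul_of_ne _ _ hc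
    · simp

/-- The isotropy ring of a category with finitely many objects. -/
instance : Ring (IsotropyRing 𝒞) :=
  { (inferInstance : NonUnitalNonAssocRing (IsotropyRing 𝒞)) with
    one := 1
    mul_assoc := IsotropyRing.mul_assoc
    one_mul := IsotropyRing.one_mul
    mul_one := IsotropyRing.mul_one }

end IsotropyRing

end IsotropyRing

/-! ### Isomorphism classes of objects and the augmentation -/

/-- The free abelian group on the isomorphism classes of objects of a category; for the homotopy
orbit category these are the homotopy types of orbits. -/
abbrev IsoGroup (𝒞 : Type u) [SmallCategory 𝒞] : Type u :=
  _root_.Quotient (isIsomorphicSetoid 𝒞) →₀ ℤ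

/-- The generator of the isomorphism class of an object. -/
def isoClass {𝒞 : Type u} [SmallCategory 𝒞] (a : 𝒞) : IsoGroup 𝒞 :=
  Finsupp.single (Quotient.mk (isIsomorphicSetoid 𝒞) a) 1

open Classical in
/-- The augmentation `φ`: it sends an endomorphism `f : T → T` to the class of `T` and a morphism
between different objects to zero. -/
def augmentation (𝒞 : Type u) [SmallCategory 𝒞] : IsotropyRing 𝒞 →+ IsoGroup 𝒞 :=
  IsotropyRing.lift fun f => if f.1 = f.2.1 then isoClass f.1 else 0

/-! ### Abelianization and Hattori–Stallings rank -/

section HattoriStallings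

variable (S : Type u) [Ring S]

/-- The additive subgroup generated by the additive commutators of a ring. -/
def commutators : AddSubgroup S := AddSubgroup.closure {x | ∃ a b : S, x = a * b - b * a}

/-- The additive group of a ring modulo the commutators. -/
abbrev AbelianizedRing : Type u := S ⧸ commutators S

/-- The class of a ring element in the abelianization. -/
abbrev abMk : S →+ AbelianizedRing S := QuotientAddGroup.mk' (commutators S)

variable {S}

/-- The map `Ab(φ)` induced by an additive map `φ` which vanishes on commutators. -/
def abLift {A : Type*} [AddCommGroup A] (φ : S →+ A) (h : ∀ a b, φ (a * b) = φ (b * a)) :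
    AbelianizedRing S →+ A :=
  QuotientAddGroup.lift (commutators S) φ <| (AddSubgroup.closure_le _).2 <| by
    rintro _ ⟨a, b, rfl⟩
    simp [h a b]

/-- `r` is the Hattori–Stallings rank of the finitely generated projective right module `P`: the
trace `∑ φᵢ(xᵢ)` of its identity map `∑ xᵢ φᵢ`, with `xᵢ ∈ P` and `φᵢ ∈ Hom(P, S)`, modulo
commutators. -/
def IsProjectiveRank (P : ModuleCat.{u} Sᵐᵒᵖ) (r : AbelianizedRing S) : Prop :=
  ∃ (n : ℕ) (x : Fin n → P) (φ : Fin n → P →ₗ[Sᵐᵒᵖ] S),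
    (∀ p : P, p = ∑ i, MulOpposite.op (φ i p) • x i) ∧ r = abMk S (∑ i, φ i (x i))

/-- `r` is the Hattori–Stallings rank of the right module `M`.  The rank is defined for the modules
which have a finite resolution `0 → P_k → ⋯ → P_0 → M → 0` by finitely generated projective
modules, and is then the alternating sum of the ranks of the `P_j`. -/
inductive IsRank : ModuleCat.{u} Sᵐᵒᵖ → AbelianizedRing S → Prop
  | projective {P : ModuleCat.{u} Sᵐᵒᵖ} {r : AbelianizedRing S} (h : IsProjectiveRank P r) : IsRank P r
  | resolution {K P M : ModuleCat.{u} Sᵐᵒᵖ} {k p : AbelianizedRing S} (f : K →ₗ[Sᵐᵒᵖ] P) (g : P →ₗ[Sᵐᵒᵖ] M)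
      (hf : Function.Injective f) (hfg : Function.Exact f g) (hg : Function.Surjective g)
      (hP : IsProjectiveRank P p) (hK : IsRank K k) : IsRank M (p - k)

end HattoriStallings

/-! ### Coefficients and equivariant homology -/

section Coefficients

variable {𝒞 : Type u} [SmallCategory 𝒞] [Fintype 𝒞]

/-- Left multiplication as a map of right modules. -/
def leftMul {S : Type u} [Ring S] (a : S) : S →ₗ[Sᵐᵒᵖ] S where
  toFun x := a * x
  map_add' := mul_add a
  map_smul' s x := (mul_assoc a x s.unop).symm

/-- The right submodule `1_T I` of the isotropy ring. -/
def corner (T : 𝒞) : Submodule (IsotropyRing 𝒞)ᵐᵒᵖ (IsotropyRing 𝒞) :=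
  LinearMap.range (leftMul (IsotropyRing.of (𝟙 T)))

lemma id_mul_of_mem_corner {T : 𝒞} {x : IsotropyRing 𝒞} (hx : x ∈ corner T) :
    IsotropyRing.of (𝟙 T) * x = x := by
  obtain ⟨y, rfl⟩ := hx
  change _ * (_ * y) = _ * y
  rw [← mul_assoc, IsotropyRing.of_mul_of, Category.comp_id]

lemma leftMul_mem_corner {T T' : 𝒞} (f : T ⟶ T') (x : IsotropyRing 𝒞) :
    leftMul (IsotropyRing.of f) x ∈ corner T' := by
  refine ⟨leftMul (IsotropyRing.of f) x, ?_⟩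
  change _ * (_ * x) = _ * x
  rw [← mul_assoc, IsotropyRing.of_mul_of, Category.comp_id]

variable (𝒞) in
/-- The coefficient system `ζI`: the covariant functor `T ↦ 1_T I` to right modules over the
isotropy ring, on which morphisms act by left multiplication. -/
def zetaI : 𝒞 ⥤ ModuleCat.{u} (IsotropyRing 𝒞)ᵐᵒᵖ where
  obj T := ModuleCat.of _ (corner T)
  map {T T'} f := ModuleCat.ofHom
    ((leftMul (IsotropyRing.of f)).restrict (p := corner T) (q := corner T')
      fun x _ => leftMul_mem_corner f x)
  map_id T := by
    ext x
    exact id_mul_of_mem_corner x.2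
  map_comp {T₁ T₂ T₃} f g := by
    ext x
    change IsotropyRing.of (f ≫ g) * x.1 = IsotropyRing.of g * (IsotropyRing.of f * x.1)
    rw [← mul_assoc, IsotropyRing.of_mul_of]

end Coefficients

section FunctorTensor

open TensorProduct DirectSum

variable {J : Type u} [SmallCategory J] {S : Type u} [Ring S] (M : J ⥤ ModuleCat.{u} S)

/-- The direct sum of the tensor products `M(j) ⊗ C(j)` over all objects `j`. -/
abbrev TensorSum (C : Jᵒᵖ ⥤ ModuleCat.{u} ℤ) : Type u :=
  ⨁ j : J, (M.obj j ⊗[ℤ] C.obj (op j))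

open Classical in
/-- The inclusion of a summand. -/
def tensorIn (C : Jᵒᵖ ⥤ ModuleCat.{u} ℤ) (j : J) :
    (M.obj j ⊗[ℤ] C.obj (op j)) →ₗ[S] TensorSum M C :=
  DirectSum.lof S J (fun j => M.obj j ⊗[ℤ] C.obj (op j)) j

/-- The relations `f m ⊗ c = m ⊗ c f` for morphisms `f : j ⟶ k`. -/
def tensorRel (C : Jᵒᵖ ⥤ ModuleCat.{u} ℤ) : Submodule S (TensorSum M C) :=
  Submodule.span S {x | ∃ (j k : J) (f : j ⟶ k) (m : M.obj j) (c : C.obj (op k)),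
    x = tensorIn M C k (M.map f m ⊗ₜ c) - tensorIn M C j (m ⊗ₜ C.map f.op c)}

/-- The tensor product `C ⊗_J M` of a contravariant functor `C` to abelian groups and a covariant
functor `M` to modules: the quotient of `⨁ M(j) ⊗ C(j)` by the relations above. -/
abbrev TensorProd (C : Jᵒᵖ ⥤ ModuleCat.{u} ℤ) : Type u := TensorSum M C ⧸ tensorRel M C

open Classical in
/-- The map of direct sums induced by a natural transformation. -/
def tensorSumMap {C C' : Jᵒᵖ ⥤ ModuleCat.{u} ℤ} (α : C ⟶ C') : TensorSum M C →ₗ[S] TensorSum M C' :=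
  DirectSum.toModule S J (TensorSum M C') fun j =>
    tensorIn M C' j ∘ₗ AlgebraTensorModule.map LinearMap.id (α.app (op j)).hom

lemma tensorSumMap_tmul {C C' : Jᵒᵖ ⥤ ModuleCat.{u} ℤ} (α : C ⟶ C') (j : J) (m : M.obj j)
    (c : C.obj (op j)) :
    tensorSumMap M α (tensorIn M C j (m ⊗ₜ c)) = tensorIn M C' j (m ⊗ₜ α.app (op j) c) := by
  classical
  simp only [tensorSumMap, tensorIn, DirectSum.toModule_lof]
  rfl

/-- The map of tensor products induced by a natural transformation. -/
def tensorProdMap {C C' : Jᵒᵖ ⥤ ModuleCat.{u} ℤ} (α : C ⟶ C') :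
    TensorProd M C →ₗ[S] TensorProd M C' :=
  Submodule.mapQ (tensorRel M C) (tensorRel M C') (tensorSumMap M α) <| by
    refine Submodule.span_le.2 ?_
    rintro _ ⟨j, k, f, m, c, rfl⟩
    refine Submodule.subset_span ⟨j, k, f, m, α.app (op k) c, ?_⟩
    rw [map_sub, tensorSumMap_tmul, tensorSumMap_tmul]
    congr 3
    exact congrArg (fun h => h.hom c) (α.naturality f.op)

/-- The class of `m ⊗ c` in the tensor product. -/
def tmk (C : Jᵒᵖ ⥤ ModuleCat.{u} ℤ) (j : J) (m : M.obj j) (c : C.obj (op j)) : TensorProd M C :=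
  (tensorRel M C).mkQ (tensorIn M C j (m ⊗ₜ c))

lemma tensorProdMap_tmk {C C' : Jᵒᵖ ⥤ ModuleCat.{u} ℤ} (α : C ⟶ C') (j : J) (m : M.obj j)
    (c : C.obj (op j)) : tensorProdMap M α (tmk M C j m c) = tmk M C' j m (α.app (op j) c) :=
  congrArg (tensorRel M C').mkQ (tensorSumMap_tmul M α j m c)

lemma tensorProd_hom_ext {C : Jᵒᵖ ⥤ ModuleCat.{u} ℤ} {N : Type u} [AddCommGroup N] [Module S N]
    {f g : TensorProd M C →ₗ[S] N} (h : ∀ j m c, f (tmk M C j m c) = g (tmk M C j m c)) :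
    f = g := by
  classical
  refine Submodule.linearMap_qext _ (DirectSum.linearMap_ext S fun j => ?_)
  refine LinearMap.ext fun t => ?_
  induction t using TensorProduct.induction_on with
  | zero => simp
  | tmul m c => exact h j m c
  | add x y hx hy => rw [map_add, map_add, hx, hy]

/-- The functor `C ↦ C ⊗_J M`. -/
def tensorFunctor : (Jᵒᵖ ⥤ ModuleCat.{u} ℤ) ⥤ ModuleCat.{u} S where
  obj C := ModuleCat.of S (TensorProd M C)
  map α := ModuleCat.ofHom (tensorProdMap M α)
  map_id C := ModuleCat.hom_ext <| tensorProd_hom_ext M fun j m c => tensorProdMap_tmk M (𝟙 C) j m c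
  map_comp {C C' C''} α β := ModuleCat.hom_ext <| tensorProd_hom_ext M fun j m c => by
    refine (tensorProdMap_tmk M (α ≫ β) j m c).trans ?_
    change _ = tensorProdMap M β (tensorProdMap M α (tmk M C j m c))
    rw [tensorProdMap_tmk, tensorProdMap_tmk]
    rfl

instance : (tensorFunctor M).Additive where
  map_add {C C' α β} := ModuleCat.hom_ext <| tensorProd_hom_ext M fun j m c => by
    refine (tensorProdMap_tmk M (α + β) j m c).trans ?_
    change _ = tensorProdMap M α (tmk M C j m c) + tensorProdMap M β (tmk M C j m c)
    rw [tensorProdMap_tmk, tensorProdMap_tmk]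
    change (tensorRel M C').mkQ (tensorIn M C' j (m ⊗ₜ (α.app (op j) c + β.app (op j) c))) = _
    rw [TensorProduct.tmul_add, map_add, map_add]
    rfl

end FunctorTensor

/-! ### Equivariant homology with coefficients in the isotropy ring and the Euler characteristic -/

namespace DCWStructure

variable [TopEnriched D] {X : DSpace D} {ι : Type u} {O : ι → DSpace D} (S : DCWStructure X O)

/-- The complex `C_*(X) ⊗_{O'} ζI` of right modules over the isotropy ring `I` of `hO'`. -/
def isotropyComplex [Fintype ι] :
    ChainComplex (ModuleCat.{u} (IsotropyRing (HoOrbitCat O))ᵐᵒᵖ) ℕ :=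
  ((tensorFunctor (toHo O ⋙ zetaI (HoOrbitCat O))).mapHomologicalComplex _).obj S.chains

/-- The cellular equivariant homology `H_n^D(X; ζI)`, a right module over the isotropy ring. -/
def equivariantHomology [Fintype ι] (n : ℕ) :
    ModuleCat.{u} (IsotropyRing (HoOrbitCat O))ᵐᵒᵖ :=
  S.isotropyComplex.homology n

/-- The equivariant Euler characteristic of a finite `D`-CW-complex: the alternating sum of the
homotopy types of the orbits of its cells. -/
def eulerCharacteristic [Fintype S.Cells] : IsoGroup (HoOrbitCat O) :=
  ∑ c : S.Cells, (-1 : ℤ) ^ c.1 • isoClass (hoObj O (S.orbit c.2))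

end DCWStructure

end EquivariantEuler
end

open EquivariantEuler

/-!
The homomorphism `ψ` exists because the classes of identities can be separated in the abelianized
isotropy ring. Say that an object `R` is an eventual image of an endomorphism `f : T ⟶ T` if `R`
splits an idempotent power of `f` which is unchanged by further composition with `f`. It is unique up
to isomorphism, it is `T` for the identity of `T`, and `a ≫ b` and `b ≫ a` have the same eventual
images (`IsEventualImage.comp_comm`). So the map which sends `f` to the class of its eventual image,
and the other morphisms to zero, vanishes on commutators.

For the Euler characteristic, the rank of modules with finite projective resolutions is well defined
on projective modules and additive in extensions (`IsRank.eq_of_projective`, `IsRank.extension`).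
Hence a bounded complex of projective modules whose homology modules have ranks satisfies the
Euler–Poincaré formula `sum_isRank_homology`, and the alternating sum of the ranks of the modules
`H_n(X; ζI)` equals the alternating sum of the ranks of the chain modules `C_n(X) ⊗ ζI`.

These chain modules are computed by showing that the functor
`C_n(X)(T) = H_n(hom(T, X_n), hom(T, X_{n-1}))` is free on the `n`-cells (`exists_isFreeOn`): it is
generated by one element over the orbit `T_c` of every `n`-cell `c`, up to homotopy of maps
`T ⟶ T_c`. An invariant map from an orbit to a Euclidean space is constant. Therefore an equivariant
map from an orbit `T` to `X_n` either goes to `X_{n-1}` or is given by a map to one of the orbits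
`T_c` and a point of the open disc (`orbit_cases`); the maps of the second kind form an open subspace
`⨿ hom(T, T_c) × ℝⁿ` of the mapping space. Since `X_{n-1}` is a deformation retract of `X_n` without
the centres of the `n`-cells (`exists_retraction`), excision identifies `C_n(X)(T)` with the homology
in degree `n` of the pair `⨿ hom(T, T_c) × (ℝⁿ, ℝⁿ ∖ 0)`. By iterated suspension this is the
homology in degree zero of `⨿ hom(T, T_c)` (`exists_local_class`), the free abelian group on the
homotopy classes of maps to the orbits `T_c`.

It follows that `C_n(X) ⊗ ζI` is the sum of the right ideals `1_{T_c} I` and has the rank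
`∑ c, [1_{T_c}]` (`IsFreeOn.isProjectiveRank`). Every `ψ` with `ψ [1_T] = [T]` maps the alternating
sum of these ranks to the Euler characteristic; if the augmentation vanishes on commutators, then the
homomorphism which it induces is such a `ψ`.

Excision for singular homology is proved by barycentric subdivision. Mapping spaces carry compactly
generated topologies; as these have the same singular simplices as the compact-open topologies
(`isIso_singularChains_fromMapSpace`), the arguments take place in the latter.
-/

noncomputable section

namespace EquivariantEuler

/-! ### Hattori–Stallings ranks -/

section Rank

variable {S : Type u} [Ring S]

lemma abMk_mul_comm (a b : S) : abMk S (a * b) = abMk S (b * a) := by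
  rw [← sub_eq_zero, ← map_sub]
  exact (QuotientAddGroup.eq_zero_iff _).2 (AddSubgroup.subset_closure ⟨a, b, rfl⟩)

/-- The data of a dual basis, indexed by an arbitrary finite type. -/
lemma isProjectiveRank_of_fintype {P : ModuleCat.{u} Sᵐᵒᵖ} {κ : Type*} [Fintype κ] (x : κ → P)
    (φ : κ → P →ₗ[Sᵐᵒᵖ] S) (h : ∀ p : P, p = ∑ i, MulOpposite.op (φ i p) • x i) :
    IsProjectiveRank P (∑ i, abMk S (φ i (x i))) := by
  let e := Fintype.equivFin κ
  refine ⟨Fintype.card κ, x ∘ e.symm, φ ∘ e.symm, fun p => ?_, ?_⟩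
  · exact (h p).trans (e.symm.sum_comp (fun i => MulOpposite.op (φ i p) • x i)).symm
  · rw [map_sum, ← e.symm.sum_comp]
    rfl

lemma map_op_smul {P : Type u} [AddCommGroup P] [Module Sᵐᵒᵖ P] (φ : P →ₗ[Sᵐᵒᵖ] S) (s : S) (p : P) :
    φ (MulOpposite.op s • p) = φ p * s := φ.map_smul _ _

/-- The rank does not depend on the dual basis: both sums are the class of
`∑ i j, φ i (y j) * ψ j (x i)`, with the factors in one or the other order. -/
lemma IsProjectiveRank.unique {P : ModuleCat.{u} Sᵐᵒᵖ} {p q : AbelianizedRing S}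
    (hp : IsProjectiveRank P p) (hq : IsProjectiveRank P q) : p = q := by
  obtain ⟨m, x, φ, hx, rfl⟩ := hp
  obtain ⟨n, y, ψ, hy, rfl⟩ := hq
  have h₁ : ∀ i, φ i (x i) = ∑ j, φ i (y j) * ψ j (x i) := fun i => by
    conv_lhs => rw [hy (x i)]
    simp only [map_sum, map_op_smul]
  have h₂ : ∀ j, ψ j (y j) = ∑ i, ψ j (x i) * φ i (y j) := fun j => by
    conv_lhs => rw [hx (y j)]
    simp only [map_sum, map_op_smul]
  simp only [map_sum, h₁, h₂]
  rw [Finset.sum_comm]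
  exact Finset.sum_congr rfl fun j _ => Finset.sum_congr rfl fun i _ => abMk_mul_comm _ _

lemma isProjectiveRank_zero (P : ModuleCat.{u} Sᵐᵒᵖ) [Subsingleton P] : IsProjectiveRank P 0 :=
  ⟨0, Fin.elim0, Fin.elim0, fun _ => Subsingleton.elim _ _, by simp⟩

lemma IsProjectiveRank.prod {P Q R : ModuleCat.{u} Sᵐᵒᵖ} {p q : AbelianizedRing S}
    (hp : IsProjectiveRank P p) (hq : IsProjectiveRank Q q) (e : (P × Q) ≃ₗ[Sᵐᵒᵖ] R) :
    IsProjectiveRank R (p + q) := by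
  obtain ⟨m, x, φ, hx, rfl⟩ := hp
  obtain ⟨n, y, ψ, hy, rfl⟩ := hq
  convert isProjectiveRank_of_fintype (κ := Fin m ⊕ Fin n)
    (Sum.elim (fun i => e (x i, 0)) (fun j => e (0, y j)))
    (Sum.elim (fun i => φ i ∘ₗ LinearMap.fst _ _ _ ∘ₗ e.symm.toLinearMap)
      (fun j => ψ j ∘ₗ LinearMap.snd _ _ _ ∘ₗ e.symm.toLinearMap)) ?_ using 1
  · simp [map_sum]
  · intro r
    obtain ⟨⟨a, b⟩, rfl⟩ := e.surjective r
    simp only [Fintype.sum_sum_type, Sum.elim_inl, Sum.elim_inr, LinearMap.comp_apply,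
      LinearEquiv.coe_coe, LinearEquiv.symm_apply_apply, LinearMap.fst_apply, LinearMap.snd_apply,
      ← map_smul, ← map_sum, ← map_add, Prod.smul_mk, smul_zero]
    congr 1
    ext
    · simpa [Prod.fst_sum] using hx a
    · simpa [Prod.snd_sum] using hy b

lemma IsProjectiveRank.of_equiv {P Q : ModuleCat.{u} Sᵐᵒᵖ} {p : AbelianizedRing S}
    (hp : IsProjectiveRank P p) (e : P ≃ₗ[Sᵐᵒᵖ] Q) : IsProjectiveRank Q p := by
  obtain ⟨m, x, φ, hx, rfl⟩ := hp
  refine ⟨m, fun i => e (x i), fun i => φ i ∘ₗ e.symm.toLinearMap, fun q => ?_, by simp⟩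
  obtain ⟨a, rfl⟩ := e.surjective q
  simpa [← map_smul, ← map_sum] using congrArg e (hx a)

lemma IsProjectiveRank.of_retract {P Q : ModuleCat.{u} Sᵐᵒᵖ} {p : AbelianizedRing S}
    (hp : IsProjectiveRank P p) (i : Q →ₗ[Sᵐᵒᵖ] P) (r : P →ₗ[Sᵐᵒᵖ] Q)
    (h : ∀ q, r (i q) = q) : ∃ q, IsProjectiveRank Q q := by
  obtain ⟨m, x, φ, hx, rfl⟩ := hp
  refine ⟨_, m, fun j => r (x j), fun j => φ j ∘ₗ i, fun q => ?_, rfl⟩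
  simpa [h] using congrArg r (hx (i q))

/-- The lifting property of a module with a dual basis: lift the images of the generators. -/
lemma IsProjectiveRank.lift {P : ModuleCat.{u} Sᵐᵒᵖ} {p : AbelianizedRing S}
    (hp : IsProjectiveRank P p) {M N : Type u} [AddCommGroup M] [Module Sᵐᵒᵖ M] [AddCommGroup N]
    [Module Sᵐᵒᵖ N] (g : M →ₗ[Sᵐᵒᵖ] N) (hg : Function.Surjective g) (f : P →ₗ[Sᵐᵒᵖ] N) :
    ∃ s : P →ₗ[Sᵐᵒᵖ] M, ∀ x, g (s x) = f x := by
  obtain ⟨m, x, φ, hx, rfl⟩ := hp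
  choose y hy using fun i => hg (f (x i))
  let s (i : Fin m) : P →ₗ[Sᵐᵒᵖ] M :=
    { toFun := fun p => MulOpposite.op (φ i p) • y i
      map_add' := fun a b => by rw [map_add, MulOpposite.op_add, add_smul]
      map_smul' := fun a b => by
        obtain ⟨a, rfl⟩ := MulOpposite.op_surjective a
        rw [map_op_smul, MulOpposite.op_mul, mul_smul]
        rfl }
  refine ⟨∑ i, s i, fun p => ?_⟩
  rw [LinearMap.sum_apply]
  conv_rhs => rw [hx p]
  simp [s, hy]

lemma IsRank.of_equiv {M N : ModuleCat.{u} Sᵐᵒᵖ} {r : AbelianizedRing S} (h : IsRank M r)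
    (e : M ≃ₗ[Sᵐᵒᵖ] N) : IsRank N r := by
  cases h with
  | projective h => exact .projective (h.of_equiv e)
  | resolution f g hf hfg hg hP hK =>
    refine .resolution f (e.toLinearMap ∘ₗ g) hf ?_ (e.surjective.comp hg) hP hK
    intro x
    rw [← hfg x]
    simp

/-- A surjection onto a module with a dual basis identifies its source with the sum of the kernel
and the target. -/
lemma exists_equiv_prod_of_surjective {K P M : ModuleCat.{u} Sᵐᵒᵖ} {r : AbelianizedRing S}
    (f : K →ₗ[Sᵐᵒᵖ] P) (g : P →ₗ[Sᵐᵒᵖ] M) (hf : Function.Injective f) (hfg : Function.Exact f g)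
    (hg : Function.Surjective g) (hM : IsProjectiveRank M r) :
    ∃ e : (K × M) ≃ₗ[Sᵐᵒᵖ] P, ∀ k, e (k, 0) = f k := by
  obtain ⟨s, hs⟩ := hM.lift g hg LinearMap.id
  have hb : Function.Bijective (f.coprod s) := by
    refine ⟨?_, fun p => ?_⟩
    · rw [← LinearMap.ker_eq_bot, LinearMap.ker_eq_bot']
      rintro ⟨k, m⟩ h
      have h₀ : f k + s m = 0 := h
      have h₁ : m = 0 := by simpa [hs, hfg.apply_apply_eq_zero] using congrArg g h₀
      subst h₁
      have h₂ : k = 0 := hf (by simpa using h₀)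
      rw [h₂]
      rfl
    · obtain ⟨k, hk⟩ := (hfg (p - s (g p))).1 (by simp [hs])
      exact ⟨(k, g p), by simp [hk]⟩
  exact ⟨LinearEquiv.ofBijective _ hb, fun k => by simp⟩

/-- On projective modules the rank by resolutions agrees with the trace of the identity: all
resolutions split. -/
lemma IsRank.eq_of_projective {M : ModuleCat.{u} Sᵐᵒᵖ} {r p : AbelianizedRing S} (h : IsRank M r)
    (hp : IsProjectiveRank M p) : r = p := by
  induction h generalizing p with
  | projective h => exact h.unique hp
  | @resolution K P M k p' f g hf hfg hg hP hK ih =>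
    obtain ⟨e, he⟩ := exists_equiv_prod_of_surjective f g hf hfg hg hp
    obtain ⟨k', hk'⟩ := hP.of_retract (Q := K) f
      (LinearMap.fst Sᵐᵒᵖ K M ∘ₗ e.symm.toLinearMap) (fun q => by simp [← he])
    rw [ih hk', hP.unique (hk'.prod hp e)]
    abel

lemma IsRank.exists_resolution {M : ModuleCat.{u} Sᵐᵒᵖ} {r : AbelianizedRing S} (h : IsRank M r) :
    ∃ (K P : ModuleCat.{u} Sᵐᵒᵖ) (k p : AbelianizedRing S) (f : K →ₗ[Sᵐᵒᵖ] P) (g : P →ₗ[Sᵐᵒᵖ] M),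
      Function.Injective f ∧ Function.Exact f g ∧ Function.Surjective g ∧ IsProjectiveRank P p ∧
        IsRank K k ∧ r = p - k := by
  cases h with
  | projective h =>
    refine ⟨ModuleCat.of _ PUnit, M, 0, r, 0, LinearMap.id, fun _ _ _ => Subsingleton.elim _ _,
      fun x => ?_, Function.surjective_id, h, .projective (isProjectiveRank_zero _), by simp⟩
    simp [eq_comm]
  | @resolution K P _ k p f g hf hfg hg hP hK =>
    exact ⟨K, P, k, p, f, g, hf, hfg, hg, hP, hK, rfl⟩

lemma IsRank.prod_projective {A C : ModuleCat.{u} Sᵐᵒᵖ} {a c : AbelianizedRing S} (hA : IsRank A a)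
    (hC : IsProjectiveRank C c) : IsRank (ModuleCat.of Sᵐᵒᵖ (A × C)) (a + c) := by
  obtain ⟨K, P, k, p, f, g, hf, hfg, hg, hP, hK, rfl⟩ := hA.exists_resolution
  have h : p - k + c = (p + c) - k := by abel
  rw [h]
  refine .resolution (P := ModuleCat.of Sᵐᵒᵖ (P × C)) (LinearMap.inl _ _ _ ∘ₗ f)
    (g.prodMap LinearMap.id) (LinearMap.inl_injective.comp hf) ?_
    (hg.prodMap Function.surjective_id) (hP.prod hC (LinearEquiv.refl _ _)) hK
  rintro ⟨x, y⟩
  have hx := hfg x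
  simp only [LinearMap.prodMap_apply, LinearMap.id_apply, Prod.mk_eq_zero, LinearMap.coe_comp,
    LinearMap.coe_inl, Set.mem_range, Function.comp_apply, Prod.mk.injEq] at hx ⊢
  rw [hx]
  constructor
  · rintro ⟨⟨k, rfl⟩, rfl⟩
    exact ⟨k, rfl, rfl⟩
  · rintro ⟨k, rfl, rfl⟩
    exact ⟨⟨k, rfl⟩, rfl⟩

/-- The rank is additive in extensions: resolutions of the two ends combine to a resolution of the
middle term (the horseshoe lemma). -/
lemma IsRank.extension {C : ModuleCat.{u} Sᵐᵒᵖ} {c : AbelianizedRing S} (hC : IsRank C c) :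
    ∀ {A B : ModuleCat.{u} Sᵐᵒᵖ} {a : AbelianizedRing S}, IsRank A a → ∀ (f : A →ₗ[Sᵐᵒᵖ] B)
      (g : B →ₗ[Sᵐᵒᵖ] C), Function.Injective f → Function.Exact f g → Function.Surjective g →
        IsRank B (a + c) := by
  induction hC with
  | projective hC =>
    intro A B a hA f g hf hfg hg
    obtain ⟨e, -⟩ := exists_equiv_prod_of_surjective f g hf hfg hg hC
    exact (hA.prod_projective hC).of_equiv e
  | @resolution KC PC C kC pC fC gC hfC hfgC hgC hPC hKC ih =>
    intro A B a hA f g hf hfg hg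
    obtain ⟨KA, PA, kA, pA, fA, gA, hfA, hfgA, hgA, hPA, hKA, rfl⟩ := hA.exists_resolution
    obtain ⟨s, hs⟩ := hPC.lift g hg gC
    -- `PA × PC` maps onto `B`; its kernel `ker G` is an extension of `KC` by `KA`, to which the
    -- induction hypothesis applies.
    let G : (PA × PC) →ₗ[Sᵐᵒᵖ] B := (f ∘ₗ gA).coprod s
    have hG : ∀ x y, G (x, y) = f (gA x) + s y := fun x y => rfl
    let eC := LinearEquiv.ofInjective fC hfC
    have hker : ∀ z : LinearMap.ker G, z.1.2 ∈ LinearMap.range fC := by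
      rintro ⟨⟨x, y⟩, hz⟩
      have h := congrArg g (show f (gA x) + s y = 0 from hz)
      rw [map_add, hfg.apply_apply_eq_zero, zero_add, hs, map_zero] at h
      exact (hfgC y).1 h
    let R : LinearMap.ker G →ₗ[Sᵐᵒᵖ] KC := eC.symm.toLinearMap ∘ₗ
      LinearMap.codRestrict (LinearMap.range fC)
        (LinearMap.snd _ _ _ ∘ₗ (LinearMap.ker G).subtype) hker
    have hR : ∀ z, fC (R z) = z.1.2 := fun z =>
      congrArg Subtype.val (eC.apply_symm_apply ⟨z.1.2, hker z⟩)
    let I : KA →ₗ[Sᵐᵒᵖ] LinearMap.ker G := LinearMap.codRestrict _ (LinearMap.inl _ _ _ ∘ₗ fA)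
      fun k => by
        change f (gA (fA k)) + s 0 = 0
        rw [hfgA.apply_apply_eq_zero, map_zero, map_zero, add_zero]
    have hI : ∀ k, (I k).1 = (fA k, 0) := fun k => rfl
    have key := ih (B := ModuleCat.of _ (LinearMap.ker G)) hKA I R ?_ ?_ ?_
    · have h : pA - kA + (pC - kC) = (pA + pC) - (kA + kC) := by abel
      rw [h]
      refine .resolution (P := ModuleCat.of _ (PA × PC)) (LinearMap.ker G).subtype G
        Subtype.val_injective (fun x => by simp) ?_ (hPA.prod hPC (LinearEquiv.refl _ _)) key
      intro b
      obtain ⟨y, hy⟩ := hgC (g b)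
      obtain ⟨x, hx⟩ := (hfg (b - s y)).1 (by rw [map_sub, hs, hy, sub_self])
      obtain ⟨x, rfl⟩ := hgA x
      exact ⟨(x, y), by rw [hG, hx, sub_add_cancel]⟩
    · intro k k' h
      exact hfA (congrArg (fun z => z.1.1) h)
    · rintro ⟨⟨x, y⟩, hz⟩
      constructor
      · intro h
        have hy : y = 0 := by simpa [h] using (hR ⟨(x, y), hz⟩).symm
        subst hy
        have h0 : f (gA x) = 0 := by simpa [hG] using hz
        obtain ⟨k, rfl⟩ := (hfgA x).1 (hf (by rw [h0, map_zero]))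
        exact ⟨k, rfl⟩
      · rintro ⟨k, h⟩
        apply hfC
        rw [hR, ← h, hI, map_zero]
    · intro k
      obtain ⟨x, hx⟩ := (hfg (s (fC k))).1 (by rw [hs, hfgC.apply_apply_eq_zero])
      obtain ⟨x, rfl⟩ := hgA x
      refine ⟨⟨(-x, fC k), ?_⟩, hfC (hR _)⟩
      rw [LinearMap.mem_ker, hG, map_neg, map_neg, hx, neg_add_cancel]

open HomologicalComplex in
/-- The rank of the cycles, by descending induction from the vanishing part of the complex. A
complex of projective modules gives the exact sequences of cycles, chains and boundaries, which are
resolutions of the boundaries, and the extensions of the homology by the boundaries. -/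
lemma exists_isRank_cycles (C : ChainComplex (ModuleCat.{u} Sᵐᵒᵖ) ℕ) (c r : ℕ → AbelianizedRing S)
    (N : ℕ) (hc : ∀ n, IsProjectiveRank (C.X n) (c n)) (hN : Subsingleton (C.X N))
    (hr : ∀ n, IsRank (C.homology n) (r n)) (d n : ℕ) (hn : n + d = N) :
    ∃ z, IsRank (C.cycles n) z ∧
      (-1 : ℤ) ^ n • (z - c n) = ∑ j ∈ Finset.Ico n N, (-1 : ℤ) ^ j • (r j - c j) := by
  induction d generalizing n with
  | zero =>
    obtain rfl : n = N := hn
    have hsub : Subsingleton (C.cycles n) :=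
      ((ModuleCat.mono_iff_injective (C.iCycles n)).1 inferInstance).subsingleton
    exact ⟨0, .projective (isProjectiveRank_zero _),
      by simp [(hc n).unique (isProjectiveRank_zero _)]⟩
  | succ d ih =>
    obtain ⟨z, hz, hz'⟩ := ih (n + 1) (by omega)
    let t : C.X (n + 1) →ₗ[Sᵐᵒᵖ] C.cycles n := (C.toCycles (n + 1) n).hom
    have hB : IsRank (ModuleCat.of _ (LinearMap.range t)) (c (n + 1) - z) := by
      refine .resolution (C.iCycles (n + 1)).hom t.rangeRestrict
        ((ModuleCat.mono_iff_injective (C.iCycles (n + 1))).1 inferInstance) ?_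
        t.surjective_rangeRestrict (hc _) hz
      intro x
      have hd : ∀ y, (C.iCycles n).hom (t y) = (C.d (n + 1) n).hom y := fun y => by
        exact congrArg (fun F => F.hom y) (C.toCycles_i (n + 1) n)
      have hi := (ModuleCat.mono_iff_injective (C.iCycles n)).1 inferInstance
      have hex := (ShortComplex.ShortExact.moduleCat_exact_iff_function_exact _).1
        (ShortComplex.exact_of_f_is_kernel (ShortComplex.mk (C.iCycles (n + 1)) (C.d (n + 1) n)
          (C.iCycles_d _ _)) (C.cyclesIsKernel (n + 1) n (by simp)))
      rw [← hex x]
      change t.rangeRestrict x = 0 ↔ (C.d (n + 1) n).hom x = 0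
      rw [← hd, Subtype.ext_iff]
      exact ⟨fun h => by simpa using congrArg (C.iCycles n).hom h, fun h => hi (by simpa using h)⟩
    have hZ : IsRank (C.cycles n) (c (n + 1) - z + r n) := by
      refine (hr n).extension hB (LinearMap.range t).subtype (C.homologyπ n).hom
        Subtype.val_injective ?_ ((ModuleCat.epi_iff_surjective (C.homologyπ n)).1 inferInstance)
      have hex := (ShortComplex.ShortExact.moduleCat_exact_iff_function_exact _).1
        (ShortComplex.exact_of_g_is_cokernel (ShortComplex.mk (C.toCycles (n + 1) n)
          (C.homologyπ n) (C.toCycles_comp_homologyπ _ _))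
          (C.homologyIsCokernel (n + 1) n (by simp)))
      intro x
      simpa using hex x
    refine ⟨_, hZ, ?_⟩
    rw [Finset.sum_eq_sum_Ico_succ_bot (by omega : n < N), ← hz', pow_succ, mul_neg_one, neg_zsmul,
      ← zsmul_neg, ← zsmul_add]
    congr 1
    abel

open HomologicalComplex in
/-- The Euler–Poincaré formula for the rank. The boundaries and cycles of a bounded complex of
projective modules need not be projective, but they have ranks as soon as the homology does. -/
theorem sum_isRank_homology (C : ChainComplex (ModuleCat.{u} Sᵐᵒᵖ) ℕ) (c r : ℕ → AbelianizedRing S)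
    (N : ℕ) (hc : ∀ n, IsProjectiveRank (C.X n) (c n)) (hN : Subsingleton (C.X N))
    (hr : ∀ n, IsRank (C.homology n) (r n)) :
    ∑ j ∈ Finset.range N, (-1 : ℤ) ^ j • r j = ∑ j ∈ Finset.range N, (-1 : ℤ) ^ j • c j := by
  obtain ⟨z, hz, hz'⟩ := exists_isRank_cycles C c r N hc hN hr N 0 (zero_add N)
  -- In degree zero every chain is a cycle.
  have hiso : IsIso (C.iCycles 0) := C.isIso_iCycles 0 _ rfl (by simp)
  rw [hz.eq_of_projective ((hc 0).of_equiv (asIso (C.iCycles 0)).symm.toLinearEquiv), sub_self,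
    smul_zero] at hz'
  simp only [zsmul_sub, Finset.sum_sub_distrib, ← Finset.range_eq_Ico] at hz'
  exact sub_eq_zero.1 hz'.symm

/-- The homology at a vanishing chain module has rank zero. -/
lemma isRank_homology_eq_zero (C : ChainComplex (ModuleCat.{u} Sᵐᵒᵖ) ℕ) {r : AbelianizedRing S}
    (n : ℕ) (hn : Subsingleton (C.X n)) (hr : IsRank (C.homology n) r) : r = 0 := by
  have h₁ : Subsingleton (C.cycles n) :=
    ((ModuleCat.mono_iff_injective (C.iCycles n)).1 inferInstance).subsingleton
  have h₂ : Subsingleton (C.homology n) :=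
    ((ModuleCat.epi_iff_surjective (C.homologyπ n)).1 inferInstance).subsingleton
  exact hr.eq_of_projective (isProjectiveRank_zero _)

end Rank

/-! ### Eventual images of endomorphisms -/

section AbelianizationSplitting

variable {𝒞 : Type u} [SmallCategory 𝒞]

/-- The object `R` is an eventual image of the endomorphism `f`: some power of `f` is unchanged by
composing with `f`, and is an idempotent split by `R`. Thus `f` is the identity on `R`; the
identity of an object has this object as eventual image. -/
def IsEventualImage {T : 𝒞} (f : T ⟶ T) (R : 𝒞) : Prop :=
  ∃ (n : ℕ) (i : R ⟶ T) (p : T ⟶ R), i ≫ p = 𝟙 R ∧ p ≫ i = (End.of f) ^ n ∧ i ≫ f = i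

lemma isEventualImage_id (T : 𝒞) : IsEventualImage (𝟙 T) T :=
  ⟨0, 𝟙 T, 𝟙 T, by simp, by simp [End.one_def], by simp⟩

lemma comp_end_pow {T R : 𝒞} {f : T ⟶ T} {i : R ⟶ T} (h : i ≫ f = i) (n : ℕ) :
    i ≫ ((End.of f) ^ n : End T) = i := by
  induction n with
  | zero => exact Category.comp_id i
  | succ n ih =>
    rw [pow_succ', End.mul_def, ← Category.assoc, ih]
    exact h

/-- The powers of `f` split by two eventual images agree from some point on, so that the two objects
split the same idempotent. -/
lemma IsEventualImage.nonempty_iso {T R R' : 𝒞} {f : T ⟶ T} (h : IsEventualImage f R)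
    (h' : IsEventualImage f R') : Nonempty (R ≅ R') := by
  obtain ⟨n, i, p, hip, hpi, hi⟩ := h
  obtain ⟨n', i', p', hip', hpi', hi'⟩ := h'
  refine ⟨⟨i ≫ p', i' ≫ p, ?_, ?_⟩⟩
  · rw [Category.assoc, ← Category.assoc p', hpi', ← Category.assoc, comp_end_pow hi, hip]
  · rw [Category.assoc, ← Category.assoc p, hpi, ← Category.assoc, comp_end_pow hi', hip']

lemma pow_comp_comm {T T' : 𝒞} (a : T ⟶ T') (b : T' ⟶ T) (n : ℕ) :
    ((End.of (a ≫ b)) ^ n : End T) ≫ a = a ≫ ((End.of (b ≫ a)) ^ n : End T') := by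
  induction n with
  | zero => exact (Category.id_comp a).trans (Category.comp_id a).symm
  | succ n ih =>
    rw [pow_succ', pow_succ', End.mul_def, End.mul_def, ← Category.assoc a, ← ih]
    change (_ ≫ a ≫ b) ≫ a = (_ ≫ a) ≫ b ≫ a
    simp only [Category.assoc]

/-- The eventual images of `a ≫ b` and `b ≫ a` agree: if `(a ≫ b) ^ n = p ≫ i`, then the idempotent
`(b ≫ a) ^ (n + 1) = (b ≫ p) ≫ (i ≫ a)` is split by the same object. -/
lemma IsEventualImage.comp_comm {T T' R : 𝒞} (a : T ⟶ T') (b : T' ⟶ T)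
    (h : IsEventualImage (a ≫ b) R) : IsEventualImage (b ≫ a) R := by
  obtain ⟨n, i, p, hip, hpi, hi⟩ := h
  refine ⟨n + 1, i ≫ a, b ≫ p, ?_, ?_, ?_⟩
  · rw [Category.assoc, ← Category.assoc a, ← Category.assoc, hi, hip]
  · rw [Category.assoc, ← Category.assoc p, hpi, pow_comp_comm, pow_succ, End.mul_def,
      ← Category.assoc]
  · rw [Category.assoc, ← Category.assoc a, ← Category.assoc, hi]

open Classical in
/-- The class of the eventual image of an endomorphism, and zero on the morphisms without one. -/
def eventualClass (f : Mor 𝒞) : IsoGroup 𝒞 :=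
  if h : ∃ R, ∃ e : f.2.1 = f.1, IsEventualImage (f.2.2 ≫ eqToHom e) R then isoClass h.choose
  else 0

lemma isoClass_eq {R R' : 𝒞} (e : R ≅ R') : isoClass R = isoClass R' :=
  congrArg (fun q => Finsupp.single q 1)
    (Quotient.sound (s := isIsomorphicSetoid 𝒞) (⟨e⟩ : IsIsomorphic R R'))

lemma eventualClass_eq {T R : 𝒞} {f : T ⟶ T} (h : IsEventualImage f R) :
    eventualClass ⟨T, T, f⟩ = isoClass R := by
  have h' : ∃ R, ∃ e : T = T, IsEventualImage (f ≫ eqToHom e) R := ⟨R, rfl, by simpa using h⟩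
  rw [eventualClass, dif_pos h']
  obtain ⟨e, he⟩ := h'.choose_spec
  exact isoClass_eq ((by simpa using he : IsEventualImage f _).nonempty_iso h).some

lemma eventualClass_of_ne {T T' : 𝒞} (f : T ⟶ T') (h : T' ≠ T) : eventualClass ⟨T, T', f⟩ = 0 :=
  dif_neg fun ⟨_, e, _⟩ => h e

lemma eventualClass_eq_zero {T : 𝒞} (f : T ⟶ T) (h : ¬ ∃ R, IsEventualImage f R) :
    eventualClass ⟨T, T, f⟩ = 0 :=
  dif_neg fun ⟨R, _, hR⟩ => h ⟨R, by simpa using hR⟩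

lemma eventualClass_comp_comm {T T' : 𝒞} (a : T ⟶ T') (b : T' ⟶ T) :
    eventualClass ⟨T, T, a ≫ b⟩ = eventualClass ⟨T', T', b ≫ a⟩ := by
  by_cases h : ∃ R, IsEventualImage (a ≫ b) R
  · obtain ⟨R, hR⟩ := h
    rw [eventualClass_eq hR, eventualClass_eq (hR.comp_comm a b)]
  · rw [eventualClass_eq_zero _ h, eventualClass_eq_zero]
    rintro ⟨R, hR⟩
    exact h ⟨R, hR.comp_comm b a⟩

lemma lift_eventualClass_mul_comm (x y : IsotropyRing 𝒞) :
    IsotropyRing.lift eventualClass (x * y) = IsotropyRing.lift eventualClass (y * x) := by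
  induction x using IsotropyRing.induction with
  | zero => simp
  | add x x' hx hx' => simp only [add_mul, mul_add, map_add, hx, hx']
  | neg x hx => simp only [neg_mul, mul_neg, map_neg, hx]
  | @of b c f =>
    induction y using IsotropyRing.induction with
    | zero => simp
    | add y y' hy hy' => simp only [add_mul, mul_add, map_add, hy, hy']
    | neg y hy => simp only [neg_mul, mul_neg, map_neg, hy]
    | @of a b' g =>
      by_cases h₁ : b' = b
      · subst h₁
        rw [IsotropyRing.of_mul_of, IsotropyRing.lift_of]
        by_cases h₂ : c = a
        · subst h₂
          rw [IsotropyRing.of_mul_of, IsotropyRing.lift_of, eventualClass_comp_comm]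
        · rw [IsotropyRing.of_mul_of_ne _ _ h₂, map_zero, eventualClass_of_ne _ h₂]
      · rw [IsotropyRing.of_mul_of_ne _ _ h₁, map_zero]
        by_cases h₂ : c = a
        · subst h₂
          rw [IsotropyRing.of_mul_of, IsotropyRing.lift_of, eventualClass_of_ne _ h₁]
        · rw [IsotropyRing.of_mul_of_ne _ _ h₂, map_zero]

/-- The classes of the identities in the abelianization can be mapped to the isomorphism classes of
the objects: the class of an eventual image is invariant under `a ≫ b ↦ b ≫ a`. -/
theorem exists_abelianizedRing_hom (𝒞 : Type u) [SmallCategory 𝒞] [Fintype 𝒞] :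
    ∃ ψ : AbelianizedRing (IsotropyRing 𝒞) →+ IsoGroup 𝒞,
      ∀ T, ψ (abMk _ (IsotropyRing.of (𝟙 T))) = isoClass T := by
  refine ⟨abLift (IsotropyRing.lift eventualClass) lift_eventualClass_mul_comm, fun T => ?_⟩
  change IsotropyRing.lift eventualClass (IsotropyRing.of (𝟙 T)) = isoClass T
  rw [IsotropyRing.lift_of]
  exact eventualClass_eq (isEventualImage_id T)

end AbelianizationSplitting

/-! ### Tensor products with free functors -/

section TensorRank

open TensorProduct DirectSum

/-- The map of right modules with `1 ↦ x`. -/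
def smulMap {S : Type u} [Ring S] {P : Type u} [AddCommGroup P] [Module Sᵐᵒᵖ P] (x : P) :
    S →ₗ[Sᵐᵒᵖ] P where
  toFun s := MulOpposite.op s • x
  map_add' a b := by rw [MulOpposite.op_add, add_smul]
  map_smul' s t := (mul_smul s (MulOpposite.op t) x)

variable {J : Type u} [SmallCategory J]

section Lift

variable {S : Type u} [Ring S] (M : J ⥤ ModuleCat.{u} S) (C : Jᵒᵖ ⥤ ModuleCat.{u} ℤ)

open Classical in
/-- The universal property of the tensor product of functors. -/
lemma exists_tensorProd_lift {N : Type u} [AddCommGroup N] [Module S N]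
    (b : ∀ j, M.obj j →ₗ[S] (C.obj (op j) →+ N))
    (h : ∀ (j k : J) (f : j ⟶ k) (m : M.obj j) (c : C.obj (op k)),
      b k (M.map f m) c = b j m (C.map f.op c)) :
    ∃ φ : TensorProd M C →ₗ[S] N, ∀ j m c, φ (tmk M C j m c) = b j m c := by
  let B (j : J) : (M.obj j ⊗[ℤ] C.obj (op j)) →ₗ[S] N :=
    AlgebraTensorModule.lift
      { toFun := fun m =>
          { toFun := b j m
            map_add' := map_add _
            map_smul' := fun n x => map_intCast_smul (b j m) ℤ ℤ n x }
        map_add' := fun m m' => by ext; simp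
        map_smul' := fun s m => by ext; simp }
  let F : TensorSum M C →ₗ[S] N := DirectSum.toModule S J N B
  have hF : ∀ j m c, F (tensorIn M C j (m ⊗ₜ c)) = b j m c := fun j m c =>
    (DirectSum.toModule_lof S j _).trans rfl
  refine ⟨(tensorRel M C).liftQ F (Submodule.span_le.2 ?_), hF⟩
  rintro _ ⟨j, k, f, m, c, rfl⟩
  change F _ = 0
  rw [map_sub, hF, hF, h, sub_self]

lemma smul_tmk (s : S) (j : J) (m : M.obj j) (c : C.obj (op j)) :
    s • tmk M C j m c = tmk M C j (s • m) c := by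
  rw [tmk, ← map_smul, ← map_smul, TensorProduct.smul_tmul']
  rfl

lemma tmk_map (j k : J) (f : j ⟶ k) (m : M.obj j) (c : C.obj (op k)) :
    tmk M C k (M.map f m) c = tmk M C j m (C.map f.op c) :=
  (Submodule.Quotient.eq _).2 (Submodule.subset_span ⟨_, _, f, m, _, rfl⟩)

end Lift

variable {𝒞 : Type u} [SmallCategory 𝒞] (Q : J ⥤ 𝒞) (C : Jᵒᵖ ⥤ ModuleCat.{u} ℤ)
  {κ : Type u} (o : κ → J) (θ : ∀ (c : κ) {j : J}, (j ⟶ o c) → C.obj (op j))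

/-- A functor which is free on the homotopy classes of maps to the objects `o c`: it is generated by
the images under the maps `f : j ⟶ o c` of one element over each `o c`, and the relations among them
are detected on the classes `Q f`. -/
structure IsFreeOn : Prop where
  map : ∀ (c : κ) {j k : J} (a : j ⟶ k) (f : k ⟶ o c), C.map a.op (θ c f) = θ c (a ≫ f)
  span : ∀ (j : J) (x : C.obj (op j)), x ∈ AddSubgroup.closure {y | ∃ c f, y = θ c (j := j) f}
  exists_coord : ∀ j : J, ∃ π : C.obj (op j) →+ ((Σ c : κ, Q.obj j ⟶ Q.obj (o c)) →₀ ℤ),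
    ∀ c f, π (θ c f) = Finsupp.single ⟨c, Q.map f⟩ 1

variable {Q C o θ}

open Classical in
/-- The coordinate of a free functor that belongs to one generator, as an element of the isotropy
ring. -/
lemma IsFreeOn.exists_hom (h : IsFreeOn Q C o θ) (c : κ) (j : J) :
    ∃ l : C.obj (op j) →+ IsotropyRing 𝒞, ∀ c' f, l (θ c' f) =
      if c' = c then IsotropyRing.of (Q.map f) else 0 := by
  obtain ⟨π, hπ⟩ := h.exists_coord j
  let q : ((Σ c : κ, Q.obj j ⟶ Q.obj (o c)) →₀ ℤ) →+ IsotropyRing 𝒞 :=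
    Finsupp.liftAddHom fun p => zmultiplesHom _ (if p.1 = c then IsotropyRing.of p.2 else 0)
  refine ⟨q.comp π, fun c' f => ?_⟩
  rw [AddMonoidHom.comp_apply, hπ]
  exact (Finsupp.liftAddHom_apply_single _ _ _).trans (by simp)

lemma IsFreeOn.hom_ext (h : IsFreeOn Q C o θ) {j : J} {N : Type*} [AddCommGroup N]
    {f g : C.obj (op j) →+ N} (hfg : ∀ c a, f (θ c a) = g (θ c a)) (x : C.obj (op j)) :
    f x = g x := by
  induction h.span j x using AddSubgroup.closure_induction with
  | mem x hx => obtain ⟨c, a, rfl⟩ := hx; exact hfg c a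
  | zero => rw [map_zero, map_zero]
  | add x y _ _ hx hy => rw [map_add, map_add, hx, hy]
  | neg x _ hx => rw [map_neg, map_neg, hx]

/-- The tensor product of a free functor with `ζI` is the sum of the right ideals `1_T I`: the
elements `1_T ⊗ θ` and the coordinates `m ⊗ x ↦ x · m` are a dual basis. -/
theorem IsFreeOn.isProjectiveRank [Fintype 𝒞] [Fintype κ] (h : IsFreeOn Q C o θ) :
    IsProjectiveRank ((tensorFunctor (Q ⋙ zetaI 𝒞)).obj C)
      (∑ c, abMk _ (IsotropyRing.of (𝟙 (Q.obj (o c))))) := by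
  classical
  choose l hl using h.exists_hom
  have hmap : ∀ c (j k : J) (a : j ⟶ k) (x : C.obj (op k)),
      l c j (C.map a.op x) = l c k x * IsotropyRing.of (Q.map a) := fun c j k a x => by
    refine h.hom_ext (f := (l c j).comp (C.map a.op).hom.toAddMonoidHom)
      (g := (AddMonoidHom.mulRight (IsotropyRing.of (Q.map a))).comp (l c k)) (fun c' f => ?_) x
    change l c j (C.map a.op (θ c' f)) = l c k (θ c' f) * _
    rw [h.map, hl, hl, Q.map_comp]
    split_ifs with hc
    · rw [IsotropyRing.of_mul_of]
    · rw [zero_mul]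
  let M := Q ⋙ zetaI 𝒞
  -- The coordinate functional of the generator over `o c`.
  have hφ : ∀ c, ∃ φ : TensorProd M C →ₗ[(IsotropyRing 𝒞)ᵐᵒᵖ] IsotropyRing 𝒞,
      ∀ j (m : corner (Q.obj j)) (x : C.obj (op j)), φ (tmk M C j m x) = l c j x * m.1 := by
    intro c
    obtain ⟨φ, hφ⟩ := exists_tensorProd_lift M C (N := IsotropyRing 𝒞)
      (fun j =>
        { toFun := fun (m : corner (Q.obj j)) => (AddMonoidHom.mulRight m.1).comp (l c j)
          map_add' := fun m m' => by ext x; exact mul_add _ _ _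
          map_smul' := fun s m => by ext x; exact (mul_assoc (l c j x) m.1 s.unop).symm })
      (fun j k f m x => by
        change l c k x * (IsotropyRing.of (Q.map f) * m.1) = l c j (C.map f.op x) * m.1
        rw [hmap, mul_assoc])
    exact ⟨φ, hφ⟩
  choose φ hφ using hφ
  -- The generator `1_T` of the right ideal `1_T I`.
  let one (T : 𝒞) : corner T := ⟨IsotropyRing.of (𝟙 T), IsotropyRing.of (𝟙 T), by
    change IsotropyRing.of (𝟙 T) * IsotropyRing.of (𝟙 T) = _
    rw [IsotropyRing.of_mul_of, Category.comp_id]⟩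
  let x (c : κ) : TensorProd M C := tmk M C (o c) (one _) (θ c (𝟙 _))
  have hsum : (∑ c, smulMap (x c) ∘ₗ φ c) = LinearMap.id := by
    refine tensorProd_hom_ext M fun j (m : corner (Q.obj j)) y => ?_
    let tm : C.obj (op j) →+ TensorProd M C :=
      (tensorRel M C).mkQ.toAddMonoidHom.comp ((tensorIn M C j).toAddMonoidHom.comp
        (TensorProduct.mk ℤ _ _ m).toAddMonoidHom)
    refine h.hom_ext (f := ((∑ c, smulMap (x c) ∘ₗ φ c)).toAddMonoidHom.comp tm) (g := tm)
      (fun c f => ?_) y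
    change (∑ c, smulMap (x c) ∘ₗ φ c) (tmk M C j m (θ c f)) = tmk M C j m (θ c f)
    rw [LinearMap.sum_apply, Finset.sum_eq_single c]
    · change MulOpposite.op (φ c (tmk M C j m (θ c f))) • x c = _
      rw [hφ, hl, if_pos rfl]
      have h₁ : θ c f = C.map f.op (θ c (𝟙 _)) := by rw [h.map, Category.comp_id]
      rw [h₁]
      refine Eq.trans ?_ (tmk_map M C j (o c) f m _)
      refine (smul_tmk M C _ (o c) _ _).trans ?_
      have h₃ : MulOpposite.op (IsotropyRing.of (Q.map f) * m.1) • one (Q.obj (o c)) = M.map f m :=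
        Subtype.ext (by
          change IsotropyRing.of (𝟙 _) * (IsotropyRing.of (Q.map f) * m.1) =
            IsotropyRing.of (Q.map f) * m.1
          rw [← mul_assoc, IsotropyRing.of_mul_of, Category.comp_id])
      exact congrArg (fun y => tmk M C (o c) y (θ c (𝟙 _))) h₃
    · intro c' _ hc
      change MulOpposite.op (φ c' (tmk M C j m (θ c f))) • x c' = _
      rw [hφ, hl, if_neg hc.symm, zero_mul, MulOpposite.op_zero, zero_smul]
    · simp
  convert isProjectiveRank_of_fintype (P := (tensorFunctor (Q ⋙ zetaI 𝒞)).obj C) x φ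
    (fun p => ?_) using 3 with c
  · symm
    change φ c (tmk M C (o c) (one _) (θ c (𝟙 _))) = _
    rw [hφ, hl, if_pos rfl, Q.map_id, IsotropyRing.of_mul_of, Category.comp_id]
  · have := congrArg (fun F : TensorProd M C →ₗ[(IsotropyRing 𝒞)ᵐᵒᵖ] TensorProd M C => F p) hsum
    exact this.symm.trans (LinearMap.sum_apply _ _ _)

end TensorRank

/-! ### Ordered simplices and barycentric subdivision -/

section VertexChains

/-- The free abelian group on `k`-tuples of vertices in `E`, viewed as ordered simplices of
dimension `k - 1`. The degree is shifted so that the empty simplex, in degree `0`, augments the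
complex. -/
abbrev VertexChains (E : Type*) (k : ℕ) : Type _ := (Fin k → E) →₀ ℤ

namespace VertexChains

variable {E E' : Type*}

/-- An ordered simplex as a chain. -/
abbrev simplex {k : ℕ} (v : Fin k → E) : VertexChains E k := Finsupp.single v 1

lemma hom_ext {k : ℕ} {N : Type*} [AddCommGroup N] {f g : VertexChains E k →ₗ[ℤ] N}
    (h : ∀ v, f (simplex v) = g (simplex v)) : f = g :=
  Finsupp.lhom_ext' fun v => LinearMap.ext_ring (h v)

/-- The alternating sum of the faces. -/
def boundary (k : ℕ) : VertexChains E (k + 1) →ₗ[ℤ] VertexChains E k :=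
  Finsupp.linearCombination ℤ fun v =>
    ∑ i : Fin (k + 1), (-1 : ℤ) ^ (i : ℕ) • simplex (v ∘ i.succAbove)

/-- The cone with apex `e`. -/
def cone (e : E) (k : ℕ) : VertexChains E k →ₗ[ℤ] VertexChains E (k + 1) :=
  Finsupp.linearCombination ℤ fun v => simplex (Fin.cons e v)

/-- The map induced by a map of vertices. -/
def map (g : E → E') (k : ℕ) : VertexChains E k →ₗ[ℤ] VertexChains E' k :=
  Finsupp.linearCombination ℤ fun v => simplex (g ∘ v)

lemma boundary_simplex {k : ℕ} (v : Fin (k + 1) → E) :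
    boundary k (simplex v) = ∑ i : Fin (k + 1), (-1 : ℤ) ^ (i : ℕ) • simplex (v ∘ i.succAbove) := by
  rw [boundary, Finsupp.linearCombination_single, one_smul]

@[simp] lemma cone_simplex {k : ℕ} (e : E) (v : Fin k → E) :
    cone e k (simplex v) = simplex (Fin.cons e v) := by
  rw [cone, Finsupp.linearCombination_single, one_smul]

@[simp] lemma map_simplex {k : ℕ} (g : E → E') (v : Fin k → E) :
    map g k (simplex v) = simplex (g ∘ v) := by
  rw [map, Finsupp.linearCombination_single, one_smul]

lemma map_cone {k : ℕ} (g : E → E') (e : E) (x : VertexChains E k) :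
    map g (k + 1) (cone e k x) = cone (g e) k (map g k x) := by
  refine LinearMap.congr_fun (f := map g (k + 1) ∘ₗ cone e k) (g := cone (g e) k ∘ₗ map g k)
    (hom_ext fun v => ?_) x
  simp [Fin.comp_cons]

lemma map_boundary {k : ℕ} (g : E → E') (x : VertexChains E (k + 1)) :
    map g k (boundary k x) = boundary k (map g (k + 1) x) := by
  refine LinearMap.congr_fun (f := map g k ∘ₗ boundary k) (g := boundary k ∘ₗ map g (k + 1))
    (hom_ext fun v => ?_) x
  simp only [LinearMap.comp_apply, map_simplex, boundary_simplex, map_sum, map_zsmul]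
  rfl

lemma boundary_cone_zero (e : E) (x : VertexChains E 0) : boundary 0 (cone e 0 x) = x := by
  refine LinearMap.congr_fun (f := boundary 0 ∘ₗ cone e 0) (g := LinearMap.id)
    (hom_ext fun v => ?_) x
  rw [LinearMap.comp_apply, cone_simplex, boundary_simplex, Fin.sum_univ_one, LinearMap.id_apply]
  simp [Subsingleton.elim _ v]

lemma boundary_cone {k : ℕ} (e : E) (x : VertexChains E (k + 1)) :
    boundary (k + 1) (cone e (k + 1) x) = x - cone e k (boundary k x) := by
  refine LinearMap.congr_fun (f := boundary (k + 1) ∘ₗ cone e (k + 1))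
    (g := LinearMap.id - cone e k ∘ₗ boundary k) (hom_ext fun v => ?_) x
  have h₀ : (Fin.cons e v : Fin (k + 2) → E) ∘ Fin.succAbove 0 = v := by
    ext j; simp
  have h₁ : ∀ i : Fin (k + 1), (Fin.cons e v : Fin (k + 2) → E) ∘ Fin.succAbove i.succ =
      Fin.cons e (v ∘ i.succAbove) := fun i => by
    ext j
    refine Fin.cases ?_ (fun j => ?_) j <;> simp
  simp only [LinearMap.comp_apply, LinearMap.sub_apply, LinearMap.id_apply, cone_simplex,
    boundary_simplex, Fin.sum_univ_succ (n := k + 1), h₀, h₁, map_sum, map_zsmul]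
  simp [pow_succ, sub_eq_add_neg]

lemma boundary_boundary {k : ℕ} (x : VertexChains E (k + 2)) :
    boundary k (boundary (k + 1) x) = 0 := by
  induction k with
  | zero =>
    refine LinearMap.congr_fun (f := boundary 0 ∘ₗ boundary 1) (g := 0) (hom_ext fun v => ?_) x
    obtain ⟨e, w, rfl⟩ : ∃ e w, v = Fin.cons e w := ⟨v 0, Fin.tail v, (Fin.cons_self_tail v).symm⟩
    rw [LinearMap.comp_apply, ← cone_simplex, boundary_cone, map_sub, boundary_cone_zero, sub_self]
    rfl
  | succ k ih =>
    refine LinearMap.congr_fun (f := boundary (k + 1) ∘ₗ boundary (k + 2)) (g := 0)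
      (hom_ext fun v => ?_) x
    obtain ⟨e, w, rfl⟩ : ∃ e w, v = Fin.cons e w := ⟨v 0, Fin.tail v, (Fin.cons_self_tail v).symm⟩
    rw [LinearMap.comp_apply, ← cone_simplex, boundary_cone, map_sub, boundary_cone, ih, map_zero,
      sub_zero, sub_self]
    rfl

-- The barycentres `b k v` are arbitrary as long as only algebraic identities are concerned.
variable (b : ∀ k, (Fin (k + 1) → E) → E) (b' : ∀ k, (Fin (k + 1) → E') → E')

/-- The subdivision of a simplex is the cone, from its barycentre, on the subdivision of its
boundary. -/
def subdivision : ∀ k, VertexChains E k →ₗ[ℤ] VertexChains E k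
  | 0 => LinearMap.id
  | k + 1 => Finsupp.linearCombination ℤ fun v =>
      cone (b k v) k (subdivision k (boundary k (simplex v)))

/-- The chain homotopy from the identity to the subdivision. -/
def subdivisionHomotopy : ∀ k, VertexChains E k →ₗ[ℤ] VertexChains E (k + 1)
  | 0 => 0
  | k + 1 => Finsupp.linearCombination ℤ fun v =>
      cone (b k v) (k + 1) (simplex v - subdivisionHomotopy k (boundary k (simplex v)))

lemma subdivision_simplex {k : ℕ} (v : Fin (k + 1) → E) : subdivision b (k + 1) (simplex v) =
    cone (b k v) k (subdivision b k (boundary k (simplex v))) := by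
  rw [subdivision, Finsupp.linearCombination_single, one_smul]

lemma subdivisionHomotopy_simplex {k : ℕ} (v : Fin (k + 1) → E) :
    subdivisionHomotopy b (k + 1) (simplex v) =
      cone (b k v) (k + 1) (simplex v - subdivisionHomotopy b k (boundary k (simplex v))) := by
  rw [subdivisionHomotopy, Finsupp.linearCombination_single, one_smul]

lemma boundary_subdivisionHomotopy {k : ℕ} (x : VertexChains E (k + 1)) :
    boundary (k + 1) (subdivisionHomotopy b (k + 1) x) +
      subdivisionHomotopy b k (boundary k x) = x - subdivision b (k + 1) x := by
  induction k with
  | zero =>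
    refine LinearMap.congr_fun
      (f := boundary 1 ∘ₗ subdivisionHomotopy b 1 + subdivisionHomotopy b 0 ∘ₗ boundary 0)
      (g := LinearMap.id - subdivision b 1) (hom_ext fun v => ?_) x
    rw [LinearMap.add_apply, LinearMap.comp_apply, subdivisionHomotopy_simplex,
      LinearMap.comp_apply, boundary_cone, LinearMap.sub_apply, subdivision_simplex]
    simp [subdivision, subdivisionHomotopy]
  | succ k ih =>
    refine LinearMap.congr_fun
      (f := boundary (k + 2) ∘ₗ subdivisionHomotopy b (k + 2) +
        subdivisionHomotopy b (k + 1) ∘ₗ boundary (k + 1))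
      (g := LinearMap.id - subdivision b (k + 2)) (hom_ext fun v => ?_) x
    have h := ih (boundary (k + 1) (simplex v))
    rw [boundary_boundary, map_zero, add_zero] at h
    rw [LinearMap.add_apply, LinearMap.comp_apply, subdivisionHomotopy_simplex,
      LinearMap.comp_apply, boundary_cone, LinearMap.sub_apply, subdivision_simplex, map_sub (boundary (k + 1)), h,
      LinearMap.id_apply, sub_sub_cancel]
    abel

variable {b b'}

lemma map_subdivision {g : E → E'} (hg : ∀ k v, g (b k v) = b' k (g ∘ v)) {k : ℕ}
    (x : VertexChains E k) : map g k (subdivision b k x) = subdivision b' k (map g k x) := by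
  induction k with
  | zero => rfl
  | succ k ih =>
    refine LinearMap.congr_fun (f := map g (k + 1) ∘ₗ subdivision b (k + 1))
      (g := subdivision b' (k + 1) ∘ₗ map g (k + 1)) (hom_ext fun v => ?_) x
    rw [LinearMap.comp_apply, subdivision_simplex, map_cone, ih, map_boundary, hg,
      LinearMap.comp_apply, map_simplex, subdivision_simplex]

lemma map_subdivisionHomotopy {g : E → E'} (hg : ∀ k v, g (b k v) = b' k (g ∘ v)) {k : ℕ}
    (x : VertexChains E k) :
    map g (k + 1) (subdivisionHomotopy b k x) = subdivisionHomotopy b' k (map g k x) := by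
  induction k with
  | zero => simp [subdivisionHomotopy]
  | succ k ih =>
    refine LinearMap.congr_fun (f := map g (k + 2) ∘ₗ subdivisionHomotopy b (k + 1))
      (g := subdivisionHomotopy b' (k + 1) ∘ₗ map g (k + 1)) (hom_ext fun v => ?_) x
    rw [LinearMap.comp_apply, subdivisionHomotopy_simplex, map_cone, map_sub, ih, map_boundary, hg,
      LinearMap.comp_apply, map_simplex, subdivisionHomotopy_simplex]

section Metric

variable {E : Type*} [PseudoMetricSpace E] {b : ∀ k, (Fin (k + 1) → E) → E}

/-- The points which lie in every closed ball that contains the points `v j`. For points of a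
standard simplex this contains their convex hull, which is all that the estimates need. -/
def ballHull {κ : Type*} (v : κ → E) : Set E := {y | ∀ x r, (∀ j, dist x (v j) ≤ r) → dist x y ≤ r}

/-- The span of the simplices with vertices in the hull of `v` and of diameter at most `r`. -/
abbrev smallChains {κ : Type*} (v : κ → E) (r : ℝ) (k : ℕ) : Submodule ℤ (VertexChains E k) :=
  Finsupp.supported ℤ ℤ {w | (∀ i, w i ∈ ballHull v) ∧ ∀ i j, dist (w i) (w j) ≤ r}

/-- One subdivision shrinks the diameter of a simplex with `k` vertices at least by the factor
`(k - 1) / k`, and its simplices stay in the hull of the given one. -/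
lemma subdivision_mem_smallChains (hb : ∀ k v, b k v ∈ ballHull v)
    (hb' : ∀ k (v : Fin (k + 1) → E) r, (∀ i j, dist (v i) (v j) ≤ r) →
      ∀ j, dist (b k v) (v j) ≤ k / (k + 1) * r) {k : ℕ} (v : Fin k → E) {r : ℝ}
    (hv : ∀ i j, dist (v i) (v j) ≤ r) :
    subdivision b k (simplex v) ∈ smallChains v ((k - 1) / k * r) k := by
  induction k with
  | zero => exact Finsupp.single_mem_supported ℤ _ ⟨fun i => i.elim0, fun i => i.elim0⟩
  | succ k ih =>
    have hr : 0 ≤ r := dist_nonneg.trans (hv 0 0)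
    rw [subdivision_simplex, boundary_simplex, map_sum, map_sum]
    refine Submodule.sum_mem _ fun i _ => ?_
    rw [map_zsmul, map_zsmul]
    refine Submodule.smul_mem _ _ ?_
    have h : smallChains (v ∘ i.succAbove) ((k - 1) / k * r) k ≤
        (smallChains v (((k + 1 : ℕ) - 1) / (k + 1 : ℕ) * r) (k + 1)).comap (cone (b k v) k) := by
      rw [smallChains, Finsupp.supported_eq_span_single, Submodule.span_le]
      rintro _ ⟨w, ⟨hw₁, hw₂⟩, rfl⟩
      have hw : ∀ j, w j ∈ ballHull v := fun j x r' hx => hw₁ j x r' fun l => hx _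
      have hd : ∀ j, dist (b k v) (w j) ≤ ((k + 1 : ℕ) - 1) / (k + 1 : ℕ) * r := fun j => by
        have := hw j (b k v) _ (hb' k v r hv)
        simpa using this
      have h0 : 0 ≤ (((k + 1 : ℕ) : ℝ) - 1) / (k + 1 : ℕ) * r := by
        push_cast
        rw [add_sub_cancel_right]
        positivity
      change cone (b k v) k (simplex w) ∈
        smallChains v (((k + 1 : ℕ) - 1) / (k + 1 : ℕ) * r) (k + 1)
      rw [cone_simplex]
      refine Finsupp.single_mem_supported ℤ _ ⟨fun j => ?_, fun j l => ?_⟩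
      · refine Fin.cases ?_ (fun j => ?_) j
        · exact hb k v
        · exact hw j
      · refine Fin.cases ?_ (fun j => ?_) j <;> refine Fin.cases ?_ (fun l => ?_) l
        · simpa using h0
        · exact hd l
        · rw [dist_comm]
          exact hd j
        · refine (hw₂ j l).trans (mul_le_mul_of_nonneg_right ?_ hr)
          have hk : (0 : ℝ) < k := Nat.cast_pos.2 (Fin.pos j)
          push_cast
          rw [div_le_div_iff₀ hk (by positivity)]
          linarith
    exact h (ih (v ∘ i.succAbove) fun j l => hv _ _)

/-- The simplices of the iterated subdivisions become arbitrarily small. -/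
lemma subdivision_iterate_mem (hb : ∀ k v, b k v ∈ ballHull v)
    (hb' : ∀ k (v : Fin (k + 1) → E) r, (∀ i j, dist (v i) (v j) ≤ r) →
      ∀ j, dist (b k v) (v j) ≤ k / (k + 1) * r) {k : ℕ} (v : Fin k → E) {r : ℝ}
    (hv : ∀ i j, dist (v i) (v j) ≤ r) (m : ℕ) :
    ((subdivision b k)^[m]) (simplex v) ∈ smallChains v (((k - 1) / k) ^ m * r) k := by
  induction m with
  | zero =>
    refine Finsupp.single_mem_supported ℤ _ ⟨fun i x r' hx => hx i, fun i j => ?_⟩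
    simpa using hv i j
  | succ m ih =>
    rw [Function.iterate_succ_apply']
    have h : smallChains v (((k - 1) / k) ^ m * r) k ≤
        (smallChains v (((k - 1) / k) ^ (m + 1) * r) k).comap (subdivision b k) := by
      nth_rewrite 1 [smallChains]
      rw [Finsupp.supported_eq_span_single, Submodule.span_le]
      rintro _ ⟨w, ⟨hw₁, hw₂⟩, rfl⟩
      have := subdivision_mem_smallChains hb hb' w hw₂
      have hsub : {w' : Fin k → E | (∀ i, w' i ∈ ballHull w) ∧
          ∀ i j, dist (w' i) (w' j) ≤ ((k : ℝ) - 1) / k ^ 1 * (((k - 1) / k) ^ m * r)} ⊆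
          {w' | (∀ i, w' i ∈ ballHull v) ∧
            ∀ i j, dist (w' i) (w' j) ≤ ((k - 1) / k) ^ (m + 1) * r} := fun w' hw' =>
        ⟨fun i x r' hx => hw'.1 i x r' fun j => hw₁ j x r' hx,
          fun i j => (hw'.2 i j).trans_eq (by ring)⟩
      rw [pow_one] at hsub
      exact Finsupp.supported_mono hsub this
    exact h ih

end Metric

end VertexChains

end VertexChains

/-! ### Singular simplices -/

section SingularSimplices

open Simplicial

/-- The standard topological simplex of dimension `k`. -/
abbrev Simplex (k : ℕ) : Type := stdSimplex ℝ (Fin (k + 1))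

/-- The `i`-th face of the standard simplex. -/
def simplexFace {k : ℕ} (i : Fin (k + 2)) : C(Simplex k, Simplex (k + 1)) :=
  ⟨stdSimplex.map i.succAbove, stdSimplex.continuous_map _⟩

variable {X Y : TopCat.{u}} {k : ℕ}

/-- A singular simplex as an element of the singular chain complex. -/
def gen (σ : C(Simplex k, X)) : (singularChains.obj X).X k :=
  ((TopCat.toSSet.obj X).ιChainComplex (R := ModuleCat.of ℤ (ULift.{u} ℤ))
    ((TopCat.toSSetObjEquiv X (op ⦋k⦌)).symm σ)).hom ⟨1⟩

lemma d_gen (σ : C(Simplex (k + 1), X)) : ((singularChains.obj X).d (k + 1) k).hom (gen σ) =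
    ∑ i : Fin (k + 2), (-1 : ℤ) ^ (i : ℕ) • gen (σ.comp (simplexFace i)) := by
  have h := congrArg (fun F => F.hom ⟨1⟩) ((TopCat.toSSet.obj X).ιChainComplex_d
    (R := ModuleCat.of ℤ (ULift.{u} ℤ)) ((TopCat.toSSetObjEquiv X (op ⦋k + 1⦌)).symm σ))
  refine Eq.trans h ?_
  simp only [ModuleCat.hom_sum, LinearMap.sum_apply, ModuleCat.hom_zsmul]
  rfl

lemma map_gen (f : X ⟶ Y) (σ : C(Simplex k, X)) :
    ((singularChains.map f).f k).hom (gen σ) = gen (f.hom.comp σ) :=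
  congrArg (fun F => F.hom ⟨1⟩) (SSet.ι_chainComplexMap_f _ _ (TopCat.toSSet.map f)
    (R := ModuleCat.of ℤ (ULift.{u} ℤ)) ((TopCat.toSSetObjEquiv X (op ⦋k⦌)).symm σ))

/-- The singular chains are free on the singular simplices. -/
lemma exists_singularLift {N : Type u} [AddCommGroup N] (F : C(Simplex k, X) → N) :
    ∃ φ : (singularChains.obj X).X k →+ N, ∀ σ, φ (gen σ) = F σ := by
  let φ := Limits.Cofan.IsColimit.desc ((TopCat.toSSet.obj X).isColimitChainComplexXCofan
    (ModuleCat.of ℤ (ULift.{u} ℤ)) k) (A := ModuleCat.of ℤ N) fun s => ModuleCat.ofHom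
      ((LinearMap.toSpanSingleton ℤ N (F (TopCat.toSSetObjEquiv X (op ⦋k⦌) s))) ∘ₗ
        (ULift.moduleEquiv (R := ℤ) (M := ℤ)).toLinearMap)
  refine ⟨φ.hom.toAddMonoidHom, fun σ => ?_⟩
  have h := congrArg (fun F => F.hom ⟨1⟩) (Limits.Cofan.IsColimit.fac
    ((TopCat.toSSet.obj X).isColimitChainComplexXCofan
    (ModuleCat.of ℤ (ULift.{u} ℤ)) k) (A := ModuleCat.of ℤ N) (fun s => ModuleCat.ofHom
      ((LinearMap.toSpanSingleton ℤ N (F (TopCat.toSSetObjEquiv X (op ⦋k⦌) s))) ∘ₗ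
        (ULift.moduleEquiv (R := ℤ) (M := ℤ)).toLinearMap))
          ((TopCat.toSSetObjEquiv X (op ⦋k⦌)).symm σ))
  refine Eq.trans h ?_
  simp

/-- Additive maps on singular chains are determined by their values on singular simplices. -/
lemma singular_hom_eq_zero {N : Type u} [AddCommGroup N] (q : (singularChains.obj X).X k →+ N)
    (hq : ∀ σ, q (gen σ) = 0) (x) : q x = 0 := by
  let p : ((TopCat.toSSet.obj X).chainComplex (ModuleCat.of ℤ (ULift.{u} ℤ))).X k ⟶
      ModuleCat.of ℤ N :=
    ModuleCat.ofHom
      { toFun := q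
        map_add' := map_add q
        map_smul' := fun n x => map_intCast_smul q ℤ ℤ n x }
  have h : p = 0 := SSet.chainComplex_hom_ext fun s => ModuleCat.hom_ext <| LinearMap.ext <| by
    rintro ⟨n⟩
    have hs : q (gen (TopCat.toSSetObjEquiv X (op ⦋k⦌) s)) = 0 := hq _
    rw [gen, Equiv.symm_apply_apply] at hs
    have hn : (⟨n⟩ : ULift.{u} ℤ) = n • ⟨1⟩ := ULift.ext _ _ (by simp)
    change ((TopCat.toSSet.obj X).ιChainComplex s ≫ p).hom (⟨n⟩ : ULift.{u} ℤ) = 0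
    rw [hn, map_zsmul]
    exact (congrArg (fun y => n • y) hs).trans (zsmul_zero n)
  exact congrArg (fun F : ((TopCat.toSSet.obj X).chainComplex (ModuleCat.of ℤ (ULift.{u} ℤ))).X k ⟶
      ModuleCat.of ℤ N => F.hom x) h

/-- The singular chains are spanned by the singular simplices. -/
lemma mem_closure_gen (x : (singularChains.obj X).X k) :
    x ∈ AddSubgroup.closure (Set.range (gen (X := X) (k := k))) :=
  (QuotientAddGroup.eq_zero_iff x).1 <| singular_hom_eq_zero
    (QuotientAddGroup.mk' (AddSubgroup.closure (Set.range (gen (X := X) (k := k)))))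
    (fun σ => (QuotientAddGroup.eq_zero_iff _).2 (AddSubgroup.subset_closure ⟨σ, rfl⟩)) x

lemma singular_hom_ext {N : Type*} [AddCommGroup N] {f g : (singularChains.obj X).X k →+ N}
    (h : ∀ σ, f (gen σ) = g (gen σ)) (x) : f x = g x := by
  induction mem_closure_gen x using AddSubgroup.closure_induction with
  | mem x hx => obtain ⟨σ, rfl⟩ := hx; exact h σ
  | zero => rw [map_zero, map_zero]
  | add x y _ _ hx hy => rw [map_add, map_add, hx, hy]
  | neg x _ hx => rw [map_neg, map_neg, hx]

end SingularSimplices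

/-! ### Affine simplices -/

section AffineSimplices

variable {κ ι : Type*} [Fintype κ] [Fintype ι] {ρ : Type*} [Fintype ρ]

/-- The affine combination of points of a simplex. -/
def affineComb (v : κ → stdSimplex ℝ ι) (t : stdSimplex ℝ κ) : stdSimplex ℝ ι :=
  ⟨fun i => ∑ j, t j * v j i,
    fun i => Finset.sum_nonneg fun j _ => mul_nonneg (t.2.1 j) ((v j).2.1 i), by
      rw [Finset.sum_comm]
      simp only [← Finset.mul_sum]
      simp⟩

lemma affineComb_apply (v : κ → stdSimplex ℝ ι) (t : stdSimplex ℝ κ) (i : ι) :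
    affineComb v t i = ∑ j, t j * v j i := rfl

lemma affineComb_affineComb (v : κ → stdSimplex ℝ ι) (w : ρ → stdSimplex ℝ κ)
    (t : stdSimplex ℝ ρ) :
    affineComb v (affineComb w t) = affineComb (affineComb v ∘ w) t := by
  refine Subtype.ext (funext fun i => ?_)
  change ∑ j, (∑ l, t l * w l j) * v j i = ∑ l, t l * ∑ j, w l j * v j i
  simp only [Finset.sum_mul, Finset.mul_sum]
  rw [Finset.sum_comm]
  simp only [mul_assoc]

lemma affineComb_vertex [DecidableEq ι] (t : stdSimplex ℝ ι) :
    affineComb (stdSimplex.vertex (S := ℝ)) t = t := by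
  refine Subtype.ext (funext fun i => ?_)
  change ∑ j, t j * (stdSimplex.vertex (S := ℝ) j : ι → ℝ) i = t i
  simp [Pi.single_apply]

lemma affineComb_apply_vertex [DecidableEq κ] (v : κ → stdSimplex ℝ ι) (j : κ) :
    affineComb v (stdSimplex.vertex (S := ℝ) j) = v j := by
  refine Subtype.ext (funext fun i => ?_)
  change ∑ l, (stdSimplex.vertex (S := ℝ) j : κ → ℝ) l * v l i = v j i
  simp [Pi.single_apply]

lemma map_eq_affineComb [DecidableEq ι] (f : κ → ι) (t : stdSimplex ℝ κ) :
    stdSimplex.map f t = affineComb (stdSimplex.vertex (S := ℝ) ∘ f) t := by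
  refine Subtype.ext (funext fun i => ?_)
  refine (FunOnFinite.linearMap_apply_apply ℝ ℝ f _ i).trans ?_
  change _ = ∑ j, t j * (stdSimplex.vertex (S := ℝ) (f j) : ι → ℝ) i
  rw [Finset.sum_filter]
  refine Finset.sum_congr rfl fun j _ => ?_
  simp [Pi.single_apply, eq_comm]

lemma affineComb_mem_ballHull (v : κ → stdSimplex ℝ ι) (t : stdSimplex ℝ κ) :
    affineComb v t ∈ VertexChains.ballHull v := by
  intro x r h
  have hr : 0 ≤ r := by
    obtain ⟨j⟩ : Nonempty κ := by
      by_contra hκ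
      rw [not_nonempty_iff] at hκ
      simpa using t.2.2
    exact dist_nonneg.trans (h j)
  rw [Subtype.dist_eq, dist_pi_le_iff hr]
  intro i
  have h₁ : x i - affineComb v t i = ∑ j, t j * (x i - v j i) := by
    simp only [mul_sub, Finset.sum_sub_distrib, ← Finset.sum_mul, affineComb_apply]
    simp
  change dist (x i) (affineComb v t i) ≤ r
  rw [Real.dist_eq, h₁]
  calc |∑ j, t j * (x i - v j i)| ≤ ∑ j, |t j * (x i - v j i)| := Finset.abs_sum_le_sum_abs _ _
    _ ≤ ∑ j, t j * r := Finset.sum_le_sum fun j _ => by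
        rw [abs_mul, abs_of_nonneg (show (0 : ℝ) ≤ DFunLike.coe t j from t.2.1 j)]
        refine mul_le_mul_of_nonneg_left ?_ (t.2.1 j)
        have := (dist_le_pi_dist (x : ι → ℝ) (v j) i).trans (h j)
        rwa [Real.dist_eq] at this
    _ = r := by rw [← Finset.sum_mul]; simp

/-- The affine map of simplices with prescribed images of the vertices. -/
def affineMap (v : κ → stdSimplex ℝ ι) : C(stdSimplex ℝ κ, stdSimplex ℝ ι) :=
  ⟨affineComb v, by
    refine Continuous.subtype_mk (continuous_pi fun i => continuous_finsetSum _ fun j _ => ?_) _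
    exact ((continuous_apply j).comp continuous_subtype_val).mul continuous_const⟩

/-- The barycentre of an ordered simplex. -/
def barycentre (k : ℕ) (v : Fin (k + 1) → stdSimplex ℝ ι) : stdSimplex ℝ ι :=
  affineComb v stdSimplex.barycenter

lemma affineComb_barycentre (v : κ → stdSimplex ℝ ι) (k : ℕ) (w : Fin (k + 1) → stdSimplex ℝ κ) :
    affineComb v (barycentre k w) = barycentre k (affineComb v ∘ w) :=
  affineComb_affineComb _ _ _

/-- The barycentre of `k + 1` points `v j` has the distance at most `k / (k + 1)` times the diameter
from each of them, as the point itself contributes nothing to the average of the distances. -/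
lemma dist_barycentre_le (k : ℕ) (v : Fin (k + 1) → stdSimplex ℝ ι) (r : ℝ)
    (h : ∀ i j, dist (v i) (v j) ≤ r) (j : Fin (k + 1)) :
    dist (barycentre k v) (v j) ≤ k / (k + 1) * r := by
  have hr : 0 ≤ r := dist_nonneg.trans (h 0 0)
  rw [Subtype.dist_eq, dist_pi_le_iff (by positivity)]
  intro i
  have hb : ∀ l, (stdSimplex.barycenter : stdSimplex ℝ (Fin (k + 1))) l = ((k : ℝ) + 1)⁻¹ :=
    fun l => by
      change ((Fintype.card (Fin (k + 1)) : ℝ))⁻¹ = _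
      simp
  have h₁ : barycentre k v i - v j i = ∑ l, ((k : ℝ) + 1)⁻¹ * (v l i - v j i) := by
    rw [barycentre, affineComb_apply]
    simp only [hb, mul_sub, Finset.sum_sub_distrib, Finset.sum_const, Finset.card_univ,
      Fintype.card_fin, nsmul_eq_mul]
    push_cast
    field_simp
  change dist (barycentre k v i) (v j i) ≤ _
  rw [Real.dist_eq, h₁, ← Finset.mul_sum, abs_mul, abs_of_pos (by positivity), div_mul_eq_mul_div,
    inv_mul_eq_div]
  refine div_le_div_of_nonneg_right ?_ (by positivity)
  calc |∑ l, (v l i - v j i)| ≤ ∑ l, |v l i - v j i| := Finset.abs_sum_le_sum_abs _ _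
    _ ≤ ∑ l, if l = j then 0 else r := Finset.sum_le_sum fun l _ => by
        split_ifs with hl
        · simp [hl]
        · have := (dist_le_pi_dist (v l : ι → ℝ) (v j) i).trans (h l j)
          rwa [Real.dist_eq] at this
    _ = k * r := by
        rw [Finset.sum_ite, Finset.sum_const_zero, zero_add, Finset.sum_const, nsmul_eq_mul,
          Finset.filter_ne', Finset.card_erase_of_mem (Finset.mem_univ _)]
        simp

end AffineSimplices

/-! ### Subdivision of singular chains -/

section SingularSubdivision

open VertexChains

variable {X Y : TopCat.{u}} {k n : ℕ}

/-- The singular chain obtained from a chain of ordered simplices in a standard simplex by composing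
the corresponding affine simplices with a singular simplex. -/
def realize (σ : C(Simplex n, X)) (k : ℕ) :
    VertexChains (Simplex n) (k + 1) →+ (singularChains.obj X).X k :=
  Finsupp.liftAddHom fun v => zmultiplesHom _ (gen (σ.comp (affineMap v)))

lemma realize_simplex (σ : C(Simplex n, X)) (v : Fin (k + 1) → Simplex n) :
    realize σ k (simplex v) = gen (σ.comp (affineMap v)) :=
  (Finsupp.liftAddHom_apply_single _ _ _).trans (by simp)

lemma vertexChains_hom_ext {E : Type*} {N : Type*} [AddCommGroup N]
    {f g : VertexChains E k →+ N} (h : ∀ v, f (simplex v) = g (simplex v)) (x) : f x = g x :=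
  DFunLike.congr_fun (Finsupp.addHom_ext' fun v => AddMonoidHom.ext_int (h v)) x

lemma map_realize (f : X ⟶ Y) (σ : C(Simplex n, X)) (x : VertexChains (Simplex n) (k + 1)) :
    ((singularChains.map f).f k).hom (realize σ k x) = realize (f.hom.comp σ) k x := by
  refine vertexChains_hom_ext (f := ((singularChains.map f).f k).hom.toAddMonoidHom.comp
    (realize σ k)) (fun v => ?_) x
  change ((singularChains.map f).f k).hom (realize σ k (simplex v)) = _
  rw [realize_simplex, realize_simplex, map_gen]
  rfl

/-- The standard simplex as an ordered simplex in itself. -/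
abbrev stdVertices (n : ℕ) : Fin (n + 1) → Simplex n := stdSimplex.vertex (S := ℝ)

lemma affineMap_stdVertices : affineMap (stdVertices n) = ContinuousMap.id _ :=
  ContinuousMap.ext affineComb_vertex

lemma gen_eq_realize (σ : C(Simplex n, X)) : gen σ = realize σ n (simplex (stdVertices n)) := by
  rw [realize_simplex, affineMap_stdVertices, ContinuousMap.comp_id]

lemma affineMap_comp_simplexFace (v : Fin (k + 2) → Simplex n) (i : Fin (k + 2)) :
    (affineMap v).comp (simplexFace i) = affineMap (v ∘ i.succAbove) := by
  refine ContinuousMap.ext fun t => ?_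
  change affineComb v (stdSimplex.map i.succAbove t) = affineComb _ t
  rw [map_eq_affineComb, affineComb_affineComb]
  congr 1
  exact funext fun j => affineComb_apply_vertex v _

lemma d_realize (σ : C(Simplex n, X)) (x : VertexChains (Simplex n) (k + 2)) :
    ((singularChains.obj X).d (k + 1) k).hom (realize σ (k + 1) x) =
      realize σ k (boundary (k + 1) x) := by
  refine vertexChains_hom_ext (f := ((singularChains.obj X).d (k + 1) k).hom.toAddMonoidHom.comp
    (realize σ (k + 1))) (g := (realize σ k).comp (boundary (k + 1)).toAddMonoidHom)
    (fun v => ?_) x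
  change ((singularChains.obj X).d (k + 1) k).hom (realize σ (k + 1) (simplex v)) =
    realize σ k (boundary (k + 1) (simplex v))
  rw [realize_simplex, d_gen, boundary_simplex, map_sum]
  refine Finset.sum_congr rfl fun i _ => ?_
  rw [map_zsmul, realize_simplex, ContinuousMap.comp_assoc, affineMap_comp_simplexFace]

lemma realize_comp_affineMap (σ : C(Simplex n, X)) {m : ℕ} (w : Fin (m + 1) → Simplex n)
    (x : VertexChains (Simplex m) (k + 1)) :
    realize (σ.comp (affineMap w)) k x = realize σ k (map (affineComb w) (k + 1) x) := by
  refine vertexChains_hom_ext (g := (realize σ k).comp (map (affineComb w) (k + 1)).toAddMonoidHom)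
    (fun v => ?_) x
  change _ = realize σ k (map (affineComb w) (k + 1) (simplex v))
  rw [map_simplex, realize_simplex, realize_simplex, ContinuousMap.comp_assoc]
  congr 2
  exact ContinuousMap.ext fun t => affineComb_affineComb w v t

variable (X k)

/-- The additive map on singular chains induced by a chain of ordered simplices in the standard
simplex. -/
def universalMap {l : ℕ} (c : VertexChains (Simplex k) (l + 1)) :
    (singularChains.obj X).X k →+ (singularChains.obj X).X l :=
  (exists_singularLift fun σ => realize σ l c).choose

/-- Barycentric subdivision of singular chains. -/
def singularSubdivision : (singularChains.obj X).X k →+ (singularChains.obj X).X k :=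
  universalMap X k (subdivision barycentre (k + 1) (simplex (stdVertices k)))

/-- The natural homotopy from the identity to the barycentric subdivision. -/
def singularSubdivisionHomotopy : (singularChains.obj X).X k →+ (singularChains.obj X).X (k + 1) :=
  universalMap X k (subdivisionHomotopy barycentre (k + 1) (simplex (stdVertices k)))

variable {X k}

lemma universalMap_gen {l : ℕ} (c : VertexChains (Simplex k) (l + 1)) (σ : C(Simplex k, X)) :
    universalMap X k c (gen σ) = realize σ l c :=
  (exists_singularLift fun σ => realize σ l c).choose_spec σ

lemma map_universalMap {l : ℕ} (c : VertexChains (Simplex k) (l + 1)) (f : X ⟶ Y)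
    (x : (singularChains.obj X).X k) :
    ((singularChains.map f).f l).hom (universalMap X k c x) =
      universalMap Y k c (((singularChains.map f).f k).hom x) := by
  refine singular_hom_ext
    (f := ((singularChains.map f).f l).hom.toAddMonoidHom.comp (universalMap X k c))
    (g := (universalMap Y k c).comp ((singularChains.map f).f k).hom.toAddMonoidHom)
    (fun σ => ?_) x
  change ((singularChains.map f).f l).hom (universalMap X k c (gen σ)) =
      universalMap Y k c (((singularChains.map f).f k).hom (gen σ))
  rw [universalMap_gen, map_gen, universalMap_gen, map_realize]

lemma affineComb_comp_stdVertices (v : Fin (k + 1) → Simplex n) :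
    affineComb v ∘ stdVertices k = v :=
  funext fun j => affineComb_apply_vertex v j

/-- Subdivision of singular chains corresponds to subdivision of ordered simplices, because
affine maps preserve barycentres. -/
lemma singularSubdivision_realize (σ : C(Simplex n, X)) (x : VertexChains (Simplex n) (k + 1)) :
    singularSubdivision X k (realize σ k x) = realize σ k (subdivision barycentre (k + 1) x) := by
  refine vertexChains_hom_ext (f := (singularSubdivision X k).comp (realize σ k))
    (g := (realize σ k).comp (subdivision barycentre (k + 1)).toAddMonoidHom) (fun v => ?_) x
  change singularSubdivision X k (realize σ k (simplex v)) =
    realize σ k (subdivision barycentre (k + 1) (simplex v))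
  rw [realize_simplex, singularSubdivision, universalMap_gen, realize_comp_affineMap,
    map_subdivision (affineComb_barycentre v), map_simplex, affineComb_comp_stdVertices]

lemma singularSubdivisionHomotopy_realize (σ : C(Simplex n, X))
    (x : VertexChains (Simplex n) (k + 1)) : singularSubdivisionHomotopy X k (realize σ k x) =
      realize σ (k + 1) (subdivisionHomotopy barycentre (k + 1) x) := by
  refine vertexChains_hom_ext (f := (singularSubdivisionHomotopy X k).comp (realize σ k))
    (g := (realize σ (k + 1)).comp (subdivisionHomotopy barycentre (k + 1)).toAddMonoidHom)
    (fun v => ?_) x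
  change singularSubdivisionHomotopy X k (realize σ k (simplex v)) =
    realize σ (k + 1) (subdivisionHomotopy barycentre (k + 1) (simplex v))
  rw [realize_simplex, singularSubdivisionHomotopy, universalMap_gen, realize_comp_affineMap,
    map_subdivisionHomotopy (affineComb_barycentre v), map_simplex, affineComb_comp_stdVertices]

lemma d_singularSubdivisionHomotopy_zero (x : (singularChains.obj X).X 0) :
    ((singularChains.obj X).d 1 0).hom (singularSubdivisionHomotopy X 0 x) =
      x - singularSubdivision X 0 x := by
  refine singular_hom_ext
    (f := ((singularChains.obj X).d 1 0).hom.toAddMonoidHom.comp (singularSubdivisionHomotopy X 0))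
    (g := AddMonoidHom.id _ - singularSubdivision X 0) (fun σ => ?_) x
  change ((singularChains.obj X).d 1 0).hom (singularSubdivisionHomotopy X 0 (gen σ)) =
    gen σ - singularSubdivision X 0 (gen σ)
  rw [gen_eq_realize, singularSubdivisionHomotopy_realize, singularSubdivision_realize, d_realize,
    ← map_sub, ← boundary_subdivisionHomotopy]
  simp [subdivisionHomotopy]

lemma d_singularSubdivisionHomotopy (x : (singularChains.obj X).X (k + 1)) :
    ((singularChains.obj X).d (k + 2) (k + 1)).hom (singularSubdivisionHomotopy X (k + 1) x) +
      singularSubdivisionHomotopy X k (((singularChains.obj X).d (k + 1) k).hom x) =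
      x - singularSubdivision X (k + 1) x := by
  refine singular_hom_ext
    (f := ((singularChains.obj X).d (k + 2) (k + 1)).hom.toAddMonoidHom.comp
      (singularSubdivisionHomotopy X (k + 1)) + (singularSubdivisionHomotopy X k).comp
        ((singularChains.obj X).d (k + 1) k).hom.toAddMonoidHom)
    (g := AddMonoidHom.id _ - singularSubdivision X (k + 1)) (fun σ => ?_) x
  change ((singularChains.obj X).d (k + 2) (k + 1)).hom
      (singularSubdivisionHomotopy X (k + 1) (gen σ)) +
      singularSubdivisionHomotopy X k (((singularChains.obj X).d (k + 1) k).hom (gen σ)) =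
    gen σ - singularSubdivision X (k + 1) (gen σ)
  rw [gen_eq_realize, singularSubdivisionHomotopy_realize, singularSubdivision_realize, d_realize,
    d_realize, singularSubdivisionHomotopy_realize, ← map_sub, ← map_add,
    boundary_subdivisionHomotopy]

lemma exists_comp_eq_of_range_subset {Z : Type*} [TopologicalSpace Z] (f : X ⟶ Y)
    (hf : IsEmbedding f) (σ : C(Z, Y)) (h : ∀ t, σ t ∈ Set.range f) :
    ∃ τ : C(Z, X), f.hom.comp τ = σ := by
  choose τ hτ using h
  have hc : Continuous τ := hf.continuous_iff.2 (by
    convert σ.continuous using 1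
    exact funext hτ)
  exact ⟨⟨τ, hc⟩, ContinuousMap.ext hτ⟩

/-- The singular chains of `Y` which come from chains of `X`. -/
abbrev chainRange (f : X ⟶ Y) (k : ℕ) : AddSubgroup ((singularChains.obj Y).X k) :=
  ((singularChains.map f).f k).hom.toAddMonoidHom.range

lemma universalMap_mem_chainRange {l : ℕ} (c : VertexChains (Simplex k) (l + 1)) (f : X ⟶ Y)
    {y : (singularChains.obj Y).X k} (hy : y ∈ chainRange f k) :
    universalMap Y k c y ∈ chainRange f l := by
  obtain ⟨x, rfl⟩ := hy
  exact ⟨universalMap X k c x, map_universalMap c f x⟩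

lemma d_mem_chainRange (f : X ⟶ Y) {l : ℕ} {y : (singularChains.obj Y).X k}
    (hy : y ∈ chainRange f k) : ((singularChains.obj Y).d k l).hom y ∈ chainRange f l := by
  obtain ⟨x, rfl⟩ := hy
  exact ⟨((singularChains.obj X).d k l).hom x,
    (congrArg (fun F => F.hom x) ((singularChains.map f).comm k l)).symm⟩

lemma mem_sup_of_forall {A B : Type*} [AddCommGroup A] [AddCommGroup B] (φ : A →+ B)
    {G₁ G₂ : AddSubgroup A} {H₁ H₂ : AddSubgroup B} (h₁ : ∀ x ∈ G₁, φ x ∈ H₁)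
    (h₂ : ∀ x ∈ G₂, φ x ∈ H₂) {x : A} (hx : x ∈ G₁ ⊔ G₂) : φ x ∈ H₁ ⊔ H₂ := by
  obtain ⟨a, ha, b, hb, rfl⟩ := AddSubgroup.mem_sup.1 hx
  rw [map_add]
  exact AddSubgroup.add_mem_sup (h₁ a ha) (h₂ b hb)

section Cover

variable {P N Y : TopCat.{u}} (b : P ⟶ Y) (g : N ⟶ Y) (hb : IsOpenEmbedding b)
  (hg : IsOpenEmbedding g) (hbg : ∀ y, y ∈ Set.range b ∨ y ∈ Set.range g)

include hb hg hbg

/-- The simplices of an iterated subdivision of a singular simplex eventually lie in one of the two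
open subspaces, by the Lebesgue number lemma. -/
lemma exists_iterate_gen_mem (σ : C(Simplex k, Y)) :
    ∃ m, (singularSubdivision Y k)^[m] (gen σ) ∈ chainRange b k ⊔ chainRange g k := by
  obtain ⟨δ, hδ, hcover⟩ := lebesgue_number_lemma_of_metric (s := (Set.univ : Set (Simplex k)))
    (c := fun i : Bool => cond i (σ ⁻¹' Set.range b) (σ ⁻¹' Set.range g)) isCompact_univ
    (fun i => by
      cases i
      · exact hg.isOpen_range.preimage σ.continuous
      · exact hb.isOpen_range.preimage σ.continuous)
    (fun x _ => by
      rcases hbg (σ x) with h | h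
      · exact Set.mem_iUnion.2 ⟨true, h⟩
      · exact Set.mem_iUnion.2 ⟨false, h⟩)
  obtain ⟨r, hr⟩ : ∃ r, ∀ i j, dist (stdVertices k i) (stdVertices k j) ≤ r :=
    ⟨_, fun i j => Metric.dist_le_diam_of_mem (isCompact_univ (X := Simplex k)).isBounded
      trivial trivial⟩
  have hr₀ : 0 ≤ r := dist_nonneg.trans (hr 0 0)
  have hq₀ : (0 : ℝ) ≤ ((k + 1 : ℕ) - 1) / (k + 1 : ℕ) := by
    push_cast
    rw [add_sub_cancel_right]
    positivity
  have hq₁ : (((k + 1 : ℕ) : ℝ) - 1) / (k + 1 : ℕ) < 1 := by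
    rw [div_lt_one (by positivity)]
    linarith
  obtain ⟨m, hm⟩ := exists_pow_lt_of_lt_one (show 0 < δ / (r + 1) by positivity) hq₁
  have hm' : ((((k + 1 : ℕ) : ℝ) - 1) / (k + 1 : ℕ)) ^ m * r < δ := by
    rw [lt_div_iff₀ (by positivity)] at hm
    have := pow_nonneg hq₀ m
    nlinarith
  refine ⟨m, ?_⟩
  have h₁ : (singularSubdivision Y k)^[m] (gen σ) =
      realize σ k ((subdivision barycentre (k + 1))^[m] (simplex (stdVertices k))) := by
    rw [gen_eq_realize]
    exact Function.Semiconj.iterate_right (f := realize σ k)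
      (fun x => (singularSubdivision_realize σ x).symm) m _ |>.symm
  have h₂ := subdivision_iterate_mem (b := barycentre)
    (fun k v => affineComb_mem_ballHull v _) dist_barycentre_le (stdVertices k) hr m
  rw [h₁]
  generalize (subdivision barycentre (k + 1))^[m] (simplex (stdVertices k)) = z at h₂ ⊢
  rw [smallChains, Finsupp.supported_eq_span_single] at h₂
  induction h₂ using Submodule.span_induction with
  | zero => rw [map_zero]; exact zero_mem _
  | add x y _ _ hx hy => rw [map_add]; exact add_mem hx hy
  | smul a x _ hx => rw [map_zsmul]; exact zsmul_mem hx a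
  | mem x hx =>
    obtain ⟨w, ⟨-, hw⟩, rfl⟩ := hx
    change realize σ k (simplex w) ∈ _
    rw [realize_simplex]
    obtain ⟨i, hi⟩ := hcover (w 0) trivial
    have hball : ∀ t, affineMap w t ∈ Metric.ball (w 0) δ := fun t => by
      rw [Metric.mem_ball, dist_comm]
      exact (affineComb_mem_ballHull w t (w 0) _ fun j => hw 0 j).trans_lt hm'
    cases i
    · obtain ⟨τ, hτ⟩ := exists_comp_eq_of_range_subset g hg.isEmbedding (σ.comp (affineMap w))
        fun t => hi (hball t)
      exact (le_sup_right : chainRange g k ≤ _) ⟨gen τ, by rw [← hτ]; exact map_gen g τ⟩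
    · obtain ⟨τ, hτ⟩ := exists_comp_eq_of_range_subset b hb.isEmbedding (σ.comp (affineMap w))
        fun t => hi (hball t)
      exact (le_sup_left : chainRange b k ≤ _) ⟨gen τ, by rw [← hτ]; exact map_gen b τ⟩

/-- Iterated subdivision makes every chain a sum of chains in the two open subspaces. -/
lemma exists_iterate_mem (x : (singularChains.obj Y).X k) :
    ∃ m, (singularSubdivision Y k)^[m] x ∈ chainRange b k ⊔ chainRange g k := by
  have hstep : ∀ (x : (singularChains.obj Y).X k) (m l : ℕ), m ≤ l →
      (singularSubdivision Y k)^[m] x ∈ chainRange b k ⊔ chainRange g k →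
      (singularSubdivision Y k)^[l] x ∈ chainRange b k ⊔ chainRange g k := by
    intro x m l hml hx
    induction l, hml using Nat.le_induction with
    | base => exact hx
    | succ l _ ih =>
      rw [Function.iterate_succ_apply']
      exact mem_sup_of_forall _ (fun _ => universalMap_mem_chainRange _ b)
        (fun _ => universalMap_mem_chainRange _ g) ih
  induction mem_closure_gen x using AddSubgroup.closure_induction with
  | mem x hx => obtain ⟨σ, rfl⟩ := hx; exact exists_iterate_gen_mem b g hb hg hbg σ
  | zero => exact ⟨0, zero_mem _⟩
  | add x y _ _ hx hy =>
    obtain ⟨m, hm⟩ := hx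
    obtain ⟨l, hl⟩ := hy
    refine ⟨max m l, ?_⟩
    rw [iterate_map_add]
    exact add_mem (hstep _ _ _ (le_max_left _ _) hm) (hstep _ _ _ (le_max_right _ _) hl)
  | neg x _ hx =>
    obtain ⟨m, hm⟩ := hx
    refine ⟨m, ?_⟩
    rw [iterate_map_neg]
    exact neg_mem hm

/-- A chain whose boundary is a sum of chains in the two open subspaces is such a sum up to a
boundary. -/
lemma exists_sub_d_mem (x : (singularChains.obj Y).X k)
    (hx : ∀ l, k = l + 1 → ((singularChains.obj Y).d k l).hom x ∈ chainRange b l ⊔ chainRange g l) :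
    ∃ y, x - ((singularChains.obj Y).d (k + 1) k).hom y ∈ chainRange b k ⊔ chainRange g k := by
  obtain ⟨m, hm⟩ := exists_iterate_mem b g hb hg hbg x
  induction m generalizing x with
  | zero => exact ⟨0, by simpa using hm⟩
  | succ m ih =>
    have hd : ∃ e ∈ chainRange b k ⊔ chainRange g k, singularSubdivision Y k x =
        x - ((singularChains.obj Y).d (k + 1) k).hom (singularSubdivisionHomotopy Y k x) - e := by
      cases k with
      | zero => exact ⟨0, zero_mem _, by rw [d_singularSubdivisionHomotopy_zero]; abel⟩
      | succ k =>
        refine ⟨singularSubdivisionHomotopy Y k (((singularChains.obj Y).d (k + 1) k).hom x),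
          mem_sup_of_forall _ (fun _ => universalMap_mem_chainRange _ b)
            (fun _ => universalMap_mem_chainRange _ g) (hx k rfl), ?_⟩
        rw [sub_sub, d_singularSubdivisionHomotopy]
        abel
    obtain ⟨e, he, hsd⟩ := hd
    obtain ⟨y, hy⟩ := ih (singularSubdivision Y k x) (fun l hl => by
      rw [hsd, map_sub, map_sub]
      have h0 : ((singularChains.obj Y).d k l).hom (((singularChains.obj Y).d (k + 1) k).hom
          (singularSubdivisionHomotopy Y k x)) = 0 :=
        congrArg (fun F => F.hom (singularSubdivisionHomotopy Y k x))
          ((singularChains.obj Y).d_comp_d (k + 1) k l)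
      rw [h0, sub_zero]
      exact sub_mem (hx l hl) (mem_sup_of_forall ((singularChains.obj Y).d k l).hom.toAddMonoidHom
        (fun _ => d_mem_chainRange b) (fun _ => d_mem_chainRange g) he)) hm
    refine ⟨singularSubdivisionHomotopy Y k x + y, ?_⟩
    have := add_mem hy he
    rw [hsd] at this
    rw [map_add]
    convert this using 1
    abel

end Cover

end SingularSubdivision

/-! ### Relative homology and excision -/

section RelativeHomology

open Limits HomologicalComplex

/-- The relative singular chain complex of a map of spaces. -/
abbrev relComplex {A B : TopCat.{u}} (f : A ⟶ B) : ChainComplex (ModuleCat.{u} ℤ) ℕ :=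
  cokernel (singularChains.map f)

/-- The map of relative singular chain complexes induced by a map of pairs. -/
abbrev relMap {A B A' B' : TopCat.{u}} (f : A ⟶ B) (f' : A' ⟶ B') (a : A ⟶ A') (b : B ⟶ B')
    (w : f ≫ b = a ≫ f') : relComplex f ⟶ relComplex f' :=
  cokernel.map _ _ (singularChains.map a) (singularChains.map b)
    (by rw [← Functor.map_comp, ← Functor.map_comp, w])

lemma relMap_comp {A B A' B' A'' B'' : TopCat.{u}} {f : A ⟶ B} {f' : A' ⟶ B'} {f'' : A'' ⟶ B''}
    (a : A ⟶ A') (b : B ⟶ B') (w : f ≫ b = a ≫ f') (a' : A' ⟶ A'') (b' : B' ⟶ B'')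
    (w' : f' ≫ b' = a' ≫ f'') :
    relMap f f' a b w ≫ relMap f' f'' a' b' w' =
      relMap f f'' (a ≫ a') (b ≫ b') (by rw [reassoc_of% w, w', Category.assoc]) := by
  apply (cancel_epi (cokernel.π _)).1
  simp

lemma quasiIso_relMap {A B A' B' : TopCat.{u}} (f : A ⟶ B) (f' : A' ⟶ B') [Mono f] [Mono f']
    (a : A ⟶ A') (b : B ⟶ B') (w : f ≫ b = a ≫ f') (ha : QuasiIso (singularChains.map a))
    (hb : QuasiIso (singularChains.map b)) : QuasiIso (relMap f f' a b w) :=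
  HomologySequence.quasiIso_τ₃ (pairSequenceMap f f' a b w) (pairSequence_shortExact f)
    (pairSequence_shortExact f') ha hb

/-- The relative complexes of a triple of spaces. -/
abbrev tripleSequence {A B C : TopCat.{u}} (f : A ⟶ B) (g : B ⟶ C) :
    ShortComplex (ChainComplex (ModuleCat.{u} ℤ) ℕ) :=
  ShortComplex.mk (relMap f (f ≫ g) (𝟙 A) g (by simp)) (relMap (f ≫ g) g f (𝟙 C) (by simp)) (by
    apply (cancel_epi (cokernel.π _)).1
    simp)

/-- The sequence of cokernels of two composable maps is exact, and starts with a monomorphism if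
the second map is one. -/
lemma tripleSequence_shortExact {A B C : TopCat.{u}} (f : A ⟶ B) (g : B ⟶ C) [Mono g] :
    (tripleSequence f g).ShortExact := by
  have h : singularChains.map (f ≫ g) = singularChains.map f ≫ singularChains.map g :=
    singularChains.map_comp f g
  have hex := kernelCokernelCompSequence_exact (singularChains.map f) (singularChains.map g)
  let e := cokernelIsoOfEq h
  let T : ShortComplex (ChainComplex (ModuleCat.{u} ℤ) ℕ) :=
    ShortComplex.mk
      (cokernel.map (singularChains.map f) (singularChains.map f ≫ singularChains.map g) (𝟙 _)
        (singularChains.map g) (by simp))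
      (cokernel.map (singularChains.map f ≫ singularChains.map g) (singularChains.map g)
        (singularChains.map f) (𝟙 _) (by simp)) (by
      apply (cancel_epi (cokernel.π _)).1
      simp)
  have hT : T.ShortExact :=
    { exact := hex.exact 3
      mono_f := (hex.exact 2).mono_g (by
        refine IsZero.eq_of_src (IsZero.of_iso (isZero_zero _) (kernel.ofMono _)) _ _)
      epi_g := by
        have hfac : cokernel.π (singularChains.map f ≫ singularChains.map g) ≫ cokernel.map
            (singularChains.map f ≫ singularChains.map g) (singularChains.map g)
            (singularChains.map f) (𝟙 _) (by simp) = cokernel.π (singularChains.map g) := by simp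
        exact epi_of_epi_fac hfac }
  refine ShortComplex.shortExact_of_iso (ShortComplex.isoMk (S₁ := T) (Iso.refl _) e.symm
    (Iso.refl _) ?_ ?_) hT
  · apply (cancel_epi (cokernel.π _)).1
    simp [T, e]
  · apply (cancel_epi (cokernel.π _)).1
    simp [T, e]

lemma quasiIso_of_acyclic {S : ShortComplex (ChainComplex (ModuleCat.{u} ℤ) ℕ)}
    (hS : S.ShortExact) (h : S.X₃.Acyclic) : QuasiIso S.f := by
  rw [quasiIso_iff]
  intro i
  rw [quasiIsoAt_iff_isIso_homologyMap]
  have h₁ : Mono (homologyMap S.f i) :=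
    (hS.homology_exact₁ (i + 1) i (by simp)).mono_g
      (((exactAt_iff_isZero_homology _ _).1 (h (i + 1))).eq_of_src _ _)
  have h₂ : Epi (homologyMap S.f i) :=
    (hS.homology_exact₂ i).epi_f (((exactAt_iff_isZero_homology _ _).1 (h i)).eq_of_tgt _ _)
  exact isIso_of_mono_of_epi _

lemma surjective_cokernel_π {K L : ChainComplex (ModuleCat.{u} ℤ) ℕ} (f : K ⟶ L) (i : ℕ) :
    Function.Surjective ((cokernel.π f).f i).hom :=
  (ModuleCat.epi_iff_surjective _).1 inferInstance

lemma exact_cokernel_π {K L : ChainComplex (ModuleCat.{u} ℤ) ℕ} (f : K ⟶ L) (i : ℕ) :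
    Function.Exact (f.f i).hom ((cokernel.π f).f i).hom :=
  (ShortComplex.ShortExact.moduleCat_exact_iff_function_exact _).1
    ((ShortComplex.exact_cokernel f).map (eval _ _ i))

section Excision

variable {M P N Y : TopCat.{u}} (f : M ⟶ P) (g : N ⟶ Y) (a : M ⟶ N) (b : P ⟶ Y)
  (w : f ≫ b = a ≫ g)

open Classical in
/-- The chains of `P` which are carried by `N` in `Y` come from `M`. The maps `q` and `r` of the
proof project to the chains spanned by the simplices in `M` and in `N`; they are compatible with the
inclusion of `P`. -/
lemma mem_chainRange_of_comm (hf : IsEmbedding f) (hb : IsEmbedding b)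
    (hpb : ∀ p, b p ∈ Set.range g → p ∈ Set.range f) (w : f ≫ b = a ≫ g) {k : ℕ}
    (x : (singularChains.obj P).X k) (y : (singularChains.obj N).X k)
    (h : ((singularChains.map b).f k).hom x = ((singularChains.map g).f k).hom y) :
    x ∈ chainRange f k := by
  obtain ⟨q, hq⟩ := exists_singularLift (X := P) (k := k) fun σ =>
    if ∀ t, σ t ∈ Set.range f then gen σ else 0
  obtain ⟨r, hr⟩ := exists_singularLift (X := Y) (k := k) fun σ =>
    if ∀ t, σ t ∈ Set.range g then gen σ else 0
  have h₁ : ∀ x, ((singularChains.map b).f k).hom (q x) =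
      r (((singularChains.map b).f k).hom x) := by
    refine singular_hom_ext (f := ((singularChains.map b).f k).hom.toAddMonoidHom.comp q)
      (g := r.comp ((singularChains.map b).f k).hom.toAddMonoidHom) fun σ => ?_
    change ((singularChains.map b).f k).hom (q (gen σ)) =
      r (((singularChains.map b).f k).hom (gen σ))
    rw [map_gen, hq, hr]
    have hiff : (∀ t, (b.hom.comp σ) t ∈ Set.range g) ↔ ∀ t, σ t ∈ Set.range f := by
      refine forall_congr' fun t => ⟨hpb _, ?_⟩
      rintro ⟨m, hm⟩
      refine ⟨a m, ?_⟩
      change g (a m) = b (σ t)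
      rw [← hm]
      exact (congrArg (fun F => F m) w).symm
    simp only [hiff]
    split_ifs
    · exact map_gen b σ
    · rw [map_zero]
  have h₂ : ∀ y, r (((singularChains.map g).f k).hom y) = ((singularChains.map g).f k).hom y := by
    refine singular_hom_ext (f := r.comp ((singularChains.map g).f k).hom.toAddMonoidHom)
      (g := ((singularChains.map g).f k).hom.toAddMonoidHom) fun σ => ?_
    change r (((singularChains.map g).f k).hom (gen σ)) = ((singularChains.map g).f k).hom (gen σ)
    rw [map_gen, hr, if_pos fun t => ⟨σ t, rfl⟩]
  have h₃ : ∀ x, q x ∈ chainRange f k := by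
    intro x
    induction mem_closure_gen x using AddSubgroup.closure_induction with
    | mem x hx =>
      obtain ⟨σ, rfl⟩ := hx
      rw [hq]
      split_ifs with hσ
      · obtain ⟨τ, rfl⟩ := exists_comp_eq_of_range_subset f hf σ hσ
        exact ⟨gen τ, map_gen f τ⟩
      · exact zero_mem _
    | zero => rw [map_zero]; exact zero_mem _
    | add x y _ _ hx hy => rw [map_add]; exact add_mem hx hy
    | neg x _ hx => rw [map_neg]; exact neg_mem hx
  have hmono : Mono b := (TopCat.mono_iff_injective b).2 hb.injective
  have hinj : Function.Injective ((singularChains.map b).f k).hom :=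
    (ModuleCat.mono_iff_injective _).1 inferInstance
  have h₄ : q x = x := hinj (by rw [h₁, h, h₂])
  rw [← h₄]
  exact h₃ x

/-- Excision: for open subspaces `P` and `N` which cover `Y`, with intersection `M`, the pair
`(P, M)` has the homology of the pair `(Y, N)`. -/
theorem quasiIso_relMap_excision (hf : IsEmbedding f) (hb : IsOpenEmbedding b)
    (hg : IsOpenEmbedding g) (hbg : ∀ y, y ∈ Set.range b ∨ y ∈ Set.range g)
    (hpb : ∀ p, b p ∈ Set.range g → p ∈ Set.range f) : QuasiIso (relMap f g a b w) := by
  have hπ : ∀ k x, ((relMap f g a b w).f k).hom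
      (((cokernel.π (singularChains.map f)).f k).hom x) =
      ((cokernel.π (singularChains.map g)).f k).hom (((singularChains.map b).f k).hom x) := by
    intro k x
    have h : cokernel.π (singularChains.map f) ≫ relMap f g a b w =
        singularChains.map b ≫ cokernel.π (singularChains.map g) := by simp
    exact congrArg (fun F : singularChains.obj P ⟶ relComplex g => (F.f k).hom x) h
  have hmono : Mono (relMap f g a b w) := by
    refine mono_of_mono_f _ fun k => (ModuleCat.mono_iff_injective _).2 ?_
    refine (injective_iff_map_eq_zero _).2 fun x hx => ?_
    obtain ⟨x, rfl⟩ := surjective_cokernel_π _ k x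
    obtain ⟨y, hy⟩ := (exact_cokernel_π (singularChains.map g) k _).1 ((hπ k x).symm.trans hx)
    exact (exact_cokernel_π (singularChains.map f) k x).2 (mem_chainRange_of_comm f g a b hf
      hb.isEmbedding hpb w x y hy.symm)
  let T := ShortComplex.mk (relMap f g a b w) (cokernel.π (relMap f g a b w))
    (cokernel.condition _)
  have hT : T.ShortExact :=
    { exact := ShortComplex.exact_cokernel _
      mono_f := hmono
      epi_g := inferInstanceAs (Epi (cokernel.π (relMap f g a b w))) }
  -- It remains to see that the cokernel is acyclic. It is the quotient of the chains of `Y` by the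
  -- sums of chains of `P` and of `N`; by subdivision every cycle of it is a boundary.
  refine quasiIso_of_acyclic hT fun k => ?_
  let p (k : ℕ) : (singularChains.obj Y).X k →+ (cokernel (relMap f g a b w)).X k :=
    ((cokernel.π (relMap f g a b w)).f k).hom.toAddMonoidHom.comp
      ((cokernel.π (singularChains.map g)).f k).hom.toAddMonoidHom
  have hp : ∀ k, Function.Surjective (p k) := fun k =>
    (surjective_cokernel_π _ k).comp (surjective_cokernel_π _ k)
  have hpd : ∀ k l x, ((cokernel (relMap f g a b w)).d k l).hom (p k x) =
      p l (((singularChains.obj Y).d k l).hom x) := fun k l x => by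
    have h := (cokernel.π (singularChains.map g) ≫ cokernel.π (relMap f g a b w)).comm k l
    exact congrArg (fun F : (singularChains.obj Y).X k ⟶ (cokernel (relMap f g a b w)).X l =>
      F.hom x) h
  have hpker : ∀ k x, p k x = 0 ↔ x ∈ chainRange b k ⊔ chainRange g k := fun k x => by
    constructor
    · intro h
      obtain ⟨z, hz⟩ := (exact_cokernel_π (relMap f g a b w) k _).1 h
      obtain ⟨z, rfl⟩ := surjective_cokernel_π _ k z
      rw [hπ] at hz
      have h0 : ((cokernel.π (singularChains.map g)).f k).hom
          (x - ((singularChains.map b).f k).hom z) = 0 := by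
        rw [map_sub, sub_eq_zero]
        exact hz.symm
      obtain ⟨y, hy⟩ := (exact_cokernel_π (singularChains.map g) k _).1 h0
      exact AddSubgroup.mem_sup.2 ⟨_, ⟨z, rfl⟩, _, ⟨y, hy⟩, add_sub_cancel _ _⟩
    · intro h
      obtain ⟨_, ⟨z, rfl⟩, _, ⟨y, rfl⟩, rfl⟩ := AddSubgroup.mem_sup.1 h
      have h₁ : p k (((singularChains.map b).f k).hom z) = 0 := by
        refine (congrArg ((cokernel.π (relMap f g a b w)).f k).hom (hπ k z).symm).trans ?_
        exact (exact_cokernel_π (relMap f g a b w) k _).2 ⟨_, rfl⟩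
      have h₂ : p k (((singularChains.map g).f k).hom y) = 0 := by
        refine (congrArg ((cokernel.π (relMap f g a b w)).f k).hom
          ((exact_cokernel_π (singularChains.map g) k _).2 ⟨y, rfl⟩)).trans (map_zero _)
      rw [map_add]
      exact (congrArg₂ (· + ·) h₁ h₂).trans (add_zero 0)
  have hd : ∀ z : (cokernel (relMap f g a b w)).X k,
      (∀ l, k = l + 1 → ((cokernel (relMap f g a b w)).d k l).hom z = 0) →
      ∃ y, ((cokernel (relMap f g a b w)).d (k + 1) k).hom y = z := by
    intro z hz
    obtain ⟨x, rfl⟩ := hp k z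
    obtain ⟨y, hy⟩ := exists_sub_d_mem b g hb hg hbg x fun l hl => by
      rw [← hpker, ← hpd]
      exact hz l hl
    refine ⟨p (k + 1) y, ?_⟩
    rw [hpd]
    rw [← hpker, map_sub, sub_eq_zero] at hy
    exact hy.symm
  cases k with
  | zero =>
    rw [exactAt_iff' _ 1 0 0 (by simp) (by simp)]
    rw [ShortComplex.moduleCat_exact_iff]
    exact fun z _ => hd z fun l hl => by omega
  | succ k =>
    rw [exactAt_iff' _ (k + 2) (k + 1) k (by simp) (by simp)]
    rw [ShortComplex.moduleCat_exact_iff]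
    refine fun z hz => hd z fun l hl => ?_
    obtain rfl : k = l := by omega
    exact hz

end Excision

end RelativeHomology

/-! ### Pairs of subspaces and the suspension isomorphism -/

section SubspacePairs

open Limits HomologicalComplex

/-- Homotopy equivalences induce quasi-isomorphisms of singular chains. -/
lemma quasiIso_of_homotopy {X Y : TopCat.{u}} (f : X ⟶ Y) (g : Y ⟶ X)
    (h : (f ≫ g).hom.Homotopic (𝟙 X : X ⟶ X).hom) (h' : (g ≫ f).hom.Homotopic (𝟙 Y : Y ⟶ Y).hom) :
    QuasiIso (singularChains.map f) := by
  rw [quasiIso_iff]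
  intro i
  rw [quasiIsoAt_iff_isIso_homologyMap]
  have key : ∀ {Z : TopCat.{u}} (φ : Z ⟶ Z), φ.hom.Homotopic (𝟙 Z : Z ⟶ Z).hom →
      homologyMap (singularChains.map φ) i = 𝟙 _ := fun φ hφ => by
    refine (TopCat.Homotopy.congr_homologyMap_singularChainComplexFunctor (g := 𝟙 _) hφ.some
      (ModuleCat.of ℤ (ULift.{u} ℤ)) i).trans ?_
    change homologyMap (singularChains.map (𝟙 _)) i = _
    rw [CategoryTheory.Functor.map_id, homologyMap_id]
  refine ⟨homologyMap (singularChains.map g) i, ?_, ?_⟩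
  · rw [← homologyMap_comp, ← Functor.map_comp, key _ h]
  · rw [← homologyMap_comp, ← Functor.map_comp, key _ h']

/-- The restriction of a map of spaces to subspaces. -/
def setMap {P P' : TopCat.{u}} (φ : P ⟶ P') {s : Set P} {s' : Set P'} (h : Set.MapsTo φ s s') :
    TopCat.of s ⟶ TopCat.of s' :=
  TopCat.ofHom ⟨h.restrict, φ.hom.continuous.restrict h⟩

section

variable {P : TopCat.{u}}

lemma mapsTo_id {s t : Set P} (h : s ⊆ t) : Set.MapsTo (𝟙 P : P ⟶ P) s t := h

/-- The inclusion of subspaces. -/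
abbrev setIncl {s t : Set P} (h : s ⊆ t) : TopCat.of s ⟶ TopCat.of t :=
  setMap (𝟙 P) (mapsTo_id h)

lemma isEmbedding_setIncl {s t : Set P} (h : s ⊆ t) : IsEmbedding (setIncl h) :=
  IsEmbedding.inclusion h

lemma isOpenEmbedding_setIncl {s t : Set P} (h : s ⊆ t) (hs : IsOpen s) :
    IsOpenEmbedding (setIncl h) :=
  ⟨isEmbedding_setIncl h, by
    have : Set.range (setIncl h) = (Subtype.val : t → P) ⁻¹' s := Set.range_inclusion h
    rw [this]
    exact hs.preimage continuous_subtype_val⟩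

instance mono_setIncl {s t : Set P} (h : s ⊆ t) : Mono (setIncl h) :=
  (TopCat.mono_iff_injective _).2 (isEmbedding_setIncl h).injective

/-- A subspace into which the space can be deformed, such that the deformation preserves the
subspace, has the same homology. -/
lemma quasiIso_setIncl_of_deformation {s : Set P} (H : C(unitInterval × P, P))
    (h₀ : ∀ p, H (0, p) = p) (h₁ : ∀ p, H (1, p) ∈ s) (hs : ∀ t, ∀ p ∈ s, H (t, p) ∈ s) :
    QuasiIso (singularChains.map (setIncl (Set.subset_univ s))) := by
  let r : TopCat.of (Set.univ : Set P) ⟶ TopCat.of s := TopCat.ofHom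
    ⟨fun p => ⟨H (1, p.1), h₁ p.1⟩, by
      exact (H.continuous.comp (continuous_const.prodMk continuous_subtype_val)).subtype_mk _⟩
  refine quasiIso_of_homotopy _ r (ContinuousMap.Homotopic.symm ⟨⟨⟨fun q =>
    ⟨H (q.1, q.2.1), hs _ _ q.2.2⟩, ?_⟩, fun p => ?_, fun p => ?_⟩⟩)
    (ContinuousMap.Homotopic.symm ⟨⟨⟨fun q => ⟨H (q.1, q.2.1), trivial⟩, ?_⟩,
      fun p => ?_, fun p => ?_⟩⟩)
  · exact (H.continuous.comp
      (continuous_fst.prodMk (continuous_subtype_val.comp continuous_snd))).subtype_mk _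
  · exact Subtype.ext (h₀ p.1)
  · rfl
  · exact (H.continuous.comp
      (continuous_fst.prodMk (continuous_subtype_val.comp continuous_snd))).subtype_mk _
  · exact Subtype.ext (h₀ p.1)
  · rfl

/-- The relative homology of a pair of subspaces. -/
abbrev pairHomology {s t : Set P} (h : s ⊆ t) (k : ℕ) : ModuleCat.{u} ℤ :=
  (relComplex (setIncl h)).homology k

end

variable {P P' P'' : TopCat.{u}}

lemma setMap_comm (φ : P ⟶ P') {s t : Set P} {s' t' : Set P'} (h : s ⊆ t) (h' : s' ⊆ t')
    (hs : Set.MapsTo φ s s') (ht : Set.MapsTo φ t t') :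
    setIncl h ≫ setMap φ ht = setMap φ hs ≫ setIncl h' := rfl

/-- The map of relative homology induced by a map of pairs of subspaces. -/
abbrev pairMap (φ : P ⟶ P') {s t : Set P} {s' t' : Set P'} (h : s ⊆ t) (h' : s' ⊆ t')
    (hs : Set.MapsTo φ s s') (ht : Set.MapsTo φ t t') (k : ℕ) :
    pairHomology h k ⟶ pairHomology h' k :=
  homologyMap (relMap (setIncl h) (setIncl h') (setMap φ hs) (setMap φ ht)
    (setMap_comm φ h h' hs ht)) k

lemma isIso_pairMap (φ : P ⟶ P') {s t : Set P} {s' t' : Set P'} (h : s ⊆ t) (h' : s' ⊆ t')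
    (hs : Set.MapsTo φ s s') (ht : Set.MapsTo φ t t') (k : ℕ)
    (hq : QuasiIso (relMap (setIncl h) (setIncl h') (setMap φ hs) (setMap φ ht)
      (setMap_comm φ h h' hs ht))) : IsIso (pairMap φ h h' hs ht k) :=
  (quasiIsoAt_iff_isIso_homologyMap _ _).1 (QuasiIso.quasiIsoAt k)

lemma pairMap_comp (φ : P ⟶ P') (ψ : P' ⟶ P'') (χ : P ⟶ P'') (e : φ ≫ ψ = χ) {s t : Set P}
    {s' t' : Set P'} {s'' t'' : Set P''} (h : s ⊆ t) (h' : s' ⊆ t') (h'' : s'' ⊆ t'')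
    (hs : Set.MapsTo φ s s') (ht : Set.MapsTo φ t t') (hs' : Set.MapsTo ψ s' s'')
    (ht' : Set.MapsTo ψ t' t'') (hs'' : Set.MapsTo χ s s'') (ht'' : Set.MapsTo χ t t'') (k : ℕ) :
    pairMap φ h h' hs ht k ≫ pairMap ψ h' h'' hs' ht' k = pairMap χ h h'' hs'' ht'' k := by
  subst e
  exact (homologyMap_comp _ _ _).symm.trans (congrArg (homologyMap · k) (relMap_comp _ _ _ _ _ _))

/-- A decomposition `N = A ∪ B`, `W = A ∩ B` into open subspaces of `P`, such that the inclusions of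
`A` and `B` into `P` are homology isomorphisms. -/
structure SuspensionData (P : TopCat.{u}) where
  (W A B N : Set P)
  isOpen_A : IsOpen A
  isOpen_B : IsOpen B
  W_sub_A : W ⊆ A
  W_sub_B : W ⊆ B
  A_sub_N : A ⊆ N
  B_sub_N : B ⊆ N
  inter_sub : A ∩ B ⊆ W
  sub_union : N ⊆ A ∪ B
  quasiIso_A : QuasiIso (singularChains.map (setIncl (Set.subset_univ A)))
  quasiIso_B : QuasiIso (singularChains.map (setIncl (Set.subset_univ B)))

namespace SuspensionData

variable (S : SuspensionData P) (S' : SuspensionData P')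

lemma tripleShortExact :
    (tripleSequence (setIncl S.B_sub_N) (setIncl (Set.subset_univ S.N))).ShortExact :=
  tripleSequence_shortExact _ _

/-- The connecting homomorphism of the triple `B ⊆ N ⊆ P`. -/
def connect (k : ℕ) : pairHomology (Set.subset_univ S.N) (k + 1) ⟶ pairHomology S.B_sub_N k :=
  S.tripleShortExact.δ (k + 1) k (by simp)

instance isIso_connect (k : ℕ) : IsIso (S.connect k) := by
  have hac : (relComplex (setIncl S.B_sub_N ≫ setIncl (Set.subset_univ S.N))).Acyclic :=
    (pairSequence_shortExact (setIncl (Set.subset_univ S.B))).acyclic_X₃ S.quasiIso_B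
  exact S.tripleShortExact.isIso_δ _ _ _ ((exactAt_iff_isZero_homology _ _).1 (hac _))
    ((exactAt_iff_isZero_homology _ _).1 (hac _))

/-- The excision map of the decomposition. -/
abbrev excision (k : ℕ) : pairHomology S.W_sub_A k ⟶ pairHomology S.B_sub_N k :=
  pairMap (𝟙 P) S.W_sub_A S.B_sub_N (mapsTo_id S.W_sub_B) (mapsTo_id S.A_sub_N) k

/-- The map which includes the pair `(A, W)` into `(P, W)`. -/
abbrev enlarge (k : ℕ) : pairHomology S.W_sub_A k ⟶ pairHomology (Set.subset_univ S.W) k :=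
  pairMap (𝟙 P) S.W_sub_A (Set.subset_univ S.W) (mapsTo_id subset_rfl)
    (mapsTo_id (Set.subset_univ S.A)) k

instance isIso_excision (k : ℕ) : IsIso (S.excision k) := by
  refine isIso_pairMap _ _ _ _ _ _ ?_
  refine quasiIso_relMap_excision (setIncl S.W_sub_A) (setIncl S.B_sub_N) (setIncl S.W_sub_B)
    (setIncl S.A_sub_N) _ (isEmbedding_setIncl _) (isOpenEmbedding_setIncl _ S.isOpen_A)
    (isOpenEmbedding_setIncl _ S.isOpen_B) ?_ ?_
  · intro y
    rcases S.sub_union y.2 with h | h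
    · exact Or.inl ⟨⟨y.1, h⟩, rfl⟩
    · exact Or.inr ⟨⟨y.1, h⟩, rfl⟩
  · rintro p ⟨q, hq⟩
    have hq' : q.1 = p.1 := congrArg Subtype.val hq
    exact ⟨⟨p.1, S.inter_sub ⟨p.2, hq' ▸ q.2⟩⟩, rfl⟩

instance isIso_enlarge (k : ℕ) : IsIso (S.enlarge k) := by
  refine isIso_pairMap _ _ _ _ _ _ (quasiIso_relMap _ _ _ _ _ ?_ S.quasiIso_A)
  have h : setMap (𝟙 P) (s := S.W) (s' := S.W) (mapsTo_id subset_rfl) = 𝟙 _ := rfl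
  rw [h, CategoryTheory.Functor.map_id]
  infer_instance

/-- The suspension isomorphism `H_{k+1}(P, N) ≅ H_k(N, B) ≅ H_k(A, W) ≅ H_k(P, W)`. -/
def suspension (k : ℕ) :
    pairHomology (Set.subset_univ S.N) (k + 1) ⟶ pairHomology (Set.subset_univ S.W) k :=
  S.connect k ≫ inv (S.excision k) ≫ S.enlarge k

instance isIso_suspension (k : ℕ) : IsIso (S.suspension k) := by
  unfold suspension; infer_instance

variable {S S'}

/-- The suspension isomorphism is natural for maps which preserve the decompositions. -/
lemma suspension_naturality (φ : P ⟶ P') (hW : Set.MapsTo φ S.W S'.W)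
    (hA : Set.MapsTo φ S.A S'.A) (hB : Set.MapsTo φ S.B S'.B) (hN : Set.MapsTo φ S.N S'.N) (k : ℕ) :
    pairMap φ (Set.subset_univ S.N) (Set.subset_univ S'.N) hN (Set.mapsTo_univ _ _) (k + 1) ≫
      S'.suspension k = S.suspension k ≫
        pairMap φ (Set.subset_univ S.W) (Set.subset_univ S'.W) hW (Set.mapsTo_univ _ _) k := by
  let τ : tripleSequence (setIncl S.B_sub_N) (setIncl (Set.subset_univ S.N)) ⟶
      tripleSequence (setIncl S'.B_sub_N) (setIncl (Set.subset_univ S'.N)) :=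
    { τ₁ := relMap _ _ (setMap φ hB) (setMap φ hN) (setMap_comm φ _ _ _ _)
      τ₂ := relMap _ _ (setMap φ hB) (setMap φ (Set.mapsTo_univ φ Set.univ)) rfl
      τ₃ := relMap _ _ (setMap φ hN) (setMap φ (Set.mapsTo_univ φ Set.univ)) rfl
      comm₁₂ := by
        apply (cancel_epi (cokernel.π _)).1
        simp only [cokernel.π_desc_assoc, Category.assoc, cokernel.π_desc, ← Functor.map_comp_assoc]
        rfl
      comm₂₃ := by
        apply (cancel_epi (cokernel.π _)).1
        simp only [cokernel.π_desc_assoc, Category.assoc, cokernel.π_desc, ← Functor.map_comp_assoc]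
        rfl }
  have h₁ : pairMap φ (Set.subset_univ S.N) (Set.subset_univ S'.N) hN (Set.mapsTo_univ _ _)
      (k + 1) ≫ S'.connect k = S.connect k ≫ pairMap φ S.B_sub_N S'.B_sub_N hB hN k :=
    (HomologySequence.δ_naturality τ S.tripleShortExact S'.tripleShortExact (k + 1) k
      (by simp)).symm
  have h₂ : pairMap φ S.B_sub_N S'.B_sub_N hB hN k ≫ inv (S'.excision k) =
      inv (S.excision k) ≫ pairMap φ S.W_sub_A S'.W_sub_A hW hA k := by
    rw [IsIso.comp_inv_eq, Category.assoc, IsIso.eq_inv_comp]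
    exact (pairMap_comp (𝟙 P) φ φ (by simp) _ _ _ _ _ _ _
      (hB.comp (mapsTo_id S.W_sub_B)) (hN.comp (mapsTo_id S.A_sub_N)) k).trans
      (pairMap_comp φ (𝟙 P') φ (by simp) _ _ _ _ _ _ _ _ _ k).symm
  have h₃ : pairMap φ S.W_sub_A S'.W_sub_A hW hA k ≫ S'.enlarge k = S.enlarge k ≫
      pairMap φ (Set.subset_univ S.W) (Set.subset_univ S'.W) hW (Set.mapsTo_univ _ _) k :=
    (pairMap_comp φ (𝟙 P') φ (by simp) _ _ _ _ _ _ _ hW (Set.mapsTo_univ _ _) k).trans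
      (pairMap_comp (𝟙 P) φ φ (by simp) _ _ _ _ _ _ _ _ _ k).symm
  rw [suspension, suspension, reassoc_of% h₁, reassoc_of% h₂, Category.assoc, Category.assoc, h₃]

end SuspensionData

end SubspacePairs

/-! ### Relative homology in degree zero -/

section DegreeZero

open Limits HomologicalComplex

/-- The projection of the degree zero chains to the homology in degree zero. -/
def toH0 (K : ChainComplex (ModuleCat.{u} ℤ) ℕ) : K.X 0 ⟶ K.homology 0 :=
  K.pOpcycles 0 ≫ K.isoHomologyι₀.inv

instance (K : ChainComplex (ModuleCat.{u} ℤ) ℕ) : Epi (toH0 K) := by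
  unfold toH0; infer_instance

lemma d_toH0 (K : ChainComplex (ModuleCat.{u} ℤ) ℕ) : K.d 1 0 ≫ toH0 K = 0 := by
  simp [toH0]

lemma toH0_naturality {K L : ChainComplex (ModuleCat.{u} ℤ) ℕ} (φ : K ⟶ L) :
    toH0 K ≫ homologyMap φ 0 = φ.f 0 ≫ toH0 L := by
  simp [toH0]

lemma exists_toH0_desc (K : ChainComplex (ModuleCat.{u} ℤ) ℕ) {A : ModuleCat.{u} ℤ}
    (f : K.X 0 ⟶ A) (hf : K.d 1 0 ≫ f = 0) : ∃ g : K.homology 0 ⟶ A, toH0 K ≫ g = f :=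
  ⟨K.isoHomologyι₀.hom ≫ K.descOpcycles f 1 (by simp) hf, by simp [toH0]⟩

/-- The class of a point in relative homology of degree zero. -/
def pointClass {A B : TopCat.{u}} (f : A ⟶ B) (y : B) : (relComplex f).homology 0 :=
  ((cokernel.π (singularChains.map f)).f 0 ≫ toH0 (relComplex f)).hom
    (gen (ContinuousMap.const (Simplex 0) y))

lemma map_pointClass {A B A' B' : TopCat.{u}} (f : A ⟶ B) (f' : A' ⟶ B') (a : A ⟶ A') (b : B ⟶ B')
    (w : f ≫ b = a ≫ f') (y : B) :
    (homologyMap (relMap f f' a b w) 0).hom (pointClass f y) = pointClass f' (b y) := by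
  have h : ((cokernel.π (singularChains.map f)).f 0 ≫ toH0 (relComplex f)) ≫
      homologyMap (relMap f f' a b w) 0 = (singularChains.map b).f 0 ≫
        (cokernel.π (singularChains.map f')).f 0 ≫ toH0 (relComplex f') := by
    rw [Category.assoc, toH0_naturality, ← comp_f_assoc, cokernel.π_desc, comp_f, Category.assoc]
  refine (congrArg (fun F => F.hom (gen (ContinuousMap.const (Simplex 0) y))) h).trans ?_
  change ((cokernel.π (singularChains.map f')).f 0 ≫ toH0 (relComplex f')).hom
    (((singularChains.map b).f 0).hom (gen (ContinuousMap.const (Simplex 0) y))) = _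
  rw [map_gen]
  rfl

lemma eq_const_of_simplex_zero {X : TopCat.{u}} (σ : C(Simplex 0, X)) :
    σ = ContinuousMap.const (Simplex 0) (σ default) :=
  ContinuousMap.ext fun _ => congrArg σ (Subsingleton.elim _ _)

/-- The relative homology in degree zero is spanned by the classes of points. -/
lemma mem_closure_pointClass {A B : TopCat.{u}} (f : A ⟶ B) (x : (relComplex f).homology 0) :
    x ∈ AddSubgroup.closure (Set.range (pointClass f)) := by
  have hepi : Epi ((cokernel.π (singularChains.map f)).f 0 ≫ toH0 (relComplex f)) :=
    inferInstance
  obtain ⟨c, rfl⟩ := (ModuleCat.epi_iff_surjective _).1 hepi x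
  induction mem_closure_gen c using AddSubgroup.closure_induction with
  | mem c hc =>
    obtain ⟨σ, rfl⟩ := hc
    rw [eq_const_of_simplex_zero σ]
    exact AddSubgroup.subset_closure ⟨_, rfl⟩
  | zero => rw [map_zero]; exact zero_mem _
  | add x y _ _ hx hy => rw [map_add]; exact add_mem hx hy
  | neg x _ hx => rw [map_neg]; exact neg_mem hx

lemma pointClass_eq_of_joined {A B : TopCat.{u}} (f : A ⟶ B) {y y' : B} (h : Joined y y') :
    pointClass f y = pointClass f y' := by
  obtain ⟨γ⟩ := h
  let σ : C(Simplex 1, B) := ⟨fun t => γ ⟨t 1, t.2.1 1, by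
    have h0 : (0 : ℝ) ≤ t 0 := t.2.1 0
    have h1 : ∑ i, t i = 1 := t.2.2
    rw [Fin.sum_univ_two] at h1
    linarith⟩, γ.continuous.comp (((continuous_apply 1).comp continuous_subtype_val).subtype_mk _)⟩
  have h0 : σ.comp (simplexFace 0) = ContinuousMap.const (Simplex 0) y' := by
    refine ContinuousMap.ext fun t => ?_
    refine Eq.trans (congrArg γ (Subtype.ext ?_)) γ.target
    change (stdSimplex.map (Fin.succAbove 0) t) 1 = 1
    rw [Subsingleton.elim t (stdSimplex.vertex 0), stdSimplex.map_vertex]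
    simp
  have h1 : σ.comp (simplexFace 1) = ContinuousMap.const (Simplex 0) y := by
    refine ContinuousMap.ext fun t => ?_
    refine Eq.trans (congrArg γ (Subtype.ext ?_)) γ.source
    change (stdSimplex.map (Fin.succAbove 1) t) 1 = 0
    rw [Subsingleton.elim t (stdSimplex.vertex 0), stdSimplex.map_vertex]
    simp
  have hd : (singularChains.obj B).d 1 0 ≫ (cokernel.π (singularChains.map f)).f 0 ≫
      toH0 (relComplex f) = 0 := by
    rw [← Hom.comm_assoc, d_toH0, comp_zero]
  have h := congrArg (fun F => F.hom (gen σ)) hd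
  change ((cokernel.π (singularChains.map f)).f 0 ≫ toH0 (relComplex f)).hom
    (((singularChains.obj B).d 1 0).hom (gen σ)) = 0 at h
  rw [d_gen, Fin.sum_univ_two, h0, h1, map_add, map_zsmul, map_zsmul] at h
  have h' : pointClass f y' - pointClass f y = 0 := by
    rw [sub_eq_add_neg, ← h]
    simp [pointClass]
  exact (sub_eq_zero.1 h').symm

/-- Functionals on the homology in degree zero relative to the empty set are given by functions on
the set of path components. -/
lemma exists_pointClass_lift {A B : TopCat.{u}} [IsEmpty A] (f : A ⟶ B) {κ : Type u} (F : B → κ)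
    (hF : ∀ y y', Joined y y' → F y = F y') :
    ∃ π : (relComplex f).homology 0 →+ (κ →₀ ℤ),
      ∀ y, π (pointClass f y) = Finsupp.single (F y) 1 := by
  obtain ⟨q, hq⟩ := exists_singularLift (X := B) (k := 0) fun σ =>
    Finsupp.single (F (σ default)) (1 : ℤ)
  let p : (singularChains.obj B).X 0 ⟶ ModuleCat.of ℤ (κ →₀ ℤ) := ModuleCat.ofHom
    { toFun := q
      map_add' := map_add q
      map_smul' := fun n x => map_intCast_smul q ℤ ℤ n x }
  have hd : (singularChains.obj B).d 1 0 ≫ p = 0 := by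
    refine ModuleCat.hom_ext <| LinearMap.ext fun x => ?_
    refine singular_hom_eq_zero (((singularChains.obj B).d 1 0 ≫ p).hom.toAddMonoidHom)
      (fun σ => ?_) x
    change q (((singularChains.obj B).d 1 0).hom (gen σ)) = 0
    rw [d_gen, Fin.sum_univ_two, map_add, map_zsmul, map_zsmul, hq, hq]
    have hj : Joined (σ.comp (simplexFace 0) default) (σ.comp (simplexFace 1) default) :=
      (PathConnectedSpace.joined _ _).map σ.continuous
    rw [hF _ _ hj]
    simp
  have h0 : (singularChains.map f).f 0 ≫ p = 0 := by
    refine ModuleCat.hom_ext <| LinearMap.ext fun x => ?_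
    exact singular_hom_eq_zero (((singularChains.map f).f 0 ≫ p).hom.toAddMonoidHom)
      (fun σ => isEmptyElim (σ default)) x
  have hc := (ShortComplex.exact_cokernel (singularChains.map f)).map (eval _ _ 0)
  have hepi : Epi ((ShortComplex.mk (singularChains.map f) (cokernel.π (singularChains.map f))
      (cokernel.condition _)).map (eval (ModuleCat ℤ) (ComplexShape.down ℕ) 0)).g :=
    inferInstanceAs (Epi ((cokernel.π (singularChains.map f)).f 0))
  let p' : (relComplex f).X 0 ⟶ ModuleCat.of ℤ (κ →₀ ℤ) := hc.desc p h0
  have hp' : (cokernel.π (singularChains.map f)).f 0 ≫ p' = p := hc.g_desc p h0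
  have hepi' : Epi ((cokernel.π (singularChains.map f)).f 1) := inferInstance
  obtain ⟨g, hg⟩ := exists_toH0_desc (relComplex f) p' (by
    rw [← cancel_epi ((cokernel.π (singularChains.map f)).f 1), Hom.comm_assoc, hp', hd, comp_zero])
  refine ⟨g.hom.toAddMonoidHom, fun y => ?_⟩
  have h : ((cokernel.π (singularChains.map f)).f 0 ≫ toH0 (relComplex f)) ≫ g = p := by
    rw [Category.assoc, hg, hp']
  exact (congrArg (fun F => F.hom (gen (ContinuousMap.const (Simplex 0) y))) h).trans (hq _)

end DegreeZero

/-! ### The homology of a space times Euclidean space, relative to the zero section -/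

section EuclideanPairs

open Limits HomologicalComplex

/-- The product of a space with Euclidean `n`-space. -/
abbrev euclProd (Z : TopCat.{u}) (n : ℕ) : TopCat.{u} := TopCat.of (Z × EuclideanSpace ℝ (Fin n))

/-- The map of products with Euclidean space induced by a map of spaces. -/
abbrev euclProdMap {Z Z' : TopCat.{u}} (φ : Z ⟶ Z') (n : ℕ) : euclProd Z n ⟶ euclProd Z' n :=
  TopCat.ofHom ⟨Prod.map φ id, φ.hom.continuous.prodMap continuous_id⟩

/-- The points of `Z × ℝⁿ` one of whose first `k` coordinates does not vanish. -/
def offAxis (Z : TopCat.{u}) (n k : ℕ) : Set (euclProd Z n) :=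
  {p | ∃ i : Fin n, (i : ℕ) < k ∧ p.2 i ≠ 0}

/-- The points of `Z × ℝⁿ` at which the `k`-th coordinate has the sign of `ε`, or one of the
earlier coordinates does not vanish. -/
def offHalfAxis (Z : TopCat.{u}) {n : ℕ} (k : Fin n) (ε : ℝ) : Set (euclProd Z n) :=
  offAxis Z n k ∪ {p | 0 < ε * p.2 k}

variable {Z Z' : TopCat.{u}} {n : ℕ}

lemma continuous_coord (i : Fin n) : Continuous fun p : euclProd Z n => p.2 i :=
  (EuclideanSpace.proj (𝕜 := ℝ) i).continuous.comp continuous_snd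

lemma isOpen_offAxis (k : ℕ) : IsOpen (offAxis Z n k) := by
  have h : offAxis Z n k = ⋃ (i : Fin n) (_ : (i : ℕ) < k), {p | p.2 i ≠ 0} := by
    ext p; simp [offAxis]
  rw [h]
  exact isOpen_iUnion fun i => isOpen_iUnion fun _ =>
    isOpen_ne_fun (continuous_coord i) continuous_const

lemma isOpen_offHalfAxis (k : Fin n) (ε : ℝ) : IsOpen (offHalfAxis Z k ε) :=
  (isOpen_offAxis _).union (isOpen_lt continuous_const ((continuous_coord k).const_mul ε))

/-- Translation along the `k`-th coordinate axis deforms the whole space into `offHalfAxis`. -/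
lemma quasiIso_offHalfAxis (k : Fin n) (ε : ℝ) (hε : ε * ε = 1) :
    QuasiIso (singularChains.map (setIncl (Set.subset_univ (offHalfAxis Z k ε)))) := by
  -- Push along the `k`-th coordinate axis, far enough to get the desired sign.
  have hx : ∀ (t : ℝ) (x : EuclideanSpace ℝ (Fin n)) (i : Fin n),
      (x + (t * ε * (1 + |x k|)) • EuclideanSpace.single k (1 : ℝ)) i =
        x i + if i = k then t * ε * (1 + |x k|) else 0 := fun t x i => by
    simp [PiLp.single_apply]
  refine quasiIso_setIncl_of_deformation ⟨fun q => (q.2.1, q.2.2 +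
    ((q.1 : ℝ) * ε * (1 + |q.2.2 k|)) • EuclideanSpace.single k (1 : ℝ)), ?_⟩ ?_ ?_ ?_
  · have h := (continuous_coord (Z := Z) k).comp
      (continuous_snd : Continuous (Prod.snd : unitInterval × euclProd Z n → _))
    have h' : Continuous fun q : unitInterval × euclProd Z n =>
        (q.1 : ℝ) * ε * (1 + |q.2.2 k|) :=
      ((continuous_subtype_val.comp continuous_fst).mul continuous_const).mul
        (continuous_const.add h.abs)
    exact (continuous_fst.comp continuous_snd).prodMk
      ((continuous_snd.comp continuous_snd).add (h'.smul continuous_const))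
  · rintro ⟨z, x⟩
    simp
  · rintro ⟨z, x⟩
    refine Or.inr ?_
    change 0 < ε * (x + (((1 : unitInterval) : ℝ) * ε * (1 + |x k|)) •
      EuclideanSpace.single k (1 : ℝ)) k
    rw [hx, if_pos rfl]
    have hε' : |ε| = 1 := by
      rcases mul_self_eq_one_iff.1 hε with h | h <;> simp [h]
    have h1 : |ε * x k| = |x k| := by rw [abs_mul, hε', one_mul]
    have h2 := neg_abs_le (ε * x k)
    have h3 : ε * (x k + ((1 : unitInterval) : ℝ) * ε * (1 + |x k|)) =
        ε * x k + (ε * ε) * (1 + |x k|) := by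
      rw [Set.Icc.coe_one]; ring
    rw [h3, hε]
    linarith
  · rintro t ⟨z, x⟩ (⟨i, hi, hxi⟩ | h)
    · refine Or.inl ⟨i, hi, ?_⟩
      change (x + ((t : ℝ) * ε * (1 + |x k|)) • EuclideanSpace.single k (1 : ℝ)) i ≠ 0
      rw [hx, if_neg (fun h => by rw [h] at hi; exact lt_irrefl _ hi), add_zero]
      exact hxi
    · refine Or.inr ?_
      change 0 < ε * (x + ((t : ℝ) * ε * (1 + |x k|)) • EuclideanSpace.single k (1 : ℝ)) k
      rw [hx, if_pos rfl]
      have h3 : ε * (x k + (t : ℝ) * ε * (1 + |x k|)) =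
          ε * x k + (t : ℝ) * ((ε * ε) * (1 + |x k|)) := by ring
      rw [h3, hε]
      have h4 : 0 < ε * x k := h
      have := t.2.1
      positivity

lemma offAxis_mono {k l : ℕ} (h : k ≤ l) : offAxis Z n k ⊆ offAxis Z n l :=
  fun _ ⟨i, hi, hx⟩ => ⟨i, hi.trans_le h, hx⟩

lemma offHalfAxis_subset (k : Fin n) (ε : ℝ) : offHalfAxis Z k ε ⊆ offAxis Z n (k + 1) := by
  rintro p (h | h)
  · exact offAxis_mono (Nat.le_succ _) h
  · exact ⟨k, Nat.lt_succ_self _, fun h0 => by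
      have h' : 0 < ε * p.2 k := h
      rw [h0, mul_zero] at h'
      exact lt_irrefl _ h'⟩

/-- The decomposition of the set of points at which one of the first `k + 1` coordinates does not
vanish, according to the sign of the last one of them. -/
def euclSuspension (Z : TopCat.{u}) {n : ℕ} (k : Fin n) : SuspensionData (euclProd Z n) where
  W := offAxis Z n k
  A := offHalfAxis Z k 1
  B := offHalfAxis Z k (-1)
  N := offAxis Z n (k + 1)
  isOpen_A := isOpen_offHalfAxis _ _
  isOpen_B := isOpen_offHalfAxis _ _
  W_sub_A := Set.subset_union_left
  W_sub_B := Set.subset_union_left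
  A_sub_N := offHalfAxis_subset _ _
  B_sub_N := offHalfAxis_subset _ _
  inter_sub := by
    rintro p ⟨h | h, h' | h'⟩
    · exact h
    · exact h
    · exact h'
    · have h1 : 0 < 1 * p.2 k := h
      have h2 : 0 < -1 * p.2 k := h'
      linarith
  sub_union := by
    rintro p ⟨i, hi, hx⟩
    rcases (Nat.lt_succ_iff.1 hi).lt_or_eq with hik | hik
    · exact Or.inl (Or.inl ⟨i, hik, hx⟩)
    · obtain rfl : i = k := Fin.ext hik
      rcases hx.lt_or_gt with h | h
      · refine Or.inr (Or.inr ?_)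
        change 0 < -1 * p.2 i
        linarith
      · refine Or.inl (Or.inr ?_)
        change 0 < 1 * p.2 i
        linarith
  quasiIso_A := quasiIso_offHalfAxis _ _ (by norm_num)
  quasiIso_B := quasiIso_offHalfAxis _ _ (by norm_num)

lemma mapsTo_offAxis (φ : Z ⟶ Z') (n k : ℕ) :
    Set.MapsTo (euclProdMap φ n) (offAxis Z n k) (offAxis Z' n k) := fun _ h => h

lemma mapsTo_offHalfAxis (φ : Z ⟶ Z') {n : ℕ} (k : Fin n) (ε : ℝ) :
    Set.MapsTo (euclProdMap φ n) (offHalfAxis Z k ε) (offHalfAxis Z' k ε) := fun _ h => h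

/-- The relative homology of `Z × ℝⁿ` modulo the points one of whose first `k` coordinates does not
vanish. -/
abbrev axisHomology (Z : TopCat.{u}) (n k m : ℕ) : ModuleCat.{u} ℤ :=
  pairHomology (Set.subset_univ (offAxis Z n k)) m

/-- The functoriality of `axisHomology`. -/
abbrev axisHomologyMap (φ : Z ⟶ Z') (n k m : ℕ) : axisHomology Z n k m ⟶ axisHomology Z' n k m :=
  pairMap (euclProdMap φ n) _ _ (mapsTo_offAxis φ n k) (Set.mapsTo_univ _ _) m

/-- The iterated suspension isomorphism, natural in the space. Each step removes one of the
coordinates from the conditions that define the subspace, and lowers the degree by one. -/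
lemma exists_axisHomology_iso (n k : ℕ) (hk : k ≤ n) :
    ∃ σ : ∀ Z : TopCat.{u}, axisHomology Z n k k ⟶ axisHomology Z n 0 0, (∀ Z, IsIso (σ Z)) ∧
      ∀ (Z Z' : TopCat.{u}) (φ : Z ⟶ Z'),
        axisHomologyMap φ n k k ≫ σ Z' = σ Z ≫ axisHomologyMap φ n 0 0 := by
  induction k with
  | zero => exact ⟨fun Z => 𝟙 _, fun Z => inferInstance, fun Z Z' φ => by simp⟩
  | succ k ih =>
    obtain ⟨σ, hσ, hnat⟩ := ih (by omega)
    let τ (Z : TopCat.{u}) : axisHomology Z n (k + 1) (k + 1) ⟶ axisHomology Z n k k :=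
      (euclSuspension Z ⟨k, hk⟩).suspension k
    have hτ : ∀ Z, IsIso (τ Z) := fun Z => (euclSuspension Z ⟨k, hk⟩).isIso_suspension k
    refine ⟨fun Z => τ Z ≫ σ Z, fun Z => inferInstanceAs (IsIso (τ Z ≫ σ Z)), fun Z Z' φ => ?_⟩
    have h : axisHomologyMap φ n (k + 1) (k + 1) ≫ τ Z' = τ Z ≫ axisHomologyMap φ n k k :=
      SuspensionData.suspension_naturality (S := euclSuspension Z ⟨k, hk⟩)
      (S' := euclSuspension Z' ⟨k, hk⟩) (euclProdMap φ n) (mapsTo_offAxis φ n k)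
      (mapsTo_offHalfAxis φ _ _) (mapsTo_offHalfAxis φ _ _) (mapsTo_offAxis φ n (k + 1)) k
    change axisHomologyMap φ n (k + 1) (k + 1) ≫ τ Z' ≫ σ Z' = (τ Z ≫ σ Z) ≫ _
    rw [Category.assoc, ← hnat, ← Category.assoc, ← Category.assoc, h]

/-- The inclusion of a point. -/
abbrev pointIncl (z : Z) : TopCat.of PUnit.{u + 1} ⟶ Z := TopCat.ofHom (ContinuousMap.const _ z)

/-- The homology of `Z × (ℝⁿ, ℝⁿ ∖ 0)` in degree `n` is the free abelian group on the path
components of `Z`: a basis is formed by the images of one class of `(ℝⁿ, ℝⁿ ∖ 0)`. -/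
theorem exists_local_class (n : ℕ) :
    ∃ e : axisHomology (TopCat.of PUnit.{u + 1}) n n n, ∀ Z : TopCat.{u},
      (∀ x : axisHomology Z n n n,
        x ∈ AddSubgroup.closure
          (Set.range fun z : Z => (axisHomologyMap (pointIncl z) n n n).hom e)) ∧
      ∀ {κ : Type u} (F : Z → κ), (∀ z z', Joined z z' → F z = F z') →
        ∃ π : axisHomology Z n n n →+ (κ →₀ ℤ),
          ∀ z, π ((axisHomologyMap (pointIncl z) n n n).hom e) = Finsupp.single (F z) 1 := by
  obtain ⟨σ, hσ, hnat⟩ := exists_axisHomology_iso n n le_rfl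
  have he : ∀ (Z : TopCat.{u}), IsEmpty (offAxis Z n 0) := fun Z =>
    ⟨fun p => by obtain ⟨i, hi, -⟩ := p.2; exact absurd hi (Nat.not_lt_zero _)⟩
  let c (Z : TopCat.{u}) (p : euclProd Z n) : axisHomology Z n 0 0 :=
    pointClass (setIncl (Set.subset_univ (offAxis Z n 0))) ⟨p, trivial⟩
  -- The iterated suspension turns `e` into the class of the origin.
  let e : axisHomology (TopCat.of PUnit.{u + 1}) n n n := (inv (σ _)).hom (c _ (PUnit.unit, 0))
  have key : ∀ (Z : TopCat.{u}) (z : Z),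
      (σ Z).hom ((axisHomologyMap (pointIncl z) n n n).hom e) = c Z (z, 0) := fun Z z => by
    have h := congrArg (fun F => F.hom e) (hnat _ _ (pointIncl z))
    refine h.trans ?_
    have h' : (σ _).hom e = c _ (PUnit.unit, 0) :=
      congrArg (fun F => F.hom (c _ (PUnit.unit, 0))) (IsIso.inv_hom_id (σ (TopCat.of PUnit)))
    change (axisHomologyMap (pointIncl z) n 0 0).hom ((σ _).hom e) = _
    rw [h']
    exact map_pointClass _ _ _ _ _ _
  have hjoin : ∀ (Z : TopCat.{u}) (z : Z) (x : EuclideanSpace ℝ (Fin n)),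
      Joined ((z, x) : euclProd Z n) (z, 0) := fun Z z x =>
    (PathConnectedSpace.joined x 0).map (f := fun x => ((z, x) : Z × EuclideanSpace ℝ (Fin n)))
      (by fun_prop)
  refine ⟨e, fun Z => ⟨fun x => ?_, fun {κ} F hF => ?_⟩⟩
  · have h : ∀ y : axisHomology Z n 0 0, (inv (σ Z)).hom y ∈ AddSubgroup.closure
        (Set.range fun z : Z => (axisHomologyMap (pointIncl z) n n n).hom e) := fun y => by
      induction mem_closure_pointClass _ y using AddSubgroup.closure_induction with
      | mem y hy =>
        obtain ⟨⟨⟨z, x⟩, -⟩, rfl⟩ := hy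
        refine AddSubgroup.subset_closure ⟨z, ?_⟩
        have hzx : c Z (z, x) = c Z (z, 0) := pointClass_eq_of_joined _
          ((hjoin Z z x).map (f := fun p => (⟨p, trivial⟩ : (Set.univ : Set (euclProd Z n))))
            (by fun_prop))
        change _ = (inv (σ Z)).hom (c Z (z, x))
        rw [hzx, ← key]
        exact (congrArg (fun F => F.hom ((axisHomologyMap (pointIncl z) n n n).hom e))
          (IsIso.hom_inv_id (σ Z))).symm
      | zero => rw [map_zero]; exact zero_mem _
      | add x y _ _ hx hy => rw [map_add]; exact add_mem hx hy
      | neg x _ hx => rw [map_neg]; exact neg_mem hx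
    have hx : (inv (σ Z)).hom ((σ Z).hom x) = x :=
      congrArg (fun F => F.hom x) (IsIso.hom_inv_id (σ Z))
    exact hx ▸ h _
  · obtain ⟨π, hπ⟩ := exists_pointClass_lift (setIncl (Set.subset_univ (offAxis Z n 0)))
      (fun p => F p.1.1) fun y y' h => hF _ _
        (h.map (continuous_fst.comp continuous_subtype_val))
    refine ⟨π.comp (σ Z).hom.toAddMonoidHom, fun z => ?_⟩
    change π ((σ Z).hom _) = _
    rw [key, hπ]

end EuclideanPairs

/-! ### Spaces of equivariant maps -/

section MappingSpaces

variable {D : Type u} [SmallCategory D]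

/-- The set of equivariant maps with the topology induced from the compact-open topologies, without
the passage to a compactly generated topology. -/
def mapObj (T X : D ⥤ TopCat.{u}) : TopCat.{u} := @TopCat.of (T ⟶ X) (mapTop T X)

variable {T T' X Y : D ⥤ TopCat.{u}}

/-- The component of an equivariant map at an object. -/
def mapObjApp (d : D) (f : mapObj T X) : C(T.obj d, X.obj d) :=
  (NatTrans.app (F := T) (G := X) f d).hom

lemma mapObj_ext {f g : mapObj T X} (h : ∀ d t, mapObjApp d f t = mapObjApp d g t) : f = g :=
  NatTrans.ext (F := T) (G := X) (funext fun d => TopCat.hom_ext (ContinuousMap.ext (h d)))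

lemma mapObjApp_map (f : mapObj T X) {d d' : D} (a : d ⟶ d') (t : T.obj d) :
    mapObjApp d' f (T.map a t) = X.map a (mapObjApp d f t) :=
  NatTrans.naturality_apply (F := T) (G := X) f a t

/-- An equivariant map as a point of the mapping space. -/
def mapObjMk (f : ∀ d, C(T.obj d, X.obj d))
    (hf : ∀ (d d' : D) (a : d ⟶ d') t, f d' (T.map a t) = X.map a (f d t)) : mapObj T X :=
  NatTrans.mk (F := T) (G := X) (fun d => TopCat.ofHom (f d))
    (fun d d' a => by ext t; exact hf d d' a t)

lemma isInducing_mapObj : IsInducing fun (f : mapObj T X) (d : D) => mapObjApp d f :=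
  @IsInducing.mk _ _ (mapTop T X) _ _ rfl

lemma continuous_mapObjApp (d : D) : Continuous (mapObjApp d : mapObj T X → _) :=
  (continuous_apply d).comp isInducing_mapObj.continuous

lemma continuous_mapObj {Z : Type*} [TopologicalSpace Z] {f : Z → mapObj T X}
    (hf : ∀ d, Continuous fun z => mapObjApp d (f z)) : Continuous f :=
  isInducing_mapObj.continuous_iff.2 (continuous_pi hf)

lemma continuous_mapObj_eval (d : D) (t : T.obj d) :
    Continuous fun f : mapObj T X => mapObjApp d f t :=
  (continuous_eval_const t).comp (continuous_mapObjApp d)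

/-- Composition with an equivariant map of the targets. -/
def mapObjPost (T : D ⥤ TopCat.{u}) (b : X ⟶ Y) : mapObj T X ⟶ mapObj T Y :=
  TopCat.ofHom (X := mapObj T X) (Y := mapObj T Y) ⟨fun f =>
    NatTrans.vcomp (F := T) (G := X) (H := Y) f b,
    continuous_mapObj fun d =>
      (ContinuousMap.continuous_postcomp (b.app d).hom).comp (continuous_mapObjApp d)⟩

/-- Composition with an equivariant map of the sources. -/
def mapObjPre (a : T' ⟶ T) (X : D ⥤ TopCat.{u}) : mapObj T X ⟶ mapObj T' X :=
  TopCat.ofHom (X := mapObj T X) (Y := mapObj T' X) ⟨fun f =>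
    NatTrans.vcomp (F := T') (G := T) (H := X) a f,
    continuous_mapObj fun d =>
      (ContinuousMap.continuous_precomp (a.app d).hom).comp (continuous_mapObjApp d)⟩

lemma mapObjPre_post (a : T' ⟶ T) (b : X ⟶ Y) :
    mapObjPost T b ≫ mapObjPre a Y = mapObjPre a X ≫ mapObjPost T' b := rfl

lemma mapObjPost_comp {W : D ⥤ TopCat.{u}} (b : W ⟶ X) (c : X ⟶ Y) :
    mapObjPost T (b ≫ c) = mapObjPost T b ≫ mapObjPost T c := rfl

/-- Composition with a subspace inclusion is an embedding for the compact-open topologies. -/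
lemma isEmbedding_mapObjPost (b : X ⟶ Y) (hb : ∀ d, IsEmbedding (b.app d)) :
    IsEmbedding (mapObjPost T b) := by
  have h : IsEmbedding fun (f : mapObj T X) (d : D) => (b.app d).hom.comp (mapObjApp d f) := by
    refine ⟨?_, fun f g h => mapObj_ext fun d t => (hb d).injective ?_⟩
    · exact (IsInducing.piMap fun d => (ContinuousMap.isInducing_postcomp _ (hb d).isInducing)).comp
        isInducing_mapObj
    · exact congrArg (fun F => F t) (congrFun h d)
  exact IsEmbedding.of_comp (mapObjPost T b).hom.continuous
    (isInducing_mapObj (T := T) (X := Y)).continuous h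

lemma homotopic_mapObjPost {b c : X ⟶ Y} (h : DHomotopic b c) :
    (mapObjPost T b).hom.Homotopic (mapObjPost T c).hom := by
  obtain ⟨H, h₀, h₁, hH⟩ := h
  refine ⟨⟨⟨fun q => mapObjMk (fun d => (H d).comp
    ((mapObjApp d q.2).prodMk (ContinuousMap.const _ q.1))) fun d d' a t => ?_, ?_⟩,
    fun f => ?_, fun f => ?_⟩⟩
  · change H d' (mapObjApp d' q.2 (T.map a t), q.1) = Y.map a (H d (mapObjApp d q.2 t, q.1))
    rw [mapObjApp_map, hH]
  · refine continuous_mapObj fun d => ?_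
    have hc : Continuous fun q : unitInterval × mapObj T X =>
        (ContinuousMap.const (T.obj d) q.1).prodMk (mapObjApp d q.2) :=
      ContinuousMap.continuous_prodMk_const.comp
        (continuous_id.prodMap (continuous_mapObjApp d))
    exact (ContinuousMap.continuous_postcomp ((H d).comp ContinuousMap.prodSwap)).comp hc
  · exact mapObj_ext fun d t => h₀ d _
  · exact mapObj_ext fun d t => h₁ d _

/-- Equivariant homotopy equivalences induce homology isomorphisms of mapping spaces. -/
lemma quasiIso_mapObjPost (b : X ⟶ Y) (r : Y ⟶ X) (hbr : b ≫ r = 𝟙 X)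
    (hrb : DHomotopic (r ≫ b) (𝟙 Y)) : QuasiIso (singularChains.map (mapObjPost T b)) := by
  refine quasiIso_of_homotopy _ (mapObjPost T r) ?_ ?_
  · rw [← mapObjPost_comp, hbr]
    exact ContinuousMap.Homotopic.refl _
  · rw [← mapObjPost_comp]
    exact homotopic_mapObjPost hrb

/-- The identity map from the compactly generated mapping space. -/
def fromMapSpace (T X : D ⥤ TopCat.{u}) : mapSpace T X ⟶ mapObj T X :=
  @TopCat.ofHom (T ⟶ X) (T ⟶ X) (@TopologicalSpace.compactlyGenerated.{u} _ (mapTop T X))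
    (mapTop T X) (@ContinuousMap.mk _ _ (@TopologicalSpace.compactlyGenerated.{u} _ (mapTop T X))
      (mapTop T X) id (@continuous_from_compactlyGenerated.{u} _ _ (mapTop T X) (mapTop T X) id
        fun _ g => @ContinuousMap.continuous _ _ _ (mapTop T X) g))

/-- Singular simplices do not see the passage to a compactly generated topology. -/
instance isIso_singularChains_fromMapSpace (T X : D ⥤ TopCat.{u}) :
    IsIso (singularChains.map (fromMapSpace T X)) := by
  have hf : ∀ k, IsIso ((singularChains.map (fromMapSpace T X)).f k) := fun k => by
    have hmono : Mono (fromMapSpace T X) := (TopCat.mono_iff_injective _).2 fun _ _ h => h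
    have h₁ : Mono ((singularChains.map (fromMapSpace T X)).f k) := inferInstance
    have h₂ : Epi ((singularChains.map (fromMapSpace T X)).f k) := by
      refine (ModuleCat.epi_iff_surjective _).2 fun x => ?_
      induction mem_closure_gen x using AddSubgroup.closure_induction with
      | mem x hx =>
        obtain ⟨σ, rfl⟩ := hx
        have hσ : Continuous[_, @TopologicalSpace.compactlyGenerated.{u} _ (mapTop T X)]
            (σ : Simplex k → (T ⟶ X)) := by
          have h := @continuous_toCG (T ⟶ X) (mapTop T X) (ULift.{u} (Simplex k)) _ _ _
            (@ContinuousMap.mk _ _ _ (mapTop T X) (fun s => σ s.down)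
              (σ.continuous.comp continuous_uliftDown))
          exact @Continuous.comp _ _ _ _ _
            (@TopologicalSpace.compactlyGenerated.{u} _ (mapTop T X)) ULift.up _ h
            continuous_uliftUp
        exact ⟨gen (X := mapSpace T X) (@ContinuousMap.mk _ _ _
          (@TopologicalSpace.compactlyGenerated.{u} _ (mapTop T X)) σ hσ), map_gen _ _⟩
      | zero => exact ⟨0, map_zero _⟩
      | add x y _ _ hx hy =>
        obtain ⟨x, rfl⟩ := hx
        obtain ⟨y, rfl⟩ := hy
        exact ⟨x + y, map_add _ _ _⟩
      | neg x _ hx =>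
        obtain ⟨x, rfl⟩ := hx
        exact ⟨-x, map_neg _ _⟩
    exact isIso_of_mono_of_epi _
  exact HomologicalComplex.Hom.isIso_of_components _

/-- A path in the mapping space is an equivariant homotopy. -/
lemma dHomotopic_of_joined (hT : ∀ d, CompactlyGeneratedSpace (T.obj d)) {f g : mapObj T X}
    (h : Joined f g) : DHomotopic (X := T) (Y := X) f g := by
  obtain ⟨γ⟩ := h
  -- Continuity in the point of `T` can be tested on compact spaces, where evaluation is continuous;
  -- afterwards the interval is exponentiable.
  have hcont : ∀ d, Continuous fun p : T.obj d × unitInterval => mapObjApp d (γ p.2) p.1 := by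
    intro d
    let γd : C(unitInterval, C(T.obj d, X.obj d)) :=
      ⟨fun s => mapObjApp d (γ s), (continuous_mapObjApp d).comp γ.continuous⟩
    let F : T.obj d → C(unitInterval, X.obj d) := fun t =>
      ⟨fun s => γd s t, (continuous_eval_const t).comp γd.continuous⟩
    have hF : Continuous F := by
      have := hT d
      refine continuous_from_compactlyGeneratedSpace F fun K _ _ _ κ hκ => ?_
      refine ContinuousMap.continuous_of_continuous_uncurry _ ?_
      have h : Continuous fun s => (γd s).comp ⟨κ, hκ⟩ :=
        (ContinuousMap.continuous_precomp _).comp γd.continuous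
      exact (ContinuousMap.continuous_uncurry_of_continuous ⟨_, h⟩).comp continuous_swap
    exact ContinuousMap.continuous_uncurry_of_continuous ⟨F, hF⟩
  refine ⟨fun d => ⟨_, hcont d⟩, fun d x => ?_, fun d x => ?_, fun d d' a x t => ?_⟩
  · change mapObjApp d (γ 0) x = _
    rw [γ.source]; rfl
  · change mapObjApp d (γ 1) x = _
    rw [γ.target]; rfl
  · exact mapObjApp_map (γ t) a x

end MappingSpaces

/-! ### The standard cell -/

section EuclideanCells

/-- The centre of the standard cell. -/
def cellCentre (n : ℕ) : Cell n := ⟨0, by simp⟩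

/-- The embedding of Euclidean space as the interior of the standard cell. -/
def toCell {n : ℕ} (x : EuclideanSpace ℝ (Fin n)) : Cell n :=
  Set.inclusion Metric.ball_subset_closedBall (Homeomorph.unitBall x)

variable {n : ℕ}

lemma isOpenEmbedding_toCell : IsOpenEmbedding (toCell (n := n)) := by
  refine IsOpenEmbedding.comp ⟨IsEmbedding.inclusion _, ?_⟩ Homeomorph.unitBall.isOpenEmbedding
  rw [Set.range_inclusion]
  exact Metric.isOpen_ball.preimage continuous_subtype_val

lemma norm_toCell_lt (x : EuclideanSpace ℝ (Fin n)) :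
    ‖(toCell x : EuclideanSpace ℝ (Fin n))‖ < 1 :=
  mem_ball_zero_iff.1 (Homeomorph.unitBall x).2

lemma exists_toCell_eq (x : Cell n) (hx : ‖(x : EuclideanSpace ℝ (Fin n))‖ < 1) :
    ∃ y, toCell y = x :=
  ⟨Homeomorph.unitBall.symm ⟨x, mem_ball_zero_iff.2 hx⟩,
    congrArg (Set.inclusion Metric.ball_subset_closedBall)
      (Homeomorph.unitBall.apply_symm_apply ⟨_, mem_ball_zero_iff.2 hx⟩)⟩

lemma toCell_eq_centre {x : EuclideanSpace ℝ (Fin n)} : toCell x = cellCentre n ↔ x = 0 := by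
  have h : toCell (0 : EuclideanSpace ℝ (Fin n)) = cellCentre n :=
    Subtype.ext Homeomorph.coe_unitBall_apply_zero
  rw [← h, isOpenEmbedding_toCell.injective.eq_iff]

/-- The radial deformation of the punctured cell, from the projection to the sphere to the
identity: `x` is multiplied by `s + (1 - s) / ‖x‖`, so that its norm becomes `s * ‖x‖ + (1 - s)`. -/
def radial (s : unitInterval) (x : {x : Cell n // x ≠ cellCentre n}) :
    {x : Cell n // x ≠ cellCentre n} :=
  have hx : 0 < ‖(x.1 : EuclideanSpace ℝ (Fin n))‖ :=
    norm_pos_iff.2 fun h => x.2 (Subtype.ext h)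
  have hn : ‖((s : ℝ) + (1 - s) * ‖(x.1 : EuclideanSpace ℝ (Fin n))‖⁻¹) •
      (x.1 : EuclideanSpace ℝ (Fin n))‖ = s * ‖(x.1 : EuclideanSpace ℝ (Fin n))‖ + (1 - s) := by
    have h1 : 0 ≤ (s : ℝ) + (1 - s) * ‖(x.1 : EuclideanSpace ℝ (Fin n))‖⁻¹ :=
      add_nonneg s.2.1 (mul_nonneg (sub_nonneg.2 s.2.2) (by positivity))
    rw [norm_smul, Real.norm_eq_abs, abs_of_nonneg h1, add_mul, mul_assoc,
      inv_mul_cancel₀ hx.ne', mul_one]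
  ⟨⟨((s : ℝ) + (1 - s) * ‖(x.1 : EuclideanSpace ℝ (Fin n))‖⁻¹) •
      (x.1 : EuclideanSpace ℝ (Fin n)), by
    rw [mem_closedBall_zero_iff, hn]
    nlinarith [s.2.1, mem_closedBall_zero_iff.1 x.1.2]⟩, fun h => by
    have h0 : ‖((s : ℝ) + (1 - s) * ‖(x.1 : EuclideanSpace ℝ (Fin n))‖⁻¹) •
      (x.1 : EuclideanSpace ℝ (Fin n))‖ = 0 := norm_eq_zero.2 (congrArg Subtype.val h)
    rw [hn] at h0
    nlinarith [s.2.1, s.2.2, mul_nonneg s.2.1 hx.le, mul_pos hx hx,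
      mem_closedBall_zero_iff.1 x.1.2]⟩

lemma coe_radial (s : unitInterval) (x : {x : Cell n // x ≠ cellCentre n}) :
    ((radial s x).1 : EuclideanSpace ℝ (Fin n)) =
      ((s : ℝ) + (1 - s) * ‖(x.1 : EuclideanSpace ℝ (Fin n))‖⁻¹) •
        (x.1 : EuclideanSpace ℝ (Fin n)) :=
  rfl

lemma continuous_radial : Continuous fun p : unitInterval × {x : Cell n // x ≠ cellCentre n} =>
    radial p.1 p.2 := by
  refine Continuous.subtype_mk (Continuous.subtype_mk ?_ _) _
  have h : Continuous fun p : unitInterval × {x : Cell n // x ≠ cellCentre n} =>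
      (p.2.1 : EuclideanSpace ℝ (Fin n)) := by fun_prop
  have h' : Continuous fun p : unitInterval × {x : Cell n // x ≠ cellCentre n} =>
      ‖(p.2.1 : EuclideanSpace ℝ (Fin n))‖⁻¹ :=
    h.norm.inv₀ fun p hp => p.2.2 (Subtype.ext (norm_eq_zero.1 hp))
  have hs : Continuous fun p : unitInterval × {x : Cell n // x ≠ cellCentre n} => (p.1 : ℝ) := by
    fun_prop
  exact (hs.add ((continuous_const.sub hs).mul h')).smul h

lemma radial_one (x : {x : Cell n // x ≠ cellCentre n}) : radial 1 x = x :=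
  Subtype.ext (Subtype.ext (by rw [coe_radial]; simp))

lemma norm_radial_zero (x : {x : Cell n // x ≠ cellCentre n}) :
    ‖((radial 0 x).1 : EuclideanSpace ℝ (Fin n))‖ = 1 := by
  have hx : ‖(x.1 : EuclideanSpace ℝ (Fin n))‖ ≠ 0 :=
    norm_ne_zero_iff.2 fun h => x.2 (Subtype.ext h)
  rw [coe_radial, norm_smul]
  simp [hx]

lemma radial_of_norm_eq_one (s : unitInterval) (x : {x : Cell n // x ≠ cellCentre n})
    (hx : ‖(x.1 : EuclideanSpace ℝ (Fin n))‖ = 1) : radial s x = x :=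
  Subtype.ext (Subtype.ext (by rw [coe_radial, hx]; simp))

end EuclideanCells

/-! ### The stages of the filtration and their open cells -/

namespace DCWStructure

variable {D : Type u} [SmallCategory D] [TopEnriched D] {X : DSpace D} {ι : Type u}
  {O : ι → DSpace D} (S : DCWStructure X O) (n : ℕ) (d : D)

/-- The underlying diagram of the orbit of a cell. -/
abbrev orbitDiagram {n : ℕ} (c : S.cell n) : D ⥤ TopCat.{u} := (O (S.orbit c)).toFunctor

/-- The disjoint union of the previous stage of the filtration and the cells. -/
abbrev Pieces : Type u := S.skel n d ⊕ Σ c : S.cell n, (S.orbitDiagram c).obj d × Cell n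

variable {n}

/-- The characteristic map of a cell, as a map to the stage of the filtration. -/
def cellMap (c : S.cell n) : C((S.orbitDiagram c).obj d × Cell n, S.skel (n + 1) d) :=
  ⟨fun p => ⟨S.charMap c d p, S.charMap_mem c d p⟩, (S.charMap c d).continuous.subtype_mk _⟩

variable (n) in
/-- The quotient map by which the cells are attached. -/
def attach : C(S.Pieces n d, S.skel (n + 1) d) := ⟨_, (S.isQuotientMap n d).continuous⟩

lemma isQuotientMap_attach : IsQuotientMap (S.attach n d) := S.isQuotientMap n d

variable {d}

lemma norm_cell_le (x : Cell n) : ‖(x : EuclideanSpace ℝ (Fin n))‖ ≤ 1 :=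
  mem_closedBall_zero_iff.1 x.2

/-- A point of a cell which is attached to the previous stage lies on the boundary of the cell. -/
lemma norm_eq_one_of_cellMap_eq {c : S.cell n} {p} {b : S.skel n d}
    (h : S.cellMap d c p = Set.inclusion (S.skel_subset n d) b) :
    ‖(p.2 : EuclideanSpace ℝ (Fin n))‖ = 1 :=
  (S.charMap_mem_iff c d p).1 (by
    rw [show S.charMap c d p = b.1 from congrArg Subtype.val h]; exact b.2)

/-- Interior points of cells are not identified with any other points. -/
lemma eq_of_cellMap_eq {q q' : Σ c : S.cell n, (S.orbitDiagram c).obj d × Cell n}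
    (h : S.cellMap d q.1 q.2 = S.cellMap d q'.1 q'.2)
    (hq : ‖(q.2.2 : EuclideanSpace ℝ (Fin n))‖ ≠ 1) : q = q' :=
  (S.existsUnique_cell n d _ (S.charMap_mem q.1 d q.2)
    fun hm => hq ((S.charMap_mem_iff _ _ _).1 hm)).unique rfl (congrArg Subtype.val h).symm

lemma norm_eq_one_iff_of_cellMap_eq {q q' : Σ c : S.cell n, (S.orbitDiagram c).obj d × Cell n}
    (h : S.cellMap d q.1 q.2 = S.cellMap d q'.1 q'.2) :
    ‖(q.2.2 : EuclideanSpace ℝ (Fin n))‖ = 1 ↔ ‖(q'.2.2 : EuclideanSpace ℝ (Fin n))‖ = 1 := by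
  rw [← S.charMap_mem_iff q.1 d q.2, ← S.charMap_mem_iff q'.1 d q'.2,
    show S.charMap q.1 d q.2 = S.charMap q'.1 d q'.2 from congrArg Subtype.val h]

lemma skel_cases (y : S.skel (n + 1) d) : y.1 ∈ S.skel n d ∨
    ∃ (c : S.cell n) (p : (S.orbitDiagram c).obj d × Cell n),
      ‖(p.2 : EuclideanSpace ℝ (Fin n))‖ < 1 ∧ S.cellMap d c p = y := by
  by_cases h : y.1 ∈ S.skel n d
  · exact Or.inl h
  · obtain ⟨⟨c, p⟩, hq, -⟩ := S.existsUnique_cell n d y.1 y.2 h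
    refine Or.inr ⟨c, p, lt_of_le_of_ne (norm_cell_le _) fun h1 => h ?_, Subtype.ext hq⟩
    rw [← show S.charMap c d p = y.1 from hq]
    exact (S.charMap_mem_iff c d p).2 h1

open Classical in
/-- A continuous function that vanishes outside one open cell and whose value at a point of this
cell determines the coordinate `x` in the disc: the value is `((1 - ‖x‖) x, 1 - ‖x‖)`, which is zero
on the boundary. -/
lemma exists_cellCoordinate (c : S.cell n) (d : D) :
    ∃ q : C(S.skel (n + 1) d, EuclideanSpace ℝ (Fin n) × ℝ),
      (∀ y : S.skel (n + 1) d, y.1 ∈ S.skel n d → q y = 0) ∧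
      ∀ (c' : S.cell n) (p : (S.orbitDiagram c').obj d × Cell n), q (S.cellMap d c' p) =
        if c' = c then ((1 - ‖(p.2 : EuclideanSpace ℝ (Fin n))‖) • (p.2 : EuclideanSpace ℝ (Fin n)),
          1 - ‖(p.2 : EuclideanSpace ℝ (Fin n))‖) else 0 := by
  let v (x : Cell n) : EuclideanSpace ℝ (Fin n) × ℝ :=
    ((1 - ‖(x : EuclideanSpace ℝ (Fin n))‖) • (x : EuclideanSpace ℝ (Fin n)),
      1 - ‖(x : EuclideanSpace ℝ (Fin n))‖)
  have hv : Continuous v := by fun_prop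
  have hv1 : ∀ x : Cell n, ‖(x : EuclideanSpace ℝ (Fin n))‖ = 1 → v x = 0 := fun x hx => by
    simp [v, hx]
  let G : C(S.Pieces n d, EuclideanSpace ℝ (Fin n) × ℝ) :=
    ⟨Sum.elim (fun _ => 0) fun q => if q.1 = c then v q.2.2 else 0, by
      refine continuous_const.sumElim (continuous_sigma fun c' => ?_)
      by_cases h : c' = c
      · simp only [h, if_true]
        exact hv.comp continuous_snd
      · simp only [h, if_false]
        exact continuous_const⟩
  have hG1 : ∀ q : Σ c : S.cell n, (S.orbitDiagram c).obj d × Cell n,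
      ‖(q.2.2 : EuclideanSpace ℝ (Fin n))‖ = 1 → G (Sum.inr q) = 0 := fun q hq => by
    change (if q.1 = c then v q.2.2 else 0) = 0
    rw [hv1 _ hq, ite_self]
  have hG : Function.FactorsThrough G (S.attach n d) := by
    rintro (b | q) (b' | q') h
    · rfl
    · exact (hG1 _ (S.norm_eq_one_of_cellMap_eq h.symm)).symm
    · exact hG1 _ (S.norm_eq_one_of_cellMap_eq h)
    · by_cases h1 : ‖(q.2.2 : EuclideanSpace ℝ (Fin n))‖ = 1
      · rw [hG1 _ h1, hG1 _ ((S.norm_eq_one_iff_of_cellMap_eq h).1 h1)]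
      · rw [S.eq_of_cellMap_eq h h1]
  let q := (S.isQuotientMap_attach d).lift G hG
  have hq : ∀ a, q (S.attach n d a) = G a := fun a =>
    congrArg (fun F => F a) ((S.isQuotientMap_attach d).lift_comp G hG)
  exact ⟨q, fun y hy => hq (Sum.inl ⟨y.1, hy⟩), fun c' p => hq (Sum.inr ⟨c', p⟩)⟩

lemma isOpen_iff_attach {s : Set (S.skel (n + 1) d)} : IsOpen s ↔
    IsOpen (Set.inclusion (S.skel_subset n d) ⁻¹' s) ∧ ∀ c, IsOpen (S.cellMap d c ⁻¹' s) := by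
  rw [← (S.isQuotientMap_attach d).isOpen_preimage, isOpen_sum_iff, isOpen_sigma_iff]
  rfl

/-- The product of a diagram of spaces with Euclidean space. -/
def _root_.EquivariantEuler.euclDiagram (T : D ⥤ TopCat.{u}) (n : ℕ) : D ⥤ TopCat.{u} where
  obj d := euclProd (T.obj d) n
  map a := euclProdMap (T.map a) n
  map_id d := by ext p; simp; rfl
  map_comp a b := by ext p; simp; rfl

/-- The open cell, parametrized by Euclidean space. -/
def openCell (c : S.cell n) : euclDiagram (S.orbitDiagram c) n ⟶ S.skelDiagram (n + 1) where
  app d := TopCat.ofHom ((S.cellMap d c).comp ⟨fun p => (p.1, toCell p.2), by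
    exact continuous_fst.prodMk (isOpenEmbedding_toCell.continuous.comp continuous_snd)⟩)
  naturality d d' a := by
    ext p
    exact Subtype.ext (S.charMap_naturality c d d' a p.1 (toCell p.2))

lemma openCell_app (c : S.cell n) (p : euclProd ((S.orbitDiagram c).obj d) n) :
    (S.openCell c).app d p = S.cellMap d c (p.1, toCell p.2) := rfl

lemma eq_of_cellMap_eq_openCell {c c' : S.cell n} {p : euclProd ((S.orbitDiagram c).obj d) n} {q}
    (h : S.cellMap d c' q = (S.openCell c).app d p) :
    (⟨c, (p.1, toCell p.2)⟩ : Σ c : S.cell n, (S.orbitDiagram c).obj d × Cell n) = ⟨c', q⟩ :=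
  S.eq_of_cellMap_eq (q := ⟨c, (p.1, toCell p.2)⟩) (q' := ⟨c', q⟩) h.symm (norm_toCell_lt _).ne

lemma isOpenEmbedding_openCell (c : S.cell n) (d : D) : IsOpenEmbedding ((S.openCell c).app d) := by
  refine IsOpenEmbedding.of_continuous_injective_isOpenMap ((S.openCell c).app d).hom.continuous
    (fun p p' h => ?_) fun W hW => ?_
  · have h' := S.eq_of_cellMap_eq_openCell (c' := c) (q := (p'.1, toCell p'.2)) h.symm
    simp only [Sigma.mk.injEq, heq_eq_eq, true_and, Prod.mk.injEq] at h'
    exact Prod.ext h'.1 (isOpenEmbedding_toCell.injective h'.2)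
  · refine S.isOpen_iff_attach.2 ⟨?_, fun c' => ?_⟩
    · convert isOpen_empty
      refine Set.eq_empty_of_forall_notMem fun b hb => ?_
      obtain ⟨p, -, hp⟩ := hb
      exact (norm_toCell_lt p.2).ne (S.norm_eq_one_of_cellMap_eq (p := (p.1, toCell p.2)) hp)
    · by_cases hc : c' = c
      · subst hc
        have hopen := (IsOpenMap.id (X := (S.orbitDiagram c').obj d)).prodMap
          (isOpenEmbedding_toCell (n := n)).isOpenMap W hW
        convert hopen using 1
        ext q
        constructor
        · rintro ⟨p, hp, hpq⟩
          have h := S.eq_of_cellMap_eq_openCell hpq.symm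
          simp only [Sigma.mk.injEq, heq_eq_eq, true_and] at h
          exact ⟨p, hp, h⟩
        · rintro ⟨p, hp, rfl⟩
          exact ⟨p, hp, rfl⟩
      · convert isOpen_empty
        refine Set.eq_empty_of_forall_notMem fun q hq => ?_
        obtain ⟨p, -, hp⟩ := hq
        exact hc (congrArg Sigma.fst (S.eq_of_cellMap_eq_openCell hp.symm)).symm

end DCWStructure

/-! ### The stages of the filtration without the centres of the cells -/

namespace DCWStructure

variable {D : Type u} [SmallCategory D] [TopEnriched D] {X : DSpace D} {ι : Type u}
  {O : ι → DSpace D} (S : DCWStructure X O) (n : ℕ) (d : D)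

/-- The stage of the filtration without the centres of its top-dimensional cells. -/
def punctured : Set (X.toFunctor.obj d) :=
  {y | y ∈ S.skel (n + 1) d ∧ ∀ (c : S.cell n) t, S.charMap c d (t, cellCentre n) ≠ y}

lemma skel_subset_punctured : S.skel n d ⊆ S.punctured n d := fun y hy =>
  ⟨S.skel_subset n d hy, fun c t h => by
    have h1 := (S.charMap_mem_iff c d (t, cellCentre n)).1 (h ▸ hy)
    simp [cellCentre] at h1⟩

lemma punctured_subset : S.punctured n d ⊆ S.skel (n + 1) d := fun _ hy => hy.1

variable {n d}

lemma charMap_mem_punctured_iff {c : S.cell n} {p : (S.orbitDiagram c).obj d × Cell n} :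
    S.charMap c d p ∈ S.punctured n d ↔ p.2 ≠ cellCentre n := by
  constructor
  · rintro h h0
    exact h.2 c p.1 (by rw [← h0])
  · refine fun h => ⟨S.charMap_mem c d p, fun c' t h' => h ?_⟩
    have h2 := S.eq_of_cellMap_eq (q := ⟨c', (t, cellCentre n)⟩) (q' := ⟨c, p⟩)
      (Subtype.ext h') (by simp [cellCentre])
    rw [← (show (⟨c', (t, cellCentre n)⟩ : Σ c : S.cell n, (S.orbitDiagram c).obj d × Cell n).2.2 =
      cellCentre n from rfl), h2]

variable (n) in
lemma map_mem_punctured (d d' : D) (a : d ⟶ d') (y : X.toFunctor.obj d)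
    (hy : y ∈ S.punctured n d) : X.toFunctor.map a y ∈ S.punctured n d' := by
  rcases S.skel_cases ⟨y, hy.1⟩ with h | ⟨c, p, -, hp⟩
  · exact S.skel_subset_punctured n d' (S.map_mem_skel n d d' a y h)
  · obtain rfl : S.charMap c d p = y := congrArg Subtype.val hp
    have hc := S.charMap_mem_punctured_iff.1 hy
    rw [← S.charMap_naturality c d d' a p.1 p.2]
    exact S.charMap_mem_punctured_iff.2 hc

variable (n d) in
/-- The pieces of the punctured stage of the filtration. -/
abbrev PuncturedPieces : Type u :=
  S.skel n d ⊕ Σ c : S.cell n, (S.orbitDiagram c).obj d × {x : Cell n // x ≠ cellCentre n}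

variable (n d) in
/-- The quotient map from the pieces of the punctured stage of the filtration. -/
def puncturedAttach : C(S.PuncturedPieces n d, S.punctured n d) :=
  ⟨Sum.elim (Set.inclusion (S.skel_subset_punctured n d)) fun q =>
    ⟨S.charMap q.1 d (q.2.1, q.2.2.1), S.charMap_mem_punctured_iff.2 q.2.2.2⟩, by
    refine (continuous_inclusion _).sumElim (continuous_sigma fun c => Continuous.subtype_mk ?_ _)
    exact (S.charMap c d).continuous.comp (continuous_id.prodMap continuous_subtype_val)⟩

lemma isOpenEmbedding_punctured :
    IsOpenEmbedding (Set.inclusion (S.punctured_subset n d)) := by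
  refine ⟨IsEmbedding.inclusion _, ?_⟩
  rw [Set.range_inclusion, S.isOpen_iff_attach]
  constructor
  · convert isOpen_univ
    exact Set.eq_univ_of_forall fun b => S.skel_subset_punctured n d b.2
  · intro c
    convert (isOpen_compl_singleton (x := cellCentre n)).preimage
      (continuous_snd : Continuous (Prod.snd : (S.orbitDiagram c).obj d × Cell n → _)) using 1
    ext p
    exact S.charMap_mem_punctured_iff

lemma punctured_cases (y : S.punctured n d) :
    (∃ b : S.skel n d, S.puncturedAttach n d (Sum.inl b) = y) ∨
      ∃ q, S.puncturedAttach n d (Sum.inr q) = y := by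
  rcases S.skel_cases ⟨y.1, y.2.1⟩ with h | ⟨c, p, -, hp⟩
  · exact Or.inl ⟨⟨y.1, h⟩, rfl⟩
  · have h : S.charMap c d p = y.1 := congrArg Subtype.val hp
    exact Or.inr ⟨⟨c, p.1, p.2, S.charMap_mem_punctured_iff.1 (h ▸ y.2)⟩, Subtype.ext h⟩

variable (d) in
/-- The restriction of a quotient map to an open saturated subset is a quotient map. -/
lemma isQuotientMap_puncturedAttach : IsQuotientMap (S.puncturedAttach n d) := by
  let m : S.PuncturedPieces n d → S.Pieces n d :=
    Sum.map id (Sigma.map id fun c => Prod.map id Subtype.val)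
  have hopen : IsOpenMap m := by
    refine IsOpenMap.id.sumMap (isOpenMap_sigma_map.2 fun c => IsOpenMap.id.prodMap ?_)
    exact (isOpen_compl_singleton (x := cellCentre n)).isOpenMap_subtype_val
  have hm : ∀ w, S.attach n d (m w) = Set.inclusion (S.punctured_subset n d)
      (S.puncturedAttach n d w) := by
    rintro (b | q) <;> rfl
  have hmem : ∀ w', (S.attach n d w').1 ∈ S.punctured n d → ∃ w, m w = w' := by
    rintro (b | ⟨c, p⟩) h
    · exact ⟨Sum.inl b, rfl⟩
    · exact ⟨Sum.inr ⟨c, p.1, p.2, S.charMap_mem_punctured_iff.1 h⟩, rfl⟩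
  have hminj : Function.Injective m :=
    Function.injective_id.sumMap (Function.injective_id.sigma_map fun c =>
      Function.injective_id.prodMap Subtype.val_injective)
  refine (isQuotientMap_iff _).2 ⟨isCoinducing_iff.2 fun s => ⟨fun h => ?_, fun h => h.preimage
    (S.puncturedAttach n d).continuous⟩, fun y => ?_⟩
  · rw [S.isOpenEmbedding_punctured.isOpen_iff_image_isOpen,
      ← (S.isQuotientMap_attach d).isOpen_preimage]
    convert hopen _ h using 1
    ext w'
    constructor
    · rintro ⟨y, hy, hyw⟩
      obtain ⟨w, rfl⟩ := hmem w' (by rw [← hyw]; exact y.2)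
      refine ⟨w, ?_, rfl⟩
      rw [hm] at hyw
      change S.puncturedAttach n d w ∈ s
      rwa [← Set.inclusion_injective _ hyw]
    · rintro ⟨w, hw, rfl⟩
      exact ⟨_, hw, (hm w).symm⟩
  · rcases S.punctured_cases y with ⟨b, hb⟩ | ⟨q, hq⟩
    · exact ⟨_, hb⟩
    · exact ⟨_, hq⟩

/-- Pushing the cells radially away from their centres, towards the previous stage, which stays
fixed. The push is defined on the pieces and descends to their quotient; since this is done for maps
to a path space, no product of a quotient map with the interval is needed. -/
lemma exists_push (d : D) : ∃ H : C(S.punctured n d × unitInterval, S.punctured n d),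
    (∀ (b : S.skel n d) s, H (S.puncturedAttach n d (Sum.inl b), s) =
      S.puncturedAttach n d (Sum.inl b)) ∧
    ∀ (c : S.cell n) t x s, H (S.puncturedAttach n d (Sum.inr ⟨c, t, x⟩), s) =
      S.puncturedAttach n d (Sum.inr ⟨c, t, radial s x⟩) := by
  let G : C(S.PuncturedPieces n d, C(unitInterval, S.punctured n d)) :=
    ⟨Sum.elim (fun b => ContinuousMap.const _ (S.puncturedAttach n d (Sum.inl b)))
      fun q => (S.puncturedAttach n d).comp ⟨fun s => Sum.inr ⟨q.1, q.2.1, radial s q.2.2⟩, by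
        exact continuous_inr.comp (continuous_sigmaMk.comp (continuous_const.prodMk
          (continuous_radial.comp (continuous_id.prodMk continuous_const))))⟩, by
      refine Continuous.sumElim (ContinuousMap.continuous_const'.comp
        ((S.puncturedAttach n d).continuous.comp continuous_inl)) (continuous_sigma fun c =>
          ContinuousMap.continuous_of_continuous_uncurry _ ?_)
      refine (S.puncturedAttach n d).continuous.comp (continuous_inr.comp (continuous_sigmaMk.comp
        ((continuous_fst.comp continuous_fst).prodMk (continuous_radial.comp
          (continuous_snd.prodMk (continuous_snd.comp continuous_fst))))))⟩
  have hG1 : ∀ q, ‖(q.2.2.1 : EuclideanSpace ℝ (Fin n))‖ = 1 →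
      G (Sum.inr q) = ContinuousMap.const _ (S.puncturedAttach n d (Sum.inr q)) := fun q hq => by
    refine ContinuousMap.ext fun s => ?_
    change S.puncturedAttach n d (Sum.inr ⟨q.1, q.2.1, radial s q.2.2⟩) = _
    rw [radial_of_norm_eq_one _ _ hq]
    rfl
  have hG : Function.FactorsThrough G (S.puncturedAttach n d) := by
    rintro (b | q) (b' | q') h
    · exact congrArg (ContinuousMap.const _) h
    · rw [hG1 _ (S.norm_eq_one_of_cellMap_eq (c := q'.1) (p := (q'.2.1, q'.2.2.1)) (b := b)
        (Subtype.ext (congrArg Subtype.val h.symm :))), ← h]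
      rfl
    · rw [hG1 _ (S.norm_eq_one_of_cellMap_eq (c := q.1) (p := (q.2.1, q.2.2.1)) (b := b')
        (Subtype.ext (congrArg Subtype.val h :))), h]
      rfl
    · have h' : S.cellMap d q.1 (q.2.1, q.2.2.1) = S.cellMap d q'.1 (q'.2.1, q'.2.2.1) :=
        Subtype.ext (congrArg Subtype.val h :)
      by_cases h1 : ‖(q.2.2.1 : EuclideanSpace ℝ (Fin n))‖ = 1
      · have h2 : ‖(q'.2.2.1 : EuclideanSpace ℝ (Fin n))‖ = 1 :=
          (S.norm_eq_one_iff_of_cellMap_eq (q := ⟨q.1, q.2.1, q.2.2.1⟩)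
            (q' := ⟨q'.1, q'.2.1, q'.2.2.1⟩) h').1 h1
        rw [hG1 _ h1, hG1 _ h2, h]
      · have h3 := S.eq_of_cellMap_eq (q := ⟨q.1, q.2.1, q.2.2.1⟩)
          (q' := ⟨q'.1, q'.2.1, q'.2.2.1⟩) h' h1
        obtain ⟨c, t, x⟩ := q
        obtain ⟨c', t', x'⟩ := q'
        obtain rfl : c = c' := congrArg Sigma.fst h3
        simp only [Sigma.mk.injEq, heq_eq_eq, true_and, Prod.mk.injEq] at h3
        obtain ⟨rfl, h4⟩ := h3
        rw [Subtype.ext h4]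
  let q := (S.isQuotientMap_puncturedAttach d).lift G hG
  have hq : ∀ a, q (S.puncturedAttach n d a) = G a := fun a =>
    congrArg (fun F => F a) ((S.isQuotientMap_puncturedAttach d).lift_comp G hG)
  refine ⟨⟨fun p => q p.1 p.2, ContinuousMap.continuous_uncurry_of_continuous q⟩,
    fun b s => congrArg (fun F => F s) (hq (Sum.inl b)), fun c t x s =>
      congrArg (fun F => F s) (hq (Sum.inr ⟨c, t, x⟩))⟩

variable (n)

/-- The `D`-space on the punctured stage of the filtration. -/
def puncturedDiagram : D ⥤ TopCat.{u} :=
  subDiagram X.toFunctor (S.punctured n) (S.map_mem_punctured n)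

/-- The inclusion in the punctured stage. -/
def toPunctured : S.skelDiagram n ⟶ S.puncturedDiagram n :=
  subDiagramIncl X.toFunctor _ _ (S.skel_subset_punctured n)

/-- The inclusion of the punctured stage. -/
def fromPunctured : S.puncturedDiagram n ⟶ S.skelDiagram (n + 1) :=
  subDiagramIncl X.toFunctor _ _ (S.punctured_subset n)

/-- The previous stage is a deformation retract of the punctured stage. -/
lemma exists_retraction : ∃ r : S.puncturedDiagram n ⟶ S.skelDiagram n,
    S.toPunctured n ≫ r = 𝟙 _ ∧ DHomotopic (r ≫ S.toPunctured n) (𝟙 (S.puncturedDiagram n)) := by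
  choose H hb hc using fun d => S.exists_push (n := n) d
  have h0 : ∀ d y, (H d (y, 0)).1 ∈ S.skel n d := fun d y => by
    rcases S.punctured_cases y with ⟨b, rfl⟩ | ⟨⟨c, t, x⟩, rfl⟩
    · rw [hb]
      exact b.2
    · rw [hc]
      exact (S.charMap_mem_iff c d _).2 (norm_radial_zero x)
  have hnat : ∀ (d d' : D) (a : d ⟶ d') (y : (S.puncturedDiagram n).obj d) (s : unitInterval),
      H d' ((S.puncturedDiagram n).map a y, s) = (S.puncturedDiagram n).map a (H d (y, s)) := by
    intro d d' a y s
    rcases S.punctured_cases y with ⟨b, rfl⟩ | ⟨⟨c, t, x⟩, rfl⟩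
    · rw [hb]
      exact hb d' ⟨X.toFunctor.map a b.1, S.map_mem_skel n d d' a _ b.2⟩ s
    · have h : ∀ x, (S.puncturedDiagram n).map a (S.puncturedAttach n d (Sum.inr ⟨c, t, x⟩)) =
          S.puncturedAttach n d' (Sum.inr ⟨c, (S.orbitDiagram c).map a t, x⟩) := fun x =>
        Subtype.ext (S.charMap_naturality c d d' a t x.1).symm
      rw [hc, h, h]
      exact hc d' c _ x s
  let r : S.puncturedDiagram n ⟶ S.skelDiagram n :=
    { app := fun d => TopCat.ofHom ⟨fun y => ⟨(H d (y, 0)).1, h0 d y⟩, by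
        exact (continuous_subtype_val.comp ((H d).continuous.comp
          (continuous_id.prodMk continuous_const))).subtype_mk _⟩
      naturality := fun d d' a => by
        ext y
        exact Subtype.ext (congrArg Subtype.val (hnat d d' a y 0) :) }
  refine ⟨r, ?_, H, fun d y => rfl, fun d y => ?_, hnat⟩
  · ext d y
    exact Subtype.ext (congrArg Subtype.val (hb d y 0) :)
  · rcases S.punctured_cases y with ⟨b, rfl⟩ | ⟨⟨c, t, x⟩, rfl⟩
    · exact hb d b 1
    · refine (hc d c t x 1).trans ?_
      rw [radial_one]
      rfl

end DCWStructure

variable {D : Type u} [SmallCategory D]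

/-! ### Equivariant maps out of orbits -/

section Orbits

variable [TopEnriched D]

/-- An orbit is not empty: otherwise it would have two different maps to a discrete space with two
points. -/
lemma IsOrbit.exists_point {T : DSpace D} (hT : IsOrbit T) : ∃ d, Nonempty (T.toFunctor.obj d) := by
  by_contra! h
  obtain ⟨y, -, hy⟩ := hT (ULift.{u} Bool) (fun d => ContinuousMap.const _ ⟨true⟩)
    fun _ _ _ _ => rfl
  have h₁ := hy ⟨true⟩ fun d x => (h d).elim x
  have h₂ := hy ⟨false⟩ fun d x => (h d).elim x
  exact Bool.noConfusion (congrArg ULift.down (h₁.trans h₂.symm))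

/-- Invariant maps out of an orbit are constant. -/
lemma IsOrbit.eq_of_invariant {T : DSpace D} (hT : IsOrbit T) {Z : Type} [TopologicalSpace Z]
    [T2Space Z] [LocallyCompactSpace Z] (g : ∀ d, C(T.toFunctor.obj d, Z))
    (hg : ∀ (d d' : D) (a : d ⟶ d') x, g d' (T.toFunctor.map a x) = g d x) {d d' : D}
    (x : T.toFunctor.obj d) (x' : T.toFunctor.obj d') : g d x = g d' x' := by
  have hlc : LocallyCompactSpace (ULift.{u} Z) :=
    Homeomorph.ulift.isClosedEmbedding.locallyCompactSpace
  obtain ⟨y, hy, -⟩ := hT (ULift.{u} Z) (fun d => ⟨fun x => ⟨g d x⟩,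
    continuous_uliftUp.comp (g d).continuous⟩) fun d d' a x => congrArg ULift.up (hg d d' a x)
  exact congrArg ULift.down ((hy d x).trans (hy d' x').symm)

end Orbits

section MappingSpaces

variable {T T' X Y : D ⥤ TopCat.{u}}

/-- An equivariant map whose values lie in a subspace diagram factors through it. -/
lemma mem_range_mapObjPost (b : X ⟶ Y) (hb : ∀ d, IsEmbedding (b.app d)) (f : mapObj T Y)
    (hf : ∀ d t, mapObjApp d f t ∈ Set.range (b.app d)) : f ∈ Set.range (mapObjPost T b) := by
  choose g hg using hf
  refine ⟨mapObjMk (fun d => ⟨g d, ?_⟩) fun d d' a t => ?_, mapObj_ext hg⟩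
  · rw [(hb d).continuous_iff]
    have h : (b.app d) ∘ g d = mapObjApp d f := funext (hg d)
    rw [h]
    exact (mapObjApp d f).continuous
  · refine (hb d').injective ?_
    change b.app d' (g d' _) = b.app d' (X.map a (g d t))
    rw [hg, mapObjApp_map, ← hg d t]
    exact (NatTrans.naturality_apply b a (g d t)).symm

/-- An equivariant map to `T'` and a point of Euclidean space as an equivariant map. -/
def euclToMap (T T' : D ⥤ TopCat.{u}) (n : ℕ) :
    euclProd (mapObj T T') n ⟶ mapObj T (euclDiagram T' n) :=
  TopCat.ofHom (Y := mapObj T (euclDiagram T' n)) ⟨fun p => mapObjMk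
    (fun d => (mapObjApp d p.1).prodMk (ContinuousMap.const _ p.2)) (fun d d' a t => by
      refine Prod.ext ?_ rfl
      exact mapObjApp_map p.1 a t), continuous_mapObj fun d => by
    have h : Continuous fun p : mapObj T T' × EuclideanSpace ℝ (Fin n) =>
        (ContinuousMap.const (T.obj d) p.2).prodMk (mapObjApp d p.1) :=
      ContinuousMap.continuous_prodMk_const.comp
        ((continuous_id.prodMap (continuous_mapObjApp d)).comp continuous_swap)
    exact (ContinuousMap.continuous_postcomp ContinuousMap.prodSwap).comp h⟩

/-- The projection of the product with Euclidean space. -/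
def euclDiagramFst (T : D ⥤ TopCat.{u}) (n : ℕ) : euclDiagram T n ⟶ T where
  app _ := TopCat.ofHom ⟨Prod.fst, continuous_fst⟩
  naturality _ _ _ := rfl

/-- A point of `T` is needed to recover the point of Euclidean space. -/
lemma isEmbedding_euclToMap (n : ℕ) {d : D} (t : T.obj d) : IsEmbedding (euclToMap T T' n) := by
  refine Function.LeftInverse.isEmbedding
    (f := fun f : mapObj T (euclDiagram T' n) =>
      ((mapObjPost T (euclDiagramFst T' n) f, (mapObjApp d f t).2) : euclProd (mapObj T T') n))
    (fun p => rfl) ?_ (euclToMap T T' n).hom.continuous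
  exact (mapObjPost T (euclDiagramFst T' n)).hom.continuous.prodMk
    (continuous_snd.comp (continuous_mapObj_eval d t))

end MappingSpaces

/-! ### Spaces of maps from orbits into open cells -/

namespace DCWStructure

variable [TopEnriched D] {X : DSpace D} {ι : Type u}
  {O : ι → DSpace D} (S : DCWStructure X O) {n : ℕ}

/-- An equivariant map from an orbit lies in the previous stage of the filtration, or in an open
cell, where its coordinate in the disc is constant: the functions which detect the cells and the
coordinate are invariant, hence constant on the orbit. -/
lemma orbit_cases {T : DSpace D} (hT : IsOrbit T)
    (f : mapObj T.toFunctor (S.skelDiagram (n + 1))) : (∀ d t, (mapObjApp d f t).1 ∈ S.skel n d) ∨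
    ∃ (c : S.cell n) (x : EuclideanSpace ℝ (Fin n)), ∀ d t, ∃ t',
      (S.openCell c).app d (t', x) = mapObjApp d f t := by
  classical
  choose q hq₀ hq using fun (c : S.cell n) (d : D) => S.exists_cellCoordinate c d
  have hinv : ∀ c d d' (a : d ⟶ d') (y : (S.skelDiagram (n + 1)).obj d),
      q c d' ((S.skelDiagram (n + 1)).map a y) = q c d y := fun c d d' a y => by
    rcases S.skel_cases y with h | ⟨c', p, -, rfl⟩
    · exact (hq₀ c d' _ (S.map_mem_skel n d d' a _ h)).trans (hq₀ c d y h).symm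
    · have h : (S.skelDiagram (n + 1)).map a (S.cellMap d c' p) =
          S.cellMap d' c' ((S.orbitDiagram c').map a p.1, p.2) :=
        Subtype.ext (S.charMap_naturality c' d d' a p.1 p.2).symm
      rw [h]
      exact (hq c d' c' _).trans (hq c d c' p).symm
  have hconst : ∀ c {d d'} (t : T.toFunctor.obj d) (t' : T.toFunctor.obj d'),
      q c d (mapObjApp d f t) = q c d' (mapObjApp d' f t') := fun c d d' t t' =>
    hT.eq_of_invariant (fun d => (q c d).comp (mapObjApp d f)) (fun d d' a x => by
      change q c d' (mapObjApp d' f _) = q c d (mapObjApp d f x)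
      rw [mapObjApp_map]
      exact hinv c d d' a _) t t'
  obtain ⟨d₀, ⟨t₀⟩⟩ := hT.exists_point
  rcases S.skel_cases (mapObjApp d₀ f t₀) with h | ⟨c, p, hp, hpf⟩
  · refine Or.inl fun d t => ?_
    rcases S.skel_cases (mapObjApp d f t) with h' | ⟨c, p, hp, hpf⟩
    · exact h'
    · have h1 := (hconst c t t₀).trans (hq₀ c d₀ _ h)
      rw [← hpf, hq, if_pos rfl] at h1
      have h2 : 1 - ‖(p.2 : EuclideanSpace ℝ (Fin n))‖ = 0 := congrArg Prod.snd h1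
      linarith
  · obtain ⟨x, hx⟩ := exists_toCell_eq p.2 hp
    refine Or.inr ⟨c, x, fun d t => ?_⟩
    have h1 := hconst c t t₀
    rw [← hpf, hq, if_pos rfl] at h1
    rcases S.skel_cases (mapObjApp d f t) with h' | ⟨c', p', hp', hpf'⟩
    · rw [hq₀ c d _ h'] at h1
      have h2 : 0 = 1 - ‖(p.2 : EuclideanSpace ℝ (Fin n))‖ := congrArg Prod.snd h1
      linarith
    · rw [← hpf', hq] at h1
      split_ifs at h1 with hc
      · subst hc
        have h2 : 1 - ‖(p'.2 : EuclideanSpace ℝ (Fin n))‖ =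
          1 - ‖(p.2 : EuclideanSpace ℝ (Fin n))‖ := congrArg Prod.snd h1
        have h3 : (1 - ‖(p'.2 : EuclideanSpace ℝ (Fin n))‖) • (p'.2 : EuclideanSpace ℝ (Fin n)) =
          (1 - ‖(p.2 : EuclideanSpace ℝ (Fin n))‖) • (p.2 : EuclideanSpace ℝ (Fin n)) :=
          congrArg Prod.fst h1
        rw [h2] at h3
        have h4 : p'.2 = p.2 := Subtype.ext (smul_right_injective _ (by linarith : _ ≠ _) h3)
        refine ⟨p'.1, ?_⟩
        rw [← hpf', openCell_app, hx, ← h4]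
      · have h2 : 0 = 1 - ‖(p.2 : EuclideanSpace ℝ (Fin n))‖ := congrArg Prod.snd h1
        linarith

variable (n)

lemma isOpenEmbedding_fromPunctured (d : D) : IsOpenEmbedding ((S.fromPunctured n).app d) :=
  S.isOpenEmbedding_punctured

variable (T : D ⥤ TopCat.{u})

/-- The space of equivariant maps to the orbits of the `n`-cells. -/
abbrev cellSpace : TopCat.{u} := TopCat.of (Σ c : S.cell n, mapObj T (S.orbitDiagram c))

variable {n T}

/-- The space of equivariant maps into an open cell. -/
def mapCell (T : D ⥤ TopCat.{u}) (c : S.cell n) :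
    euclProd (mapObj T (S.orbitDiagram c)) n ⟶ mapObj T (S.skelDiagram (n + 1)) :=
  euclToMap T (S.orbitDiagram c) n ≫ mapObjPost T (S.openCell c)

variable (n T) in
/-- The space of equivariant maps into the open cells. -/
def mapCells : euclProd (S.cellSpace n T) n ⟶ mapObj T (S.skelDiagram (n + 1)) :=
  TopCat.ofHom (Y := mapObj T (S.skelDiagram (n + 1)))
    ⟨fun p => S.mapCell T p.1.1 (p.1.2, p.2), by
      have h : Continuous fun q : Σ c : S.cell n, mapObj T (S.orbitDiagram c) ×
          EuclideanSpace ℝ (Fin n) => S.mapCell T q.1 q.2 :=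
        continuous_sigma fun c => (S.mapCell T c).hom.continuous
      exact h.comp Homeomorph.sigmaProdDistrib.continuous⟩

/-- By `orbit_cases` the condition that a map from an orbit lies in a given open cell can be tested
at a single point of the orbit, so that it is an open condition. -/
lemma isOpenEmbedding_mapCell {T : DSpace D} (hT : IsOrbit T) (c : S.cell n) :
    IsOpenEmbedding (S.mapCell T.toFunctor c) := by
  obtain ⟨d₀, ⟨t₀⟩⟩ := hT.exists_point
  refine ⟨(isEmbedding_mapObjPost _ fun d => (S.isOpenEmbedding_openCell c d).isEmbedding).comp
    (isEmbedding_euclToMap n t₀), ?_⟩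
  have hrange : Set.range (S.mapCell T.toFunctor c) =
      (fun f => mapObjApp d₀ f t₀) ⁻¹' Set.range ((S.openCell c).app d₀) := by
    ext f
    constructor
    · rintro ⟨p, rfl⟩
      exact ⟨_, rfl⟩
    · rintro ⟨p, hp⟩
      rcases S.orbit_cases hT f with h | ⟨c', x, hf⟩
      · have h1 : ‖(toCell p.2 : EuclideanSpace ℝ (Fin n))‖ = 1 :=
          S.norm_eq_one_of_cellMap_eq (c := c) (p := (p.1, toCell p.2)) (b := ⟨_, h d₀ t₀⟩) hp
        exact absurd h1 (norm_toCell_lt _).ne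
      · obtain rfl : c = c' := by
          obtain ⟨t', ht'⟩ := hf d₀ t₀
          exact congrArg Sigma.fst (S.eq_of_cellMap_eq_openCell (c := c) (p := p) (c' := c')
            (q := (t', toCell x)) (ht'.trans hp.symm))
        obtain ⟨g, hg⟩ := mem_range_mapObjPost (S.openCell c)
          (fun d => (S.isOpenEmbedding_openCell c d).isEmbedding) f
          fun d t => (hf d t).imp' (fun t' => (t', x)) fun _ h => h
        refine ⟨(mapObjPost T.toFunctor (euclDiagramFst _ n) g, x), ?_⟩
        rw [← hg]
        refine mapObj_ext fun d t => ?_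
        obtain ⟨t', ht'⟩ := hf d t
        rw [← hg] at ht'
        have h1 : (t', x) = mapObjApp d g t := (S.isOpenEmbedding_openCell c d).injective ht'
        change (S.openCell c).app d ((mapObjApp d g t).1, x) =
          (S.openCell c).app d (mapObjApp d g t)
        rw [← h1]
  rw [hrange]
  exact (S.isOpenEmbedding_openCell c d₀).isOpen_range.preimage (continuous_mapObj_eval d₀ t₀)

lemma isOpenEmbedding_mapCells {T : DSpace D} (hT : IsOrbit T) :
    IsOpenEmbedding (S.mapCells n T.toFunctor) := by
  obtain ⟨d₀, ⟨t₀⟩⟩ := hT.exists_point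
  have h : IsOpenEmbedding fun q : Σ c : S.cell n, mapObj T.toFunctor (S.orbitDiagram c) ×
      EuclideanSpace ℝ (Fin n) => S.mapCell T.toFunctor q.1 q.2 := by
    refine IsOpenEmbedding.of_continuous_injective_isOpenMap
      (continuous_sigma fun c => (S.mapCell _ c).hom.continuous) ?_
      (isOpenMap_sigma.2 fun c => (S.isOpenEmbedding_mapCell hT c).isOpenMap)
    rintro ⟨c, p⟩ ⟨c', p'⟩ h
    have h1 : mapObjApp d₀ (S.mapCell T.toFunctor c p) t₀ =
      mapObjApp d₀ (S.mapCell T.toFunctor c' p') t₀ := congrArg (fun F => mapObjApp d₀ F t₀) h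
    obtain rfl : c = c' := congrArg Sigma.fst (S.eq_of_cellMap_eq_openCell (c := c)
      (p := (mapObjApp d₀ p.1 t₀, p.2)) (c' := c')
      (q := (mapObjApp d₀ p'.1 t₀, toCell p'.2)) h1.symm)
    exact congrArg (Sigma.mk c) ((S.isOpenEmbedding_mapCell hT c).injective h)
  exact h.comp Homeomorph.sigmaProdDistrib.isOpenEmbedding

end DCWStructure

/-! ### Excision of the open cells in mapping spaces -/

section

open Limits HomologicalComplex

/-- The map of relative complexes depends only on the map of the larger spaces. -/
lemma relMap_congr {A B A' B' : TopCat.{u}} {f : A ⟶ B} {f' : A' ⟶ B'} {a a' : A ⟶ A'}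
    {b b' : B ⟶ B'} (w : f ≫ b = a ≫ f') (w' : f ≫ b' = a' ≫ f') (h : b = b') :
    relMap f f' a b w = relMap f f' a' b' w' := by
  subst h
  apply (cancel_epi (cokernel.π _)).1
  simp

lemma quasiIso_comp_singularChains {X Y Z : TopCat.{u}} (f : X ⟶ Y) (g : Y ⟶ Z)
    (hf : QuasiIso (singularChains.map f)) (hg : QuasiIso (singularChains.map g)) :
    QuasiIso (singularChains.map (f ≫ g)) := by
  rw [CategoryTheory.Functor.map_comp]
  infer_instance

end

variable {D : Type u} [SmallCategory D]

namespace DCWStructure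

open Limits HomologicalComplex

variable [TopEnriched D] {X : DSpace D} {ι : Type u}
  {O : ι → DSpace D} (S : DCWStructure X O) (n : ℕ) (T T' : D ⥤ TopCat.{u})

/-- The maps from `T` to the orbits of the `n`-cells, with a non-zero point of Euclidean space: they
parametrize the maps into open cells which avoid the centres. -/
abbrev offCentre : Set (euclProd (S.cellSpace n T) n) := offAxis (S.cellSpace n T) n n

lemma isEmbedding_mapObjPost_fromPunctured : IsEmbedding (mapObjPost T (S.fromPunctured n)) :=
  isEmbedding_mapObjPost _ fun d => (S.isOpenEmbedding_fromPunctured n d).isEmbedding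

instance : Mono (mapObjPost T (S.fromPunctured n)) :=
  (TopCat.mono_iff_injective _).2 (S.isEmbedding_mapObjPost_fromPunctured n T).injective

variable {n T} in
lemma mapCells_mem_range (p : euclProd (S.cellSpace n T) n) (hp : p.2 ≠ 0) :
    S.mapCells n T p ∈ Set.range (mapObjPost T (S.fromPunctured n)) :=
  mem_range_mapObjPost _ (fun d => (S.isOpenEmbedding_fromPunctured n d).isEmbedding) _ fun _ _ =>
    ⟨⟨_, S.charMap_mem_punctured_iff.2 fun h => hp (toCell_eq_centre.1 h)⟩, rfl⟩

lemma ne_zero_of_mem_offAxis {Z : TopCat.{u}} {n : ℕ} {p : euclProd Z n}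
    (hp : p ∈ offAxis Z n n) : p.2 ≠ 0 := by
  obtain ⟨i, -, hi⟩ := hp
  rintro h
  exact hi (by rw [h]; rfl)

lemma mem_offAxis {Z : TopCat.{u}} {n : ℕ} {p : euclProd Z n} (hp : p.2 ≠ 0) :
    p ∈ offAxis Z n n := by
  by_contra h
  exact hp (PiLp.ext fun i => by
    by_contra hi
    exact h ⟨i, i.2, hi⟩)

/-- The inclusion of the open cells on the level of mapping spaces, on the complement of the
centres. -/
def mapCellsOff : TopCat.of (S.offCentre n T) ⟶ mapObj T (S.puncturedDiagram n) :=
  TopCat.ofHom (X := S.offCentre n T) (Y := mapObj T (S.puncturedDiagram n))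
    ⟨fun p => (S.mapCells_mem_range p.1 (ne_zero_of_mem_offAxis p.2)).choose, by
      rw [(S.isEmbedding_mapObjPost_fromPunctured n T).continuous_iff]
      have h : mapObjPost T (S.fromPunctured n) ∘ (fun p : S.offCentre n T =>
          (S.mapCells_mem_range p.1 (ne_zero_of_mem_offAxis p.2)).choose) =
          fun p => S.mapCells n T p.1 :=
        funext fun p => (S.mapCells_mem_range p.1 (ne_zero_of_mem_offAxis p.2)).choose_spec
      rw [h]
      exact (S.mapCells n T).hom.continuous.comp continuous_subtype_val⟩

/-- The inclusion of the open cells on the level of mapping spaces. -/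
def mapCellsUniv : TopCat.of (Set.univ : Set (euclProd (S.cellSpace n T) n)) ⟶
    mapObj T (S.skelDiagram (n + 1)) :=
  TopCat.ofHom ⟨Subtype.val, continuous_subtype_val⟩ ≫ S.mapCells n T

lemma setIncl_mapCellsUniv : setIncl (Set.subset_univ (S.offCentre n T)) ≫ S.mapCellsUniv n T =
    S.mapCellsOff n T ≫ mapObjPost T (S.fromPunctured n) := by
  ext p
  exact (S.mapCells_mem_range p.1 (ne_zero_of_mem_offAxis p.2)).choose_spec.symm

/-- The excision map from the open cells to the pair formed by a stage of the filtration and its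
punctured part, on the level of mapping spaces. -/
abbrev cellExcision : relComplex (setIncl (Set.subset_univ (S.offCentre n T))) ⟶
    relComplex (mapObjPost T (S.fromPunctured n)) :=
  relMap _ _ (S.mapCellsOff n T) (S.mapCellsUniv n T) (S.setIncl_mapCellsUniv n T)

/-- For an orbit, the maps into open cells and the maps into the punctured stage form two open
subspaces of the mapping space, which cover it by `orbit_cases`; so excision applies. -/
lemma quasiIso_cellExcision {T : DSpace D} (hT : IsOrbit T) :
    QuasiIso (S.cellExcision n T.toFunctor) := by
  obtain ⟨d₀, ⟨t₀⟩⟩ := hT.exists_point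
  have hmem : ∀ f : mapObj T.toFunctor (S.skelDiagram (n + 1)),
      (∀ d t, (mapObjApp d f t).1 ∈ S.punctured n d) →
        f ∈ Set.range (mapObjPost T.toFunctor (S.fromPunctured n)) := fun f hf =>
    mem_range_mapObjPost _ (fun d => (S.isOpenEmbedding_fromPunctured n d).isEmbedding) f
      fun d t => ⟨⟨_, hf d t⟩, rfl⟩
  refine quasiIso_relMap_excision _ _ _ _ _ (isEmbedding_setIncl _)
    ((S.isOpenEmbedding_mapCells hT).comp isOpen_univ.isOpenEmbedding_subtypeVal)
    ⟨S.isEmbedding_mapObjPost_fromPunctured n _, ?_⟩ (fun f => ?_) fun p hp => ?_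
  · have hrange : Set.range (mapObjPost T.toFunctor (S.fromPunctured n)) =
        (fun f => mapObjApp d₀ f t₀) ⁻¹' Set.range ((S.fromPunctured n).app d₀) := by
      ext f
      constructor
      · rintro ⟨g, rfl⟩
        exact ⟨_, rfl⟩
      · rintro ⟨y, hy⟩
        have hy' : (mapObjApp d₀ f t₀).1 ∈ S.punctured n d₀ := by
          rw [← show y.1 = (mapObjApp d₀ f t₀).1 from congrArg Subtype.val hy]
          exact y.2
        refine hmem f fun d t => ?_
        rcases S.orbit_cases hT f with h | ⟨c, x, hf⟩
        · exact S.skel_subset_punctured n d (h d t)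
        · obtain ⟨t', ht'⟩ := hf d t
          obtain ⟨t'', ht''⟩ := hf d₀ t₀
          rw [← ht''] at hy'
          rw [← ht']
          have hx := S.charMap_mem_punctured_iff.1 hy'
          exact S.charMap_mem_punctured_iff.2 hx
    rw [hrange]
    exact (S.isOpenEmbedding_fromPunctured n d₀).isOpen_range.preimage
      (continuous_mapObj_eval d₀ t₀)
  · rcases S.orbit_cases hT f with h | ⟨c, x, hf⟩
    · exact Or.inr (hmem f fun d t => S.skel_subset_punctured n d (h d t))
    · refine Or.inl ?_
      obtain ⟨g, rfl⟩ := mem_range_mapObjPost (S.openCell c)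
        (fun d => (S.isOpenEmbedding_openCell c d).isEmbedding) f
        fun d t => (hf d t).imp' (fun t' => (t', x)) fun _ h => h
      refine ⟨⟨(⟨c, mapObjPost T.toFunctor (euclDiagramFst _ n) g⟩, x), trivial⟩, ?_⟩
      refine mapObj_ext fun d t => ?_
      obtain ⟨t', ht'⟩ := hf d t
      have h1 : (t', x) = mapObjApp d g t := (S.isOpenEmbedding_openCell c d).injective ht'
      change (S.openCell c).app d ((mapObjApp d g t).1, x) = (S.openCell c).app d (mapObjApp d g t)
      rw [← h1]
  · obtain ⟨g, hg⟩ := hp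
    refine ⟨⟨p.1, mem_offAxis fun h0 => ?_⟩, rfl⟩
    have h1 : (mapObjApp d₀ g t₀).1 =
        S.charMap p.1.1.1 d₀ (mapObjApp d₀ p.1.1.2 t₀, toCell p.1.2) :=
      congrArg (fun F : mapObj T.toFunctor (S.skelDiagram (n + 1)) =>
        Subtype.val (mapObjApp d₀ F t₀)) hg
    have h2 := (mapObjApp d₀ g t₀).2
    rw [h1] at h2
    exact S.charMap_mem_punctured_iff.1 h2 (toCell_eq_centre.2 h0)

variable {T T'} in
/-- The map of the spaces of cells induced by a map of orbits. -/
def cellSpaceMap (a : T' ⟶ T) : S.cellSpace n T ⟶ S.cellSpace n T' :=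
  TopCat.ofHom ⟨Sigma.map id fun c => mapObjPre a (S.orbitDiagram c),
    continuous_sigma fun _ => continuous_sigmaMk.comp (mapObjPre a _).hom.continuous⟩

variable {T T'} in
/-- The map of pairs of mapping spaces induced by a map of orbits. -/
abbrev punctureMap (a : T' ⟶ T) : relComplex (mapObjPost T (S.fromPunctured n)) ⟶
    relComplex (mapObjPost T' (S.fromPunctured n)) :=
  relMap _ _ (mapObjPre a _) (mapObjPre a _) (mapObjPre_post a _)

variable {T T'} in
lemma cellExcision_naturality (a : T' ⟶ T) :
    homologyMap (S.cellExcision n T) n ≫ homologyMap (S.punctureMap n a) n =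
      axisHomologyMap (S.cellSpaceMap n a) n n n ≫ homologyMap (S.cellExcision n T') n := by
  have h : S.mapCellsUniv n T ≫ mapObjPre a (S.skelDiagram (n + 1)) =
      setMap (euclProdMap (S.cellSpaceMap n a) n) (Set.mapsTo_univ _ _) ≫ S.mapCellsUniv n T' := rfl
  have h' := (relMap_comp _ _ (S.setIncl_mapCellsUniv n T) _ _ (mapObjPre_post a _)).trans
    ((relMap_congr _ _ h).trans (relMap_comp _ _ (setMap_comm (euclProdMap (S.cellSpaceMap n a) n)
      _ _ (mapsTo_offAxis _ n n) _) _ _ (S.setIncl_mapCellsUniv n T')).symm)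
  have h'' := congrArg (homologyMap · n) h'
  simp only [homologyMap_comp] at h''
  exact h''

/-- The class of a map from an orbit to the orbit of a cell, in the homology of the stage of the
filtration relative to its punctured part. -/
def cellClass (e : axisHomology (TopCat.of PUnit.{u + 1}) n n n) (c : S.cell n)
    (g : mapObj T (S.orbitDiagram c)) :
    (relComplex (mapObjPost T (S.fromPunctured n))).homology n :=
  (homologyMap (S.cellExcision n T) n).hom
    ((axisHomologyMap (pointIncl (Z := S.cellSpace n T) ⟨c, g⟩) n n n).hom e)

variable {T T'} in
lemma punctureMap_cellClass (e) (c : S.cell n) (a : T' ⟶ T) (g : mapObj T (S.orbitDiagram c)) :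
    (homologyMap (S.punctureMap n a) n).hom (S.cellClass n T e c g) =
      S.cellClass n T' e c (mapObjPre a _ g) := by
  have h : axisHomologyMap (pointIncl (Z := S.cellSpace n T) ⟨c, g⟩) n n n ≫
      axisHomologyMap (S.cellSpaceMap n a) n n n =
      axisHomologyMap (pointIncl (Z := S.cellSpace n T') ⟨c, mapObjPre a _ g⟩) n n n :=
    pairMap_comp _ _ _ rfl _ _ _ _ _ _ _ _ _ _
  have h' := congrArg (fun F => (axisHomologyMap (pointIncl (Z := S.cellSpace n T) ⟨c, g⟩) n n n ≫
    F).hom e) (S.cellExcision_naturality n a)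
  refine h'.trans ?_
  rw [← Category.assoc, h]
  rfl

lemma comparison_comm : mapSpaceMap (𝟙 T) (S.skelIncl n) ≫ fromMapSpace T _ =
    (fromMapSpace T _ ≫ mapObjPost T (S.toPunctured n)) ≫ mapObjPost T (S.fromPunctured n) := rfl

/-- The comparison of the filtration quotient with the pair of the stage of the filtration and its
punctured part. -/
abbrev comparison : relComplex (mapSpaceMap (𝟙 T) (S.skelIncl n)) ⟶
    relComplex (mapObjPost T (S.fromPunctured n)) :=
  relMap _ _ (fromMapSpace T _ ≫ mapObjPost T (S.toPunctured n)) (fromMapSpace T _)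
    (S.comparison_comm n T)

/-- The comparison is a homology isomorphism, because the previous stage is a deformation retract
of the punctured stage. -/
lemma quasiIso_comparison [Mono (mapSpaceMap (𝟙 T) (S.skelIncl n))] :
    QuasiIso (S.comparison n T) := by
  obtain ⟨r, hr, hr'⟩ := S.exists_retraction n
  refine quasiIso_relMap _ _ _ _ _ ?_ inferInstance
  exact quasiIso_comp_singularChains _ _ inferInstance (quasiIso_mapObjPost _ r hr hr')

variable {T T'} in
lemma skelIncl_comm (a : T' ⟶ T) : mapSpaceMap (𝟙 T) (S.skelIncl n) ≫ mapSpaceMap a (𝟙 _) =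
    mapSpaceMap a (𝟙 _) ≫ mapSpaceMap (𝟙 T') (S.skelIncl n) := by
  ext (f : T ⟶ S.skelDiagram n)
  change a ≫ (𝟙 T ≫ f ≫ S.skelIncl n) ≫ 𝟙 _ = 𝟙 T' ≫ (a ≫ f ≫ 𝟙 _) ≫ S.skelIncl n
  simp

variable {T T'} in
lemma comparison_naturality (a : T' ⟶ T) :
    relMap (mapSpaceMap (𝟙 T) (S.skelIncl n)) (mapSpaceMap (𝟙 T') (S.skelIncl n))
      (mapSpaceMap a (𝟙 _)) (mapSpaceMap a (𝟙 _)) (S.skelIncl_comm n a) ≫ S.comparison n T' =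
      S.comparison n T ≫ S.punctureMap n a := by
  have h : mapSpaceMap a (𝟙 (S.skelDiagram (n + 1))) ≫ fromMapSpace T' _ =
      fromMapSpace T _ ≫ mapObjPre a _ := rfl
  exact (relMap_comp _ _ (S.skelIncl_comm n a) _ _ (S.comparison_comm n T')).trans
    ((relMap_congr _ _ h).trans
      (relMap_comp _ _ (S.comparison_comm n T) _ _ (mapObjPre_post a _)).symm)

end DCWStructure

variable {D : Type u} [SmallCategory D]

/-! ### Freeness of the cellular chains and the Euler characteristic -/

namespace DCWStructure

open Limits HomologicalComplex

variable [TopEnriched D] {X : DSpace D} {ι : Type u}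
  {O : ι → DSpace D} (S : DCWStructure X O) (n : ℕ)

/-- The cellular chains are free on the cells: `H_n(hom(T, X_n), hom(T, X_{n-1}))` is isomorphic to
the homology of `⨿ hom(T, T_c) × (ℝⁿ, ℝⁿ ∖ 0)`, a sum over the `n`-cells `c`, and this is the free
abelian group on the path components of the spaces `hom(T, T_c)`, which are homotopy classes of
equivariant maps. -/
lemma exists_isFreeOn (hO : ∀ i, IsOrbit (O i)) :
    ∃ θ : ∀ (c : S.cell n) {j : OrbitCat O}, (j ⟶ (S.orbit c : OrbitCat O)) →
      (S.chains.X n).obj (op j),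
      IsFreeOn (toHo O) (S.chains.X n) (fun c => (S.orbit c : OrbitCat O)) θ := by
  obtain ⟨e, he⟩ := exists_local_class.{u} n
  let C : (OrbitCat O)ᵒᵖ ⥤ ModuleCat.{u} ℤ :=
    cellularChain (fun n => (orbitPoints O).obj (S.skelDiagram n))
      (fun n => (orbitPoints O).map (S.skelIncl n)) n
  -- The comparison with the pair given by the punctured stage.
  let η (j : OrbitCat O) : C.obj (op j) ⟶
      (relComplex (mapObjPost (O j).toFunctor (S.fromPunctured n))).homology n :=
    homologyMap (S.comparison n (O j).toFunctor) n
  have hη : ∀ j, IsIso (η j) := fun j => by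
    have hm : Mono (mapSpaceMap (𝟙 (O j).toFunctor) (S.skelIncl n)) :=
      S.mono_orbitPoints_skelIncl n (op j)
    have hq := S.quasiIso_comparison n (O j).toFunctor
    exact (quasiIsoAt_iff_isIso_homologyMap _ _).1 (hq.quasiIsoAt n)
  have hηnat : ∀ {j k : OrbitCat O} (a : j ⟶ k),
      C.map a.op ≫ η j = η k ≫ homologyMap (S.punctureMap n a.hom) n := fun {j k} a => by
    have h := congrArg (homologyMap · n) (S.comparison_naturality n a.hom)
    simp only [homologyMap_comp] at h
    exact h
  -- The excision isomorphism from the open cells.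
  let ε (j : OrbitCat O) : axisHomology (S.cellSpace n (O j).toFunctor) n n n ⟶
      (relComplex (mapObjPost (O j).toFunctor (S.fromPunctured n))).homology n :=
    homologyMap (S.cellExcision n (O j).toFunctor) n
  have hε : ∀ j, IsIso (ε j) := fun j =>
    (quasiIsoAt_iff_isIso_homologyMap _ _).1 ((S.quasiIso_cellExcision n (hO j)).quasiIsoAt n)
  let θ (c : S.cell n) {j : OrbitCat O} (f : j ⟶ (S.orbit c : OrbitCat O)) : C.obj (op j) :=
    (inv (η j)).hom (S.cellClass n (O j).toFunctor e c f.hom)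
  have hηinv : ∀ j x, (inv (η j)).hom ((η j).hom x) = x := fun j x =>
    congrArg (fun F => F.hom x) (IsIso.hom_inv_id (η j))
  have hηinv' : ∀ j x, (η j).hom ((inv (η j)).hom x) = x := fun j x =>
    congrArg (fun F => F.hom x) (IsIso.inv_hom_id (η j))
  have hεinv : ∀ j x, (inv (ε j)).hom ((ε j).hom x) = x := fun j x =>
    congrArg (fun F => F.hom x) (IsIso.hom_inv_id (ε j))
  have hεinv' : ∀ j x, (ε j).hom ((inv (ε j)).hom x) = x := fun j x =>
    congrArg (fun F => F.hom x) (IsIso.inv_hom_id (ε j))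
  refine ⟨θ, ⟨fun c j k a f => ?_, fun j (x : C.obj (op j)) => ?_, fun j => ?_⟩⟩
  · have h₁ : (η j).hom ((C.map a.op).hom (θ c f)) = (η j).hom (θ c (a ≫ f)) := by
      refine (congrArg (fun F => F.hom (θ c f)) (hηnat a)).trans ?_
      change (homologyMap (S.punctureMap n a.hom) n).hom ((η k).hom (θ c f)) = _
      rw [hηinv', hηinv']
      exact S.punctureMap_cellClass n e c a.hom f.hom
    have h₂ := congrArg (inv (η j)).hom h₁
    rwa [hηinv, hηinv] at h₂
  · have h : ∀ y, (inv (η j)).hom ((ε j).hom y) ∈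
        AddSubgroup.closure {y | ∃ c f, y = θ c (j := j) f} := fun y => by
      induction (he (S.cellSpace n (O j).toFunctor)).1 y using AddSubgroup.closure_induction with
      | mem y hy =>
        obtain ⟨⟨c, g⟩, rfl⟩ := hy
        exact AddSubgroup.subset_closure ⟨c, InducedCategory.homMk g, rfl⟩
      | zero => rw [map_zero, map_zero]; exact zero_mem _
      | add x y _ _ hx hy => rw [map_add, map_add]; exact add_mem hx hy
      | neg x _ hx => rw [map_neg, map_neg]; exact neg_mem hx
    have hx := h ((inv (ε j)).hom ((η j).hom x))
    rwa [hεinv', hηinv] at hx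
  · obtain ⟨π, hπ⟩ := (he (S.cellSpace n (O j).toFunctor)).2
      (κ := Σ c : S.cell n, (toHo O).obj j ⟶ (toHo O).obj (S.orbit c : OrbitCat O))
      (fun p => ⟨p.1, (toHo O).map (InducedCategory.homMk p.2)⟩) fun p p' h => by
        obtain ⟨γ⟩ := h
        -- A path in a disjoint union stays in one summand, where it is a homotopy.
        obtain ⟨c, g, hg⟩ := ContinuousMap.exists_lift_sigma γ.toContinuousMap
        have h₀ : (⟨c, g 0⟩ : S.cellSpace n (O j).toFunctor) = p :=
          (congrArg (fun F => F 0) hg).symm.trans γ.source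
        have h₁ : (⟨c, g 1⟩ : S.cellSpace n (O j).toFunctor) = p' :=
          (congrArg (fun F => F 1) hg).symm.trans γ.target
        rw [← h₀, ← h₁]
        refine congrArg (Sigma.mk c) (CategoryTheory.Quotient.sound _ ?_)
        exact dHomotopic_of_joined (O j).cg (f := g 0) (g := g 1) ⟨⟨g, rfl, rfl⟩⟩
    refine ⟨π.comp ((inv (ε j)).hom.toAddMonoidHom.comp (η j).hom.toAddMonoidHom), fun c f => ?_⟩
    change π ((inv (ε j)).hom ((η j).hom (θ c f))) = _
    rw [hηinv']
    refine (congrArg π (hεinv j _)).trans ((hπ ⟨c, f.hom⟩).trans ?_)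
    rfl

lemma exists_isEmpty_cell [Fintype S.Cells] : ∃ N, ∀ n, N ≤ n → IsEmpty (S.cell n) := by
  refine ⟨Finset.univ.sup (fun c : S.Cells => c.1) + 1, fun n hn => ⟨fun c => ?_⟩⟩
  have h : n ≤ _ := Finset.le_sup (f := fun c : S.Cells => c.1) (Finset.mem_univ ⟨n, c⟩)
  omega

variable {n} in
lemma subsingleton_isotropyComplex [Fintype ι] (hO : ∀ i, IsOrbit (O i)) [IsEmpty (S.cell n)] :
    Subsingleton (S.isotropyComplex.X n) := by
  obtain ⟨θ, hθ⟩ := S.exists_isFreeOn n hO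
  have h0 : ∀ j (x : (S.chains.X n).obj (op j)), x = 0 := fun j x => by
    have hx := hθ.span j x
    rw [show {y | ∃ c f, y = θ c (j := j) f} = ∅ from
      Set.eq_empty_of_forall_notMem fun y ⟨c, _⟩ => isEmptyElim c, AddSubgroup.closure_empty] at hx
    exact hx
  have hid : (LinearMap.id :
      TensorProd (toHo O ⋙ zetaI (HoOrbitCat O)) (S.chains.X n) →ₗ[_] _) = 0 :=
    tensorProd_hom_ext _ fun j m c => by
      rw [h0 j c]
      change tmk _ _ j m 0 = 0
      rw [tmk, TensorProduct.tmul_zero, map_zero, map_zero]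
  exact ⟨fun x y => (LinearMap.congr_fun hid x).trans (LinearMap.congr_fun hid y).symm⟩

open Classical in
/-- The alternating sum of the ranks of the homology modules, in terms of the cells. -/
theorem eulerCharacteristic_eq [Fintype ι] [Fintype S.Cells] (hO : ∀ i, IsOrbit (O i))
    (r : ℕ → AbelianizedRing (IsotropyRing (HoOrbitCat O)))
    (hr : ∀ n, IsRank (S.equivariantHomology n) (r n)) :
    (Function.support r).Finite ∧
      ∀ ψ : AbelianizedRing (IsotropyRing (HoOrbitCat O)) →+ IsoGroup (HoOrbitCat O),
        (∀ T, ψ (abMk _ (IsotropyRing.of (𝟙 T))) = isoClass T) →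
          S.eulerCharacteristic = ψ (∑ᶠ n, (-1 : ℤ) ^ n • r n) := by
  obtain ⟨N, hN⟩ := S.exists_isEmpty_cell
  have hfin : ∀ n, Fintype (S.cell n) := fun n =>
    Fintype.ofInjective (fun c => (⟨n, c⟩ : S.Cells)) sigma_mk_injective
  have hzero : ∀ n, N ≤ n → r n = 0 := fun n hn => by
    have := hN n hn
    exact isRank_homology_eq_zero S.isotropyComplex n (S.subsingleton_isotropyComplex hO) (hr n)
  have hsupp : Function.support r ⊆ Finset.range N := fun n hn => by
    by_contra h
    exact hn (hzero n (by simpa using h))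
  refine ⟨(Finset.range N).finite_toSet.subset hsupp, fun ψ hψ => ?_⟩
  have hsum := sum_isRank_homology S.isotropyComplex
    (fun n => ∑ c : S.cell n, abMk _ (IsotropyRing.of (𝟙 (hoObj O (S.orbit c))))) r N
    (fun n => by
      obtain ⟨θ, hθ⟩ := S.exists_isFreeOn n hO
      exact hθ.isProjectiveRank)
    (by
      have := hN N le_rfl
      exact S.subsingleton_isotropyComplex hO) hr
  rw [finsum_eq_sum_of_support_subset (s := Finset.range N) _ fun n hn => hsupp fun h => hn (by
    change (-1 : ℤ) ^ n • r n = 0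
    rw [h, zsmul_zero]), hsum, map_sum]
  have huniv : (Finset.univ : Finset S.Cells) =
      (Finset.range N).sigma fun n => (Finset.univ : Finset (S.cell n)) := by
    ext c
    simp only [Finset.mem_univ, Finset.mem_sigma, Finset.mem_range, and_true, true_iff]
    by_contra h
    exact (hN c.1 (not_lt.1 h)).false c.2
  rw [eulerCharacteristic, huniv, Finset.sum_sigma]
  refine Finset.sum_congr rfl fun n _ => ?_
  rw [map_zsmul, map_sum, Finset.smul_sum]
  exact Finset.sum_congr rfl fun c _ => by rw [hψ]

end DCWStructure

end EquivariantEuler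

end

open EquivariantEuler
theorem mainTheorem1 {D : Type u} [SmallCategory D] [TopEnriched D] {ι : Type u} [Fintype ι]
    (O : ι → DSpace D) (hO : ∀ i, IsOrbit (O i)) (X : DSpace D) (S : DCWStructure X O)
    [Fintype S.Cells] :
    (∃ ψ : AbelianizedRing (IsotropyRing (HoOrbitCat O)) →+ IsoGroup (HoOrbitCat O),
      ∀ T, ψ (abMk _ (IsotropyRing.of (𝟙 T))) = isoClass T) ∧
    ∀ r : ℕ → AbelianizedRing (IsotropyRing (HoOrbitCat O)),
      (∀ n, IsRank (S.equivariantHomology n) (r n)) →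
        (Function.support r).Finite ∧
        (∀ hφ : ∀ a b, augmentation (HoOrbitCat O) (a * b) = augmentation (HoOrbitCat O) (b * a),
          S.eulerCharacteristic =
            abLift (augmentation (HoOrbitCat O)) hφ (∑ᶠ n, (-1 : ℤ) ^ n • r n)) ∧
        ∀ ψ : AbelianizedRing (IsotropyRing (HoOrbitCat O)) →+ IsoGroup (HoOrbitCat O),
          (∀ T, ψ (abMk _ (IsotropyRing.of (𝟙 T))) = isoClass T) →
            S.eulerCharacteristic = ψ (∑ᶠ n, (-1 : ℤ) ^ n • r n) := by
  refine ⟨exists_abelianizedRing_hom _, fun r hr => ?_⟩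
  obtain ⟨hfin, heq⟩ := S.eulerCharacteristic_eq hO r hr
  refine ⟨hfin, fun hφ => heq _ fun T => ?_, heq⟩
  change augmentation (HoOrbitCat O) (IsotropyRing.of (𝟙 T)) = isoClass T
  rw [augmentation, IsotropyRing.lift_of]
  simp
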